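/- Let $n\ge 0$ and let $H\in\mathbb C[x,y]$ be a polynomial of degree $n+1$ whose homogeneous part of degree $n+1$ is square-free. Assume that the $N=n^2$ forms $x^{i-1}y^{j}\,dx$, $1\le i,j\le n$, form a basis over $\mathbb C[h]$ of the Petrov module $\Lambda^1/(dH\cdot\mathbb C[x,y]+d\,\mathbb C[x,y])$ of polynomial 1-forms (where $h$ acts as multiplication by $H$), and that the affine curve $\Gamma_H=\{H=0\}\subset\mathbb C^2$ is smooth, i.e. $dH\neq 0$ at every point of it. Let $\omega_1,\dots,\omega_N$ be an enumeration of these forms and let $p_0\in\Gamma_H$. Let $\delta_1,\dots,\delta_N\in\pi_1(\Gamma_H,p_0)$ be elements whose homology classes form a $\mathbb Z$-basis of $H_1(\Gamma_H,\mathbb Z)=\pi_1(\Gamma_H,p_0)^{\mathrm{ab}}$ (for instance, free generators of the free group $\pi_1(\Gamma_H,p_0)$). For a piecewise $C^1$ path $\gamma:[0,1]\to\mathbb C^2$ put $$\int_\gamma\omega_{i_1}\cdots\omega_{i_k}=\int_0^1\Big(\int_0^{s_1}\Big(\cdots\Big(\int_0^{s_{k-1}}\gamma^*\omega_{i_k}\Big)\cdots\Big)\gamma^*\omega_{i_2}\Big)\gamma^*\omega_{i_1},$$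 the integral of the empty word being $1$. Let $U$ be the semigroup algebra over $\mathbb C$ of the free semigroup with unit $e$ on $X_1,\dots,X_N$, let $\mathfrak m=\langle X_1,\dots,X_N\rangle$, and for an integer $K\ge 0$ and $\delta\in\pi_1(\Gamma_H,p_0)$ let $\varphi_K(\delta)$ be the image in $U/\mathfrak m^{K+1}U$ of $$\varphi(\delta)=e+\sum_{k\ge 1}\ \sum_{1\le i_1,\dots,i_k\le N}\Big(\oint_\delta\omega_{i_1}\cdots\omega_{i_k}\Big)X_{i_1}\cdots X_{i_k}.$$ Then: 1. Every element of $\pi_1(\Gamma_H,p_0)$ is represented by a piecewise $C^1$ loop in $\Gamma_H$, and the iterated integrals of polynomial 1-forms over piecewise $C^1$ loops in $\Gamma_H$ based at $p_0$ depend only on the homotopy class of the loop; so $\varphi_K$ is well defined. Moreover $\varphi_K(1)=1$ and $\varphi_K(\alpha\beta)=\varphi_K(\alpha)\varphi_K(\beta)$ for all $\alpha,\beta\in\pi_1(\Gamma_H,p_0)$, where $\alpha\beta$ is the class of the loop that runs first along $\beta$ and then along $\alpha$. 2. The elements $\varphi_K(\delta_{j_1}\cdots\delta_{j_k})$, indexed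 by all words $(j_1,\dots,j_k)$ with $0\le k\le K$ and $1\le j_r\le N$, form a basis of the complex vector space $U/\mathfrak m^{K+1}U$. 3. The basic iterated integral matrix $$S_K=\Big(\oint_{\delta_{j_1}\cdots\delta_{j_k}}\omega_{i_1}\cdots\omega_{i_l}\Big),\qquad 0\le k,l\le K,\quad 1\le j_r,i_s\le N,$$ with rows indexed by the words $(i_1,\dots,i_l)$ and columns by the words $(j_1,\dots,j_k)$, is non-degenerate: $\det S_K\ne 0$. -/

import Mathlib

open scoped unitInterval Polynomial

namespace ChenPlane

noncomputable section

/-! ### Polynomial one-forms on the affine plane and the Petrov module -/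

/-- The ring of polynomials in two variables, `x = X 0` and `y = X 1`. -/
abbrev Poly2 : Type := MvPolynomial (Fin 2) ℂ

/-- Polynomial one-forms `P dx + Q dy`, stored as the pair of coefficients `(P, Q)`. -/
abbrev OneForm : Type := Fin 2 → Poly2

/-- The differential `dg` of a polynomial. -/
def extd (g : Poly2) : OneForm := fun i => MvPolynomial.pderiv i g

/-- The space of polynomial one-forms, regarded as a module over `ℂ[h]` on which the variable `h`
acts as multiplication by `H`. -/
def FormOver (_H : Poly2) : Type := OneForm

instance (H : Poly2) : AddCommGroup (FormOver H) := inferInstanceAs (AddCommGroup OneForm)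

instance (H : Poly2) : Module ℂ[X] (FormOver H) :=
  Module.compHom OneForm (Polynomial.aeval H : ℂ[X] →ₐ[ℂ] Poly2).toRingHom

/-- The relatively exact forms `f dH + dg`; they are stable under multiplication by `H`. -/
def relExact (H : Poly2) : Submodule ℂ[X] (FormOver H) where
  carrier := {θ | ∃ f g : Poly2, θ = f • extd H + extd g}
  zero_mem' := ⟨0, 0, by
    funext i
    change (0 : Poly2) = 0 * extd H i + MvPolynomial.pderiv i 0
    simp⟩
  add_mem' := by
    rintro _ _ ⟨f, g, rfl⟩ ⟨f', g', rfl⟩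
    refine ⟨f + f', g + g', ?_⟩
    funext i
    change (f * extd H i + MvPolynomial.pderiv i g) + (f' * extd H i + MvPolynomial.pderiv i g')
      = (f + f') * extd H i + MvPolynomial.pderiv i (g + g')
    rw [map_add]
    ring
  smul_mem' := by
    rintro q _ ⟨f, g, rfl⟩
    refine ⟨Polynomial.aeval H q * f - g * Polynomial.aeval H (Polynomial.derivative q),
      Polynomial.aeval H q * g, ?_⟩
    funext i
    change Polynomial.aeval H q * (f * MvPolynomial.pderiv i H + MvPolynomial.pderiv i g)
      = (Polynomial.aeval H q * f - g * Polynomial.aeval H (Polynomial.derivative q))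
          * MvPolynomial.pderiv i H + MvPolynomial.pderiv i (Polynomial.aeval H q * g)
    rw [Derivation.leibniz, Derivation.map_aeval]
    simp only [smul_eq_mul]
    ring

/-- The Petrov module of `H`: polynomial one-forms modulo the forms `f dH + dg`, over `ℂ[h]`. -/
abbrev PetrovModule (H : Poly2) : Type := FormOver H ⧸ relExact H

/-- The basic forms `x^(i-1) y^j dx`, `1 ≤ i, j ≤ n`; here the pair `(i, j)` is counted from zero,
so that `(i, j)` stands for `x^i y^(j+1) dx`. -/
def basicForm {n : ℕ} (ij : Fin n × Fin n) : OneForm :=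
  ![MvPolynomial.X 0 ^ (ij.1 : ℕ) * MvPolynomial.X 1 ^ ((ij.2 : ℕ) + 1), 0]

/-- The class of a polynomial one-form in the Petrov module. -/
def petrovClass (H : Poly2) (θ : OneForm) : PetrovModule H :=
  (relExact H).mkQ (show FormOver H from θ)

/-- The `n²` basic forms are a basis of the Petrov module of `H` over `ℂ[h]`. -/
def BasicFormsPetrovBasis (n : ℕ) (H : Poly2) : Prop :=
  LinearIndependent ℂ[X] (fun ij : Fin n × Fin n => petrovClass H (basicForm ij)) ∧
    Submodule.span ℂ[X] (Set.range fun ij : Fin n × Fin n => petrovClass H (basicForm ij)) = ⊤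

/-! ### The affine curve and iterated integrals along it -/

/-- The affine curve `Γ_H = {H = 0}` in `ℂ²`. -/
abbrev Curve (H : Poly2) : Type := {p : Fin 2 → ℂ // MvPolynomial.eval p H = 0}

/-- `dH` does not vanish at any point of `{H = 0}`. -/
def IsSmoothCurve (H : Poly2) : Prop :=
  ∀ p : Fin 2 → ℂ, MvPolynomial.eval p H = 0 →
    ∃ i, MvPolynomial.eval p (MvPolynomial.pderiv i H) ≠ 0

/-- `c` is piecewise continuously differentiable on `[0, 1]`: off a finite set `P` of break points,
it is `C¹` up to the end points on every piece. -/
def PiecewiseC1 (c : ℝ → Fin 2 → ℂ) : Prop :=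
  ContinuousOn c (Set.Icc 0 1) ∧
    ∃ P : Finset ℝ, ∀ a b : ℝ, 0 ≤ a → a < b → b ≤ 1 →
      (∀ t ∈ P, t ∉ Set.Ioo a b) → ContDiffOn ℝ 1 c (Set.Icc a b)

/-- The coefficient of `c^* θ` with respect to `ds`. -/
def pullback (c : ℝ → Fin 2 → ℂ) (θ : OneForm) (s : ℝ) : ℂ :=
  ∑ i, MvPolynomial.eval (c s) (θ i) * derivWithin (fun t => c t i) (Set.Icc 0 1) s

/-- The iterated integral of the word `ω₁ ω₂ … ω_k` over the part `c|_[0,t]`: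
`∫₀ᵗ (∫₀^{s₁} ( … ∫₀^{s_{k-1}} c^*ω_k … ) c^*ω₂) c^*ω₁`, the outermost integration being that
of `ω₁`. The empty word gives `1`. -/
def iterInt (c : ℝ → Fin 2 → ℂ) : List OneForm → ℝ → ℂ
  | [], _ => 1
  | θ :: ws, t => ∫ s in (0 : ℝ)..t, iterInt c ws s * pullback c θ s

variable {H : Poly2} {p₀ : Curve H}

/-- A path on the curve, as a map from the line to `ℂ²` (constant outside `[0, 1]`). -/
def curveOf (γ : Path p₀ p₀) : ℝ → Fin 2 → ℂ := fun t => (γ.extend t : Curve H).1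

/-- The element of `π₁(Γ_H, p₀)` represented by a loop. -/
def loopClass (γ : Path p₀ p₀) : FundamentalGroup (Curve H) p₀ :=
  FundamentalGroup.fromPath (Path.Homotopic.Quotient.mk γ)

open scoped Classical in
/-- The iterated integral of a word of one-forms over a homotopy class `δ`: its value on a
piecewise `C¹` loop that represents `δ`. -/
def loopIterInt (δ : FundamentalGroup (Curve H) p₀) (ws : List OneForm) : ℂ :=
  if h : ∃ γ : Path p₀ p₀, PiecewiseC1 (curveOf γ) ∧ loopClass γ = δ then
    iterInt (curveOf h.choose) ws 1
  else 0

/-! ### The algebra `U`, its truncations and the Chen homomorphism -/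

/-- The semigroup algebra of the free semigroup with unit on `X_1, …, X_N`. -/
abbrev U (N : ℕ) : Type := MonoidAlgebra ℂ (FreeMonoid (Fin N))

/-- The monomial `X_{i_1} ⋯ X_{i_k}`. -/
def monomial {N : ℕ} (w : FreeMonoid (Fin N)) : U N := MonoidAlgebra.of ℂ (FreeMonoid (Fin N)) w

/-- The ideal `𝔪 = ⟨X_1, …, X_N⟩` of `U`. -/
def maxIdeal (N : ℕ) : Ideal (U N) :=
  Ideal.span (Set.range fun i : Fin N => monomial (FreeMonoid.of i))

theorem maxIdeal_mul_monomial {N : ℕ} (w : FreeMonoid (Fin N)) (a : U N) (ha : a ∈ maxIdeal N) :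
    a * monomial w ∈ maxIdeal N := by
  induction w using FreeMonoid.inductionOn' generalizing a with
  | one =>
    have h : (monomial 1 : U N) = 1 := map_one _
    rwa [h, mul_one]
  | of_mul i w ih =>
    have h : monomial (FreeMonoid.of i * w) = monomial (FreeMonoid.of i) * monomial w := by
      exact map_mul _ _ _
    rw [h, ← mul_assoc]
    exact ih _ (Ideal.mul_mem_left _ _ (Ideal.subset_span ⟨i, rfl⟩))

/-- The left ideal generated by the variables is two-sided. -/
instance maxIdeal_isTwoSided (N : ℕ) : (maxIdeal N).IsTwoSided where
  mul_mem_of_left {a} b ha := by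
    induction b using MonoidAlgebra.induction_on with
    | of w => exact maxIdeal_mul_monomial w a ha
    | add f g hf hg => rw [mul_add]; exact add_mem hf hg
    | smul r f hf =>
      rw [mul_smul_comm]
      have h : r • (a * f) = (algebraMap ℂ (U N) r) * (a * f) := Algebra.smul_def r (a * f)
      rw [h]
      exact Ideal.mul_mem_left _ _ hf

/-- The truncated algebra `U / 𝔪^(K+1) U`. -/
abbrev UTrunc (N K : ℕ) : Type := U N ⧸ maxIdeal N ^ (K + 1)

/-- The completion of `U`: formal series in the non-commuting variables `X_1, …, X_N`, given by
their coefficients. -/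
abbrev UHat (N : ℕ) : Type := FreeMonoid (Fin N) → ℂ

/-- Words of length at most `K` in an alphabet of `N` letters. -/
abbrev Word (N K : ℕ) : Type := Σ k : Fin (K + 1), Fin k → Fin N

/-- The letters of a word, in order. -/
def Word.letters {N K : ℕ} (w : Word N K) : List (Fin N) := List.ofFn w.2

/-- The projection `j^K` of a formal series to `U / 𝔪^(K+1) U`. -/
def trunc {N : ℕ} (K : ℕ) (s : UHat N) : UTrunc N K :=
  Ideal.Quotient.mk (maxIdeal N ^ (K + 1))
    (∑ w : Word N K, s (FreeMonoid.ofList w.letters) • monomial (FreeMonoid.ofList w.letters))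

/-- The Chen map `φ(δ) = e + ∑ (∮_δ ω_{i_1} ⋯ ω_{i_k}) X_{i_1} ⋯ X_{i_k}`. -/
def chen {N : ℕ} (ω : Fin N → OneForm) (δ : FundamentalGroup (Curve H) p₀) : UHat N :=
  fun w => loopIterInt δ (w.toList.map ω)

/-- The truncated Chen map `φ_K = j^K φ`. -/
def chenTrunc {N : ℕ} (ω : Fin N → OneForm) (K : ℕ) (δ : FundamentalGroup (Curve H) p₀) :
    UTrunc N K :=
  trunc K (chen ω δ)

/-- The product `δ_{j_1} ⋯ δ_{j_k}` in `π₁(Γ_H, p₀)`. As everywhere in Mathlib, `a * b` in the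
fundamental group is the class of the loop that runs along `b` first and then along `a`. -/
def wordProd {N K : ℕ} (δ : Fin N → FundamentalGroup (Curve H) p₀) (w : Word N K) :
    FundamentalGroup (Curve H) p₀ :=
  (w.letters.map δ).prod

/-- The basic iterated integral matrix `S_K`: rows are words in the forms, columns are words in the
loops, of length at most `K`. -/
def iterMatrix {N : ℕ} (ω : Fin N → OneForm) (δ : Fin N → FundamentalGroup (Curve H) p₀) (K : ℕ) :
    Matrix (Word N K) (Word N K) ℂ :=
  Matrix.of fun u w => loopIterInt (wordProd δ w) (u.letters.map ω)

/-- The classes of the loops `δ_j` form a `ℤ`-basis of `H₁(Γ_H, ℤ)`, the abelianization of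
`π₁(Γ_H, p₀)`. -/
def IsHomologyBasis {N : ℕ} (δ : Fin N → FundamentalGroup (Curve H) p₀) : Prop :=
  LinearIndependent ℤ (fun j => Additive.ofMul (Abelianization.of (δ j))) ∧
    Submodule.span ℤ (Set.range fun j => Additive.ofMul (Abelianization.of (δ j))) = ⊤

end

end ChenPlane

namespace ChenPlane

noncomputable section

/-! ### The truncated free algebra -/

section Truncation

variable {N : ℕ}

/-! The iterated integrals along a path are the parallel transport of a nilpotent connection on
functions of words, in which the differential of the component at `θ :: ws` is the component at `ws`
times `θ`. On a curve every such connection is flat, so its flat sections form a covering of the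
curve, and unique lifting makes the integrals homotopy invariant (`iterInt_eq_of_homotopic`).
Cutting a concatenated path at the junction cuts each word into a prefix and a suffix
(`iterInt_second_half`). This is exactly the product in the free algebra, so the truncated Chen map
is multiplicative.

Modulo terms of degree two, the image of `δ_j` is `1` plus the linear form whose coefficients are
the periods of the `ω_i`. If the period matrix is invertible, the differences `φ(δ_j) - 1` generate
the graded pieces of the truncated algebra, so products of at most `K` generators span it
(`span_pow_sup_degGE`). There are as many words as dimensions, hence these products form a basis,
and `S_K` is its coordinate matrix in the monomials.

Invertibility of the period matrix (`isUnit_det_period`) is the geometric core. A relation among its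
rows is a constant combination `θ` of the basic forms whose integrals over a homology basis vanish.
Then all periods of `θ` vanish, and since the curve is connected, `θ` has a potential `F` on it.
Because `dF` is polynomial, `F` grows polynomially; its traces over the fibres of a linear
projection are therefore polynomials, and Lagrange interpolation shows that `F` is the restriction
of a polynomial `f` (`HasDifferential.exists_polynomial`). Now `θ - df` vanishes on tangent lines,
and smoothness gives `θ = H η + b dH + df`. So the Petrov class of `θ` is divisible by `h`, which is
impossible for a nonzero constant combination of a basis over `ℂ[h]`.

The argument needs `H` irreducible. A factorization `H = AB` on a smooth curve has factors without
common zeros, and square-freeness of the top form excludes common zeros at infinity, contradicting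
Bézout (`irreducible_of_smooth`). Connectedness then follows from the same potential theorem,
applied to the indicator function of a path component. -/

theorem monomial_mul (v w : FreeMonoid (Fin N)) :
    (monomial (v * w) : U N) = monomial v * monomial w :=
  map_mul _ _ _

theorem monomial_one : (monomial 1 : U N) = 1 :=
  map_one _

open scoped Classical in
theorem coeff_monomial (v w : FreeMonoid (Fin N)) :
    (monomial v : U N).coeff w = if v = w then 1 else 0 := by
  rw [monomial, MonoidAlgebra.of_apply, MonoidAlgebra.coeff_single, Finsupp.single_apply]

/-- The span of the monomials of degree at least `k`. -/
def degGE (N k : ℕ) : Submodule ℂ (U N) :=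
  Submodule.span ℂ {a | ∃ w : FreeMonoid (Fin N), k ≤ w.length ∧ a = monomial w}

theorem monomial_mem_degGE {k : ℕ} {w : FreeMonoid (Fin N)} (h : k ≤ w.length) :
    monomial w ∈ degGE N k :=
  Submodule.subset_span ⟨w, h, rfl⟩

theorem degGE_zero : degGE N 0 = ⊤ := by
  rw [eq_top_iff]
  rintro a -
  induction a using MonoidAlgebra.induction_on with
  | of w => exact monomial_mem_degGE (Nat.zero_le _)
  | add f g hf hg => exact add_mem hf hg
  | smul r f hf => exact Submodule.smul_mem _ _ hf

theorem mul_mem_degGE {j k : ℕ} {a b : U N} (ha : a ∈ degGE N j) (hb : b ∈ degGE N k) :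
    a * b ∈ degGE N (j + k) := by
  have h : degGE N j * degGE N k ≤ degGE N (j + k) := by
    rw [degGE, degGE, Submodule.span_mul_span, Submodule.span_le]
    rintro _ ⟨_, ⟨v, hv, rfl⟩, _, ⟨w, hw, rfl⟩, rfl⟩
    change monomial v * monomial w ∈ _
    rw [← monomial_mul]
    exact monomial_mem_degGE (by rw [FreeMonoid.length_mul]; omega)
  exact h (Submodule.mul_mem_mul ha hb)

theorem coeff_eq_zero_of_mem_degGE {k : ℕ} {a : U N} (ha : a ∈ degGE N k)
    {w : FreeMonoid (Fin N)} (hw : w.length < k) : a.coeff w = 0 := by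
  induction ha using Submodule.span_induction with
  | mem x hx =>
    obtain ⟨v, hv, rfl⟩ := hx
    rw [coeff_monomial, if_neg]
    rintro rfl
    omega
  | zero => simp
  | add x y _ _ hx hy => simp [hx, hy]
  | smul c x _ hx => simp [hx]

theorem monomial_mem_pow {k : ℕ} (w : FreeMonoid (Fin N)) (h : k ≤ w.length) :
    monomial w ∈ maxIdeal N ^ k := by
  induction w using FreeMonoid.inductionOn' generalizing k with
  | one =>
    obtain rfl : k = 0 := by simpa using h
    rw [Submodule.pow_zero, Ideal.one_eq_top]
    exact Submodule.mem_top
  | of_mul i w ih =>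
    rcases k with _ | k
    · rw [Submodule.pow_zero, Ideal.one_eq_top]
      exact Submodule.mem_top
    rw [monomial_mul, Ideal.IsTwoSided.pow_succ]
    rw [FreeMonoid.length_mul, FreeMonoid.length_of] at h
    have hi : monomial (FreeMonoid.of i) ∈ maxIdeal N := Ideal.subset_span ⟨i, rfl⟩
    have hw : monomial w ∈ maxIdeal N ^ k := ih (by omega)
    exact Ideal.mul_mem_mul hi hw

/-- Replaces powers of the ideal by a linear condition on monomials, so that membership can be
tested on coefficients. Arbitrary ring coefficients cause no trouble: they lie in `degGE N 0`, and
degrees add. -/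
theorem mem_maxIdeal_pow {k : ℕ} {a : U N} : a ∈ maxIdeal N ^ k ↔ a ∈ degGE N k := by
  constructor
  · induction k generalizing a with
    | zero => simp [degGE_zero]
    | succ k ih =>
      rw [Submodule.pow_succ]
      intro ha
      refine Submodule.mul_induction_on ha (fun r hr s hs => ?_) (fun x y hx hy => add_mem hx hy)
      refine mul_mem_degGE (ih hr) ?_
      induction hs using Submodule.span_induction with
      | mem x hx =>
        obtain ⟨i, rfl⟩ := hx
        exact monomial_mem_degGE (by simp)
      | zero => exact zero_mem _
      | add x y _ _ hx hy => exact add_mem hx hy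
      | smul c x _ hx =>
        have := mul_mem_degGE (degGE_zero (N := N) ▸ Submodule.mem_top : c ∈ degGE N 0) hx
        simpa using this
  · intro ha
    induction ha using Submodule.span_induction with
    | mem x hx =>
      obtain ⟨w, hw, rfl⟩ := hx
      exact monomial_mem_pow w hw
    | zero => exact zero_mem _
    | add x y _ _ hx hy => exact add_mem hx hy
    | smul c x _ hx =>
      rw [Algebra.smul_def]
      exact Ideal.mul_mem_left _ _ hx

theorem mem_degGE_iff {k : ℕ} {a : U N} :
    a ∈ degGE N k ↔ ∀ w : FreeMonoid (Fin N), w.length < k → a.coeff w = 0 := by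
  refine ⟨fun h w hw => coeff_eq_zero_of_mem_degGE h hw, fun h => ?_⟩
  have ha : a = ∑ w ∈ a.coeff.support, a.coeff w • monomial w := by
    apply MonoidAlgebra.coeff_injective
    ext v
    simp only [MonoidAlgebra.coeff_sum, MonoidAlgebra.coeff_smul, Finsupp.finsetSum_apply,
      Finsupp.smul_apply, coeff_monomial, smul_eq_mul, mul_ite, mul_one, mul_zero]
    rw [Finset.sum_eq_single v (fun w _ hw => if_neg hw) (fun hv => by
      rw [if_pos rfl]; exact Finsupp.notMem_support_iff.1 hv), if_pos rfl]
  rw [ha]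
  refine Submodule.sum_mem _ fun w _ => ?_
  rcases lt_or_ge w.length k with hw | hw
  · rw [h w hw, zero_smul]
    exact zero_mem _
  · exact Submodule.smul_mem _ _ (monomial_mem_degGE hw)

theorem mk_eq_mk_iff {K : ℕ} {a b : U N} :
    (Ideal.Quotient.mk (maxIdeal N ^ (K + 1)) a = Ideal.Quotient.mk (maxIdeal N ^ (K + 1)) b) ↔
      ∀ w : FreeMonoid (Fin N), w.length ≤ K → a.coeff w = b.coeff w := by
  rw [Ideal.Quotient.eq, mem_maxIdeal_pow, mem_degGE_iff]
  simp [sub_eq_zero]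

theorem Word.length_letters {K : ℕ} (w : Word N K) : w.letters.length = w.1 := by
  simp [Word.letters]

theorem Word.letters_injective {K : ℕ} : Function.Injective (Word.letters : Word N K → _) := by
  rintro ⟨k, f⟩ ⟨l, g⟩ h
  have hk : k = l := by
    have := congrArg List.length h
    simp only [Word.length_letters] at this
    exact Fin.ext this
  subst hk
  simpa [Word.letters] using h

theorem Word.exists_letters {K : ℕ} (l : List (Fin N)) (h : l.length ≤ K) :
    ∃ w : Word N K, w.letters = l :=
  ⟨⟨⟨l.length, by omega⟩, l.get⟩, by simp [Word.letters]⟩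

/-- The noncommutative polynomial with prescribed coefficients on the words of length at most
`K`. -/
def truncPoly (K : ℕ) (s : UHat N) : U N :=
  ∑ w : Word N K, s (FreeMonoid.ofList w.letters) • monomial (FreeMonoid.ofList w.letters)

theorem coeff_truncPoly {K : ℕ} (s : UHat N) (w : FreeMonoid (Fin N)) (hw : w.length ≤ K) :
    (truncPoly K s).coeff w = s w := by
  obtain ⟨v, hv⟩ := Word.exists_letters (K := K) w.toList hw
  have key : ∀ u : Word N K, FreeMonoid.ofList u.letters = w ↔ u = v := fun u => by
    rw [← Word.letters_injective.eq_iff, hv]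
    exact Iff.rfl
  have hvw : FreeMonoid.ofList v.letters = w := (key v).2 rfl
  simp only [truncPoly, MonoidAlgebra.coeff_sum, MonoidAlgebra.coeff_smul,
    Finsupp.finsetSum_apply, Finsupp.smul_apply, coeff_monomial, key, smul_eq_mul, mul_ite,
    mul_one, mul_zero]
  rw [Finset.sum_ite_eq' Finset.univ v]
  simp [hvw]

theorem trunc_eq_mk {K : ℕ} (s : UHat N) :
    trunc K s = Ideal.Quotient.mk (maxIdeal N ^ (K + 1)) (truncPoly K s) := rfl

theorem trunc_eq_one {K : ℕ} {s : UHat N} (h1 : s 1 = 1) (h : ∀ w, w ≠ 1 → s w = 0) :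
    trunc K s = 1 := by
  rw [trunc_eq_mk, ← map_one (Ideal.Quotient.mk _), mk_eq_mk_iff]
  intro w hw
  rw [coeff_truncPoly s w hw, ← monomial_one, coeff_monomial]
  split_ifs with hw1
  · rw [← hw1, h1]
  · exact h w (Ne.symm hw1)

/-- Factorizations of a word in a free monoid are its cuts into prefix and suffix. Indexing them by
the cut position gives the same shape as the composition formula for iterated integrals. -/
theorem coeff_mul_eq_sum (a b : U N) (w : FreeMonoid (Fin N)) :
    (a * b).coeff w = ∑ k ∈ Finset.range (w.length + 1),
      a.coeff (FreeMonoid.ofList (w.toList.take k)) *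
        b.coeff (FreeMonoid.ofList (w.toList.drop k)) := by
  classical
  rw [MonoidAlgebra.coeff_mul_antidiag a b w ((Finset.range (w.length + 1)).image fun k =>
    (FreeMonoid.ofList (w.toList.take k), FreeMonoid.ofList (w.toList.drop k)))]
  · rw [Finset.sum_image]
    intro k hk l hl hkl
    have h := congrArg (fun p : FreeMonoid (Fin N) × FreeMonoid (Fin N) => p.1.toList.length) hkl
    have hw : w.toList.length = w.length := rfl
    simp only [FreeMonoid.toList_ofList, List.length_take, Finset.coe_range, Set.mem_Iio, hw]
      at h hk hl
    omega
  · rintro ⟨u, v⟩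
    simp only [Finset.mem_image, Finset.mem_range, Prod.mk.injEq]
    constructor
    · rintro ⟨k, -, rfl, rfl⟩
      rw [← FreeMonoid.ofList_append, List.take_append_drop]
      rfl
    · rintro rfl
      refine ⟨u.length, by rw [FreeMonoid.length_mul]; omega, ?_, ?_⟩
      · rw [FreeMonoid.toList_mul, FreeMonoid.length, List.take_left]; rfl
      · rw [FreeMonoid.toList_mul, FreeMonoid.length, List.drop_left]; rfl

/-- Prefixes and suffixes of a word of length at most `K` are again that short, so truncation loses
nothing that enters the product. -/
theorem trunc_mul {K : ℕ} {s t r : UHat N}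
    (h : ∀ w : FreeMonoid (Fin N), r w = ∑ k ∈ Finset.range (w.length + 1),
      s (FreeMonoid.ofList (w.toList.take k)) * t (FreeMonoid.ofList (w.toList.drop k))) :
    trunc K r = trunc K s * trunc K t := by
  rw [trunc_eq_mk, trunc_eq_mk, trunc_eq_mk, ← map_mul, mk_eq_mk_iff]
  intro w hw
  rw [coeff_truncPoly r w hw, coeff_mul_eq_sum, h w]
  have hw' : w.toList.length = w.length := rfl
  refine Finset.sum_congr rfl fun k _ => ?_
  rw [coeff_truncPoly s, coeff_truncPoly t]
  · change (w.toList.drop k).length ≤ K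
    rw [List.length_drop]
    omega
  · change (w.toList.take k).length ≤ K
    rw [List.length_take]
    omega

/-- The coordinates with respect to the monomials of degree at most `K`. -/
def truncEquiv (N K : ℕ) : (Word N K → ℂ) ≃ₗ[ℂ] UTrunc N K :=
  LinearEquiv.ofBijective
    ((Ideal.Quotient.mkₐ ℂ (maxIdeal N ^ (K + 1))).toLinearMap ∘ₗ
      Fintype.linearCombination ℂ
        (fun w : Word N K => (monomial (FreeMonoid.ofList w.letters) : U N))) (by
    have hT : ∀ s : UHat N, ((Ideal.Quotient.mkₐ ℂ (maxIdeal N ^ (K + 1))).toLinearMap ∘ₗ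
        Fintype.linearCombination ℂ
        (fun w : Word N K => (monomial (FreeMonoid.ofList w.letters) : U N)))
          (fun w => s (FreeMonoid.ofList w.letters)) =
        Ideal.Quotient.mk (maxIdeal N ^ (K + 1)) (truncPoly K s) := fun s => by
      simp [Fintype.linearCombination_apply, truncPoly]
    -- Extension by zero to long words, so that the coefficient formula for `truncPoly` settles both
    -- injectivity and surjectivity.
    have hext : ∀ c : Word N K → ℂ, ∃ s : UHat N, c = fun w => s (FreeMonoid.ofList w.letters) :=
      fun c => ⟨fun w => if h : ∃ v : Word N K, v.letters = w.toList then c h.choose else 0, by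
        funext w
        have h : ∃ v : Word N K, v.letters = (FreeMonoid.ofList w.letters).toList := ⟨w, rfl⟩
        beta_reduce
        rw [dif_pos h]
        exact congrArg c (Word.letters_injective h.choose_spec).symm⟩
    constructor
    · intro c d hcd
      obtain ⟨s, rfl⟩ := hext c
      obtain ⟨t, rfl⟩ := hext d
      rw [hT, hT, mk_eq_mk_iff] at hcd
      funext w
      have hw : (FreeMonoid.ofList w.letters).length ≤ K :=
        (Word.length_letters w).le.trans (Nat.lt_succ_iff.1 w.1.2)
      have := hcd _ hw
      rwa [coeff_truncPoly _ _ hw, coeff_truncPoly _ _ hw] at this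
    · intro a
      obtain ⟨a, rfl⟩ := Ideal.Quotient.mk_surjective a
      refine ⟨fun w => a.coeff (FreeMonoid.ofList w.letters), ?_⟩
      rw [hT fun w => a.coeff w, mk_eq_mk_iff]
      exact fun w hw => coeff_truncPoly _ w hw)

theorem truncEquiv_apply {K : ℕ} (s : UHat N) :
    truncEquiv N K (fun w => s (FreeMonoid.ofList w.letters)) = trunc K s := by
  change Ideal.Quotient.mk _ (Fintype.linearCombination ℂ _ _) = _
  rw [Fintype.linearCombination_apply]
  rfl

/-! ### Products of generators -/

open scoped Pointwise in
-- Factors equal to `1` are dropped, which turns products of exactly `k` factors into words of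
-- length at most `k`.
theorem exists_list_of_mem_pow {A : Type*} [Monoid A] (x : Fin N → A) (k : ℕ) (a : A)
    (ha : a ∈ (insert 1 (Set.range x)) ^ k) :
    ∃ l : List (Fin N), l.length ≤ k ∧ a = (l.map x).prod := by
  induction k generalizing a with
  | zero =>
    rw [pow_zero, Set.mem_one] at ha
    exact ⟨[], by simp, by simp [ha]⟩
  | succ k ih =>
    rw [pow_succ'] at ha
    obtain ⟨b, hb, c, hc, rfl⟩ := Set.mem_mul.1 ha
    obtain ⟨l, hl, rfl⟩ := ih c hc
    rcases hb with rfl | ⟨i, rfl⟩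
    · exact ⟨l, by omega, by simp⟩
    · exact ⟨i :: l, by simpa using hl, by simp⟩

/-- Elements that agree with `1` plus an invertible linear substitution of the variables up to
second order generate the algebra modulo every power of the augmentation ideal. -/
theorem span_pow_sup_degGE (K : ℕ) (x : Fin N → U N) (M : Matrix (Fin N) (Fin N) ℂ)
    (hM : IsUnit M.det)
    (hx : ∀ j, x j - 1 - ∑ i, M i j • monomial (FreeMonoid.of i) ∈ degGE N 2) :
    Submodule.span ℂ (insert 1 (Set.range x)) ^ K ⊔ degGE N (K + 1) = ⊤ := by
  set P := Submodule.span ℂ (insert 1 (Set.range x)) with hP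
  set V := Submodule.span ℂ (Set.range fun j => x j - 1) with hV
  have hVP : V ≤ P := by
    rw [hV, Submodule.span_le]
    rintro _ ⟨j, rfl⟩
    exact sub_mem (Submodule.subset_span (Or.inr ⟨j, rfl⟩)) (Submodule.subset_span (Or.inl rfl))
  have h1P : (1 : Submodule ℂ (U N)) ≤ P :=
    Submodule.one_le.2 (Submodule.subset_span (Or.inl rfl))
  have hanti : ∀ {j k : ℕ}, j ≤ k → degGE N k ≤ degGE N j := fun hjk =>
    Submodule.span_mono fun a ⟨w, hw, ha⟩ => ⟨w, hjk.trans hw, ha⟩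
  -- Inverting `M` solves for each variable in terms of the `x j - 1`, up to second order.
  have hlin : ∀ i : Fin N, ∃ v ∈ V, monomial (FreeMonoid.of i) - v ∈ degGE N 2 := by
    intro i
    refine ⟨∑ j, (M⁻¹) j i • (x j - 1), Submodule.sum_mem _ fun j _ =>
      Submodule.smul_mem _ _ (Submodule.subset_span ⟨j, rfl⟩), ?_⟩
    have h := Submodule.sum_mem (degGE N 2) (t := Finset.univ) fun j _ =>
      Submodule.smul_mem _ ((M⁻¹) j i) (hx j)
    have h2 : ∑ j, (M⁻¹) j i • ∑ l, M l j • (monomial (FreeMonoid.of l) : U N) =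
        monomial (FreeMonoid.of i) := by
      simp_rw [Finset.smul_sum, smul_smul]
      rw [Finset.sum_comm]
      simp_rw [← Finset.sum_smul]
      have h3 : ∀ l, ∑ j, (M⁻¹) j i * M l j = (1 : Matrix (Fin N) (Fin N) ℂ) l i := fun l => by
        rw [← Matrix.mul_nonsing_inv M hM, Matrix.mul_apply]
        exact Finset.sum_congr rfl fun j _ => mul_comm _ _
      simp_rw [h3, Matrix.one_apply]
      simp
    have h4 : ∑ j, (M⁻¹) j i • (x j - 1 - ∑ l, M l j • (monomial (FreeMonoid.of l) : U N)) =
        ∑ j, (M⁻¹) j i • (x j - 1) - monomial (FreeMonoid.of i) := by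
      rw [← h2, ← Finset.sum_sub_distrib]
      simp_rw [smul_sub]
    rw [h4] at h
    simpa using neg_mem h
  -- Multiplying the linear approximations letter by letter approximates a word of degree `d` by an
  -- element of `V ^ d`, with error of degree `d + 1`.
  have hword : ∀ w : FreeMonoid (Fin N), ∃ v ∈ V ^ w.length,
      monomial w - v ∈ degGE N (w.length + 1) := by
    intro w
    induction w using FreeMonoid.inductionOn' with
    | one => exact ⟨1, by rw [FreeMonoid.length_one, pow_zero]; exact Submodule.one_le.1 le_rfl, by simp [monomial_one]⟩
    | of_mul i w ih =>
      obtain ⟨v, hv, hvm⟩ := hlin i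
      obtain ⟨u, hu, hum⟩ := ih
      have hlen : (FreeMonoid.of i * w).length = w.length + 1 := by
        rw [FreeMonoid.length_mul, FreeMonoid.length_of, add_comm]
      rw [hlen]
      refine ⟨v * u, by rw [pow_succ']; exact Submodule.mul_mem_mul hv hu, ?_⟩
      have hw : monomial w ∈ degGE N w.length := monomial_mem_degGE le_rfl
      have hv1 : v ∈ degGE N 1 := by
        have : monomial (FreeMonoid.of i) ∈ degGE N 1 := monomial_mem_degGE (by simp)
        simpa using sub_mem this (hanti (by norm_num) hvm)
      have e : monomial (FreeMonoid.of i * w) - v * u =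
          (monomial (FreeMonoid.of i) - v) * monomial w + v * (monomial w - u) := by
        rw [monomial_mul]; noncomm_ring
      rw [e]
      have m1 := mul_mem_degGE hvm hw
      have m2 := mul_mem_degGE hv1 hum
      rw [show 2 + w.length = w.length + 1 + 1 by omega] at m1
      rw [show 1 + (w.length + 1) = w.length + 1 + 1 by omega] at m2
      exact add_mem m1 m2
  -- Descending induction on the degree, starting at `K + 1`: each error term has higher degree and
  -- is already covered.
  have hdown : ∀ d ≤ K + 1, degGE N (K + 1 - d) ≤ P ^ K ⊔ degGE N (K + 1) := by
    intro d
    induction d with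
    | zero => intro _; exact le_sup_right
    | succ d ih =>
      intro hd
      have hle := ih (by omega)
      conv_lhs => rw [degGE]
      rw [Submodule.span_le]
      rintro _ ⟨w, hw, rfl⟩
      rcases hw.eq_or_lt with hw | hw
      · obtain ⟨v, hv, hvm⟩ := hword w
        -- Since `1 ∈ P`, the powers of `P` increase, so shorter products are also in `P ^ K`.
        have hvP : v ∈ P ^ K :=
          (pow_le_pow_right' h1P (by omega : w.length ≤ K)) (pow_le_pow_left' hVP _ hv)
        have := add_mem (Submodule.mem_sup_left hvP : v ∈ P ^ K ⊔ degGE N (K + 1))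
          (hle ((by omega : w.length + 1 = K + 1 - d) ▸ hvm))
        simpa using this
      · exact hle (monomial_mem_degGE (by omega))
  have := hdown (K + 1) le_rfl
  rw [Nat.sub_self, degGE_zero] at this
  exact top_le_iff.1 this

theorem span_words_eq_top (K : ℕ) (s : Fin N → UHat N) (hs : ∀ j, s j 1 = 1)
    (hdet : IsUnit (Matrix.of fun i j => s j (FreeMonoid.of i)).det) :
    Submodule.span ℂ (Set.range fun w : Word N K => (w.letters.map fun j => trunc K (s j)).prod)
      = ⊤ := by
  -- At `K = 0` the truncated polynomials no longer contain the linear terms, so the hypothesis on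
  -- the matrix cannot be used. The quotient is then one-dimensional and the empty product spans it.
  rcases K with _ | K
  · classical
    rw [eq_top_iff]
    rintro a -
    obtain ⟨c, rfl⟩ := (truncEquiv N 0).surjective a
    have hw0 : ∀ w : Word N 0, w.letters = [] := fun w => by
      have := Word.length_letters w
      have h0 : (w.1 : ℕ) = 0 := by have := w.1.2; omega
      exact List.length_eq_zero_iff.1 (this.trans h0)
    obtain ⟨w₀, -⟩ := Word.exists_letters (N := N) (K := 0) [] le_rfl
    have hc : c = c w₀ • fun _ => 1 := by
      funext w
      rw [Word.letters_injective ((hw0 w).trans (hw0 w₀).symm)]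
      simp
    have h1 : truncEquiv N 0 (fun _ => 1) = 1 := by
      have := truncEquiv_apply (N := N) (K := 0) (fun w => if w = 1 then 1 else 0)
      rw [trunc_eq_one (by simp) (by simp +contextual)] at this
      rw [← this]
      congr 1
      funext w
      rw [hw0 w]
      simp
    rw [hc, map_smul, h1]
    refine Submodule.smul_mem _ _ (Submodule.subset_span ⟨w₀, ?_⟩)
    simp [hw0]
  set K' := K + 1
  have h := span_pow_sup_degGE K' (fun j => truncPoly K' (s j)) _ hdet (fun j => by
    rw [mem_degGE_iff]
    intro w hw
    rw [MonoidAlgebra.coeff_sub, MonoidAlgebra.coeff_sub, Finsupp.sub_apply, Finsupp.sub_apply,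
      coeff_truncPoly _ _ (by omega), ← monomial_one, coeff_monomial]
    simp only [MonoidAlgebra.coeff_sum, MonoidAlgebra.coeff_smul, Finsupp.finsetSum_apply,
      Finsupp.smul_apply, coeff_monomial, Matrix.of_apply, smul_eq_mul, mul_ite, mul_one, mul_zero]
    interval_cases hl : w.length
    · obtain rfl := FreeMonoid.length_eq_zero.1 hl
      simp [hs]
    · obtain ⟨i, rfl⟩ := FreeMonoid.length_eq_one.1 hl
      simp [FreeMonoid.of_injective.eq_iff])
  rw [eq_top_iff]
  rintro a -
  obtain ⟨a, rfl⟩ := Ideal.Quotient.mk_surjective a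
  obtain ⟨p, hp, q, hq, rfl⟩ := Submodule.mem_sup.1 (h ▸ Submodule.mem_top : a ∈ _)
  have hq0 : Ideal.Quotient.mk (maxIdeal N ^ (K' + 1)) q = 0 :=
    Ideal.Quotient.eq_zero_iff_mem.2 (mem_maxIdeal_pow.2 hq)
  rw [map_add, hq0, add_zero]
  rw [Submodule.span_pow] at hp
  induction hp using Submodule.span_induction with
  | mem x hx =>
    obtain ⟨l, hl, rfl⟩ := exists_list_of_mem_pow _ _ _ hx
    obtain ⟨w, rfl⟩ := Word.exists_letters l hl
    refine Submodule.subset_span ⟨w, ?_⟩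
    rw [map_list_prod, List.map_map]
    rfl
  | zero => rw [map_zero]; exact zero_mem _
  | add x y _ _ hx hy => rw [map_add]; exact add_mem hx hy
  | smul c x _ hx =>
    have : Ideal.Quotient.mk (maxIdeal N ^ (K' + 1)) (c • x) =
      c • Ideal.Quotient.mk (maxIdeal N ^ (K' + 1)) x := rfl
    rw [this]
    exact Submodule.smul_mem _ _ hx

end Truncation

end

end ChenPlane

namespace ChenPlane

noncomputable section

/-! ### Piecewise `C¹` paths and iterated integrals -/

section PathIntegrals

open MeasureTheory intervalIntegral Set Filter Topology

theorem exists_Ioo_avoiding (P : Finset ℝ) {t : ℝ} (ht : t ∈ Ioo (0 : ℝ) 1) (htP : t ∉ P) :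
    ∃ a b, 0 ≤ a ∧ a < t ∧ t < b ∧ b ≤ 1 ∧ ∀ s ∈ P, s ∉ Ioo a b := by
  have hopen : IsOpen (Ioo (0 : ℝ) 1 ∩ (P : Set ℝ)ᶜ) :=
    isOpen_Ioo.inter P.finite_toSet.isClosed.isOpen_compl
  obtain ⟨ε, hε, hb⟩ := Metric.isOpen_iff.1 hopen t ⟨ht, htP⟩
  rw [Real.ball_eq_Ioo] at hb
  have h1 : t - ε / 2 ∈ Ioo (t - ε) (t + ε) := ⟨by linarith, by linarith⟩
  have h2 : t + ε / 2 ∈ Ioo (t - ε) (t + ε) := ⟨by linarith, by linarith⟩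
  refine ⟨t - ε / 2, t + ε / 2, (hb h1).1.1.le, by linarith, by linarith, (hb h2).1.2.le, ?_⟩
  intro s hs hs'
  exact (hb (⟨by linarith [hs'.1], by linarith [hs'.2]⟩ : s ∈ Ioo (t - ε) (t + ε))).2 hs

theorem PiecewiseC1.exists_hasDerivAt {c : ℝ → Fin 2 → ℂ} (hc : PiecewiseC1 c) :
    ∃ P : Finset ℝ, ∀ t ∈ Ioo (0 : ℝ) 1, t ∉ P →
      HasDerivAt c (fun i => derivWithin (fun t => c t i) (Icc 0 1) t) t := by
  obtain ⟨-, P, hP⟩ := hc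
  refine ⟨P, fun t ht htP => ?_⟩
  obtain ⟨a, b, ha, hat, htb, hb, hab⟩ := exists_Ioo_avoiding P ht htP
  have hd : DifferentiableAt ℝ c t :=
    ((hP a b ha (hat.trans htb) hb hab).differentiableOn one_ne_zero).differentiableAt
      (Icc_mem_nhds hat htb)
  rw [hasDerivAt_pi]
  intro i
  have hi : DifferentiableAt ℝ (fun t => c t i) t := differentiableAt_pi.1 hd i
  rw [derivWithin_of_mem_nhds (Icc_mem_nhds ht.1 ht.2)]
  exact hi.hasDerivAt

/-- Induction on the number of break points inside the interval, splitting at one of them. On a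
piece without break points the derivative is continuous up to the ends; values at the end points do
not affect the integral. -/
theorem PiecewiseC1.intervalIntegrable_derivWithin {c : ℝ → Fin 2 → ℂ} (hc : PiecewiseC1 c)
    (i : Fin 2) {a b : ℝ} (ha : 0 ≤ a) (hab : a ≤ b) (hb : b ≤ 1) :
    IntervalIntegrable (derivWithin (fun t => c t i) (Icc 0 1)) volume a b := by
  classical
  obtain ⟨-, P, hP⟩ := hc
  induction hn : (P.filter (· ∈ Ioo a b)).card using Nat.strong_induction_on generalizing a b with
  | _ n ih =>
  rcases hab.eq_or_lt with rfl | hlt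
  · exact IntervalIntegrable.refl
  by_cases hex : ∃ t ∈ P, t ∈ Ioo a b
  · obtain ⟨t, htP, ht⟩ := hex
    have hmem : t ∈ P.filter (· ∈ Ioo a b) := Finset.mem_filter.2 ⟨htP, ht⟩
    have hcard : ∀ u v, a ≤ u → v ≤ b → t ∉ Ioo u v → (P.filter (· ∈ Ioo u v)).card < n := by
      intro u v hu hv htuv
      rw [← hn]
      refine Finset.card_lt_card (Finset.ssubset_iff_subset_ne.2 ⟨fun s hs => ?_, fun h => ?_⟩)
      · rw [Finset.mem_filter] at hs ⊢
        exact ⟨hs.1, hu.trans_lt hs.2.1, hs.2.2.trans_le hv⟩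
      · rw [← h, Finset.mem_filter] at hmem
        exact htuv hmem.2
    exact (ih _ (hcard a t le_rfl ht.2.le (fun h => lt_irrefl _ h.2)) ha ht.1.le
        (ht.2.le.trans hb) rfl).trans
      (ih _ (hcard t b ht.1.le le_rfl (fun h => lt_irrefl _ h.1)) (ha.trans ht.1.le) ht.2.le hb rfl)
  · push Not at hex
    have hC := hP a b ha hlt hb hex
    have hCi : ContDiffOn ℝ 1 (fun t => c t i) (Icc a b) := contDiffOn_pi.1 hC i
    have hcont : ContinuousOn (derivWithin (fun t => c t i) (Icc a b)) (Icc a b) :=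
      hCi.continuousOn_derivWithin (uniqueDiffOn_Icc hlt) le_rfl
    have hint : IntervalIntegrable (derivWithin (fun t => c t i) (Icc a b)) volume a b :=
      ContinuousOn.intervalIntegrable (by rwa [uIcc_of_le hab])
    refine hint.congr_uIoo fun t ht => ?_
    rw [uIoo_of_le hab] at ht
    rw [derivWithin_of_mem_nhds (Icc_mem_nhds ht.1 ht.2),
      derivWithin_of_mem_nhds (Icc_mem_nhds (ha.trans_lt ht.1) (ht.2.trans_le hb))]

theorem continuous_eval_mvPolynomial (p : Poly2) :
    Continuous fun x : Fin 2 → ℂ => MvPolynomial.eval x p :=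
  MvPolynomial.continuous_eval p

theorem PiecewiseC1.intervalIntegrable_mul_pullback {c : ℝ → Fin 2 → ℂ} (hc : PiecewiseC1 c)
    (θ : OneForm) {g : ℝ → ℂ} (hg : ContinuousOn g (Icc 0 1)) {a b : ℝ} (ha : a ∈ Icc (0 : ℝ) 1)
    (hb : b ∈ Icc (0 : ℝ) 1) :
    IntervalIntegrable (fun s => g s * pullback c θ s) volume a b := by
  have hsub : uIcc a b ⊆ Icc 0 1 := fun x hx =>
    ⟨(le_min ha.1 hb.1).trans hx.1, hx.2.trans (max_le ha.2 hb.2)⟩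
  have hd : ∀ i, IntervalIntegrable (derivWithin (fun t => c t i) (Icc 0 1)) volume a b := by
    intro i
    rcases le_total a b with h | h
    · exact hc.intervalIntegrable_derivWithin i ha.1 h hb.2
    · exact (hc.intervalIntegrable_derivWithin i hb.1 h ha.2).symm
  have hp : ∀ i, IntervalIntegrable (fun s => (g s * MvPolynomial.eval (c s) (θ i)) *
      derivWithin (fun t => c t i) (Icc 0 1) s) volume a b := fun i =>
    (hd i).continuousOn_mul ((hg.mul ((continuous_eval_mvPolynomial _).comp_continuousOn
      hc.1)).mono hsub)
  have h := (hp 0).add (hp 1)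
  refine h.congr fun s _ => ?_
  simp only [pullback, Fin.sum_univ_two]
  ring

theorem PiecewiseC1.continuousOn_iterInt {c : ℝ → Fin 2 → ℂ} (hc : PiecewiseC1 c)
    (ws : List OneForm) : ContinuousOn (iterInt c ws) (Icc 0 1) := by
  induction ws with
  | nil => exact continuousOn_const
  | cons θ ws ih =>
    have h := hc.intervalIntegrable_mul_pullback θ ih (left_mem_Icc.2 zero_le_one)
      (right_mem_Icc.2 zero_le_one)
    have h2 := continuousOn_primitive_interval' h left_mem_uIcc
    rwa [uIcc_of_le zero_le_one] at h2

theorem PiecewiseC1.intervalIntegrable_iterInt_mul {c : ℝ → Fin 2 → ℂ} (hc : PiecewiseC1 c)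
    (ws : List OneForm) (θ : OneForm) {a b : ℝ} (ha : a ∈ Icc (0 : ℝ) 1)
    (hb : b ∈ Icc (0 : ℝ) 1) :
    IntervalIntegrable (fun s => iterInt c ws s * pullback c θ s) volume a b :=
  hc.intervalIntegrable_mul_pullback θ (hc.continuousOn_iterInt ws) ha hb

theorem PiecewiseC1.iterInt_cons_sub {c : ℝ → Fin 2 → ℂ} (hc : PiecewiseC1 c)
    (ws : List OneForm) (θ : OneForm) {a b : ℝ} (ha : a ∈ Icc (0 : ℝ) 1)
    (hb : b ∈ Icc (0 : ℝ) 1) :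
    iterInt c (θ :: ws) b = iterInt c (θ :: ws) a +
      ∫ s in a..b, iterInt c ws s * pullback c θ s :=
  (integral_add_adjacent_intervals
    (hc.intervalIntegrable_iterInt_mul ws θ (left_mem_Icc.2 zero_le_one) ha)
    (hc.intervalIntegrable_iterInt_mul ws θ ha hb)).symm

theorem iterInt_zero_cons (c : ℝ → Fin 2 → ℂ) (ws : List OneForm) (θ : OneForm) :
    iterInt c (θ :: ws) 0 = 0 :=
  integral_same

/-! #### Concatenation -/

/-- Chain rule for the two halves of a concatenation, used with `b = 0` and `b = -1`. In an open
interval `derivWithin` is the ordinary derivative, so only interior points are treated. -/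
theorem pullback_affine {c d : ℝ → Fin 2 → ℂ} {b u v : ℝ} (θ : OneForm)
    (hcd : ∀ s ∈ Ioo u v, c s = d (2 * s + b)) (hu : 0 ≤ u) (hv : v ≤ 1)
    (hu' : 0 ≤ 2 * u + b) (hv' : 2 * v + b ≤ 1) {s : ℝ} (hs : s ∈ Ioo u v) :
    pullback c θ s = 2 * pullback d θ (2 * s + b) := by
  have hs1 : Icc (0 : ℝ) 1 ∈ 𝓝 s := Icc_mem_nhds (hu.trans_lt hs.1) (hs.2.trans_le hv)
  have hs2 : Icc (0 : ℝ) 1 ∈ 𝓝 (2 * s + b) :=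
    Icc_mem_nhds (by linarith [hs.1]) (by linarith [hs.2])
  have key : ∀ i, deriv (fun t => c t i) s = 2 * deriv (fun t => d t i) (2 * s + b) := by
    intro i
    have he : (fun t => c t i) =ᶠ[𝓝 s] fun t => (fun r => d (r + b) i) (2 * t) := by
      filter_upwards [Ioo_mem_nhds hs.1 hs.2] with t ht
      rw [hcd t ht]
    rw [he.deriv_eq, deriv_comp_mul_left 2 (fun r => d (r + b) i) s,
      deriv_comp_add_const (fun r => d r i) b (2 * s)]
    simp
  simp only [pullback, derivWithin_of_mem_nhds hs1, derivWithin_of_mem_nhds hs2, key, hcd s hs,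
    Finset.mul_sum]
  exact Finset.sum_congr rfl fun i _ => by ring

theorem integral_mul_pullback_affine {c d : ℝ → Fin 2 → ℂ} {b u v : ℝ} (θ : OneForm)
    (hcd : ∀ s ∈ Ioo u v, c s = d (2 * s + b)) (hu : 0 ≤ u) (hv : v ≤ 1)
    (hu' : 0 ≤ 2 * u + b) (hv' : 2 * v + b ≤ 1) {g k : ℝ → ℂ}
    (hgk : ∀ s ∈ Ioo u v, g s = k (2 * s + b)) {t : ℝ} (ht : t ∈ Icc u v) :
    ∫ s in u..t, g s * pullback c θ s = ∫ s in (2 * u + b)..(2 * t + b), k s * pullback d θ s := by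
  rw [← smul_integral_comp_mul_add (fun s => k s * pullback d θ s) 2 b, ← intervalIntegral.integral_smul]
  refine integral_congr_Ioo_of_le ht.1 fun s hs => ?_
  have hs' : s ∈ Ioo u v := ⟨hs.1, hs.2.trans_le ht.2⟩
  rw [pullback_affine θ hcd hu hv hu' hv' hs', hgk s hs', Complex.real_smul]
  push_cast
  ring

theorem iterInt_first_half {c d : ℝ → Fin 2 → ℂ}
    (hcd : ∀ s ∈ Icc (0 : ℝ) (1 / 2), c s = d (2 * s)) (ws : List OneForm) :
    ∀ s ∈ Icc (0 : ℝ) (1 / 2), iterInt c ws s = iterInt d ws (2 * s) := by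
  induction ws with
  | nil => exact fun _ _ => rfl
  | cons θ ws ih =>
    intro t ht
    have := integral_mul_pullback_affine (c := c) (d := d) (b := 0) (u := 0) (v := 1 / 2) θ
      (fun s hs => by simpa using hcd s (Ioo_subset_Icc_self hs)) le_rfl (by norm_num) (by norm_num)
      (by norm_num) (g := iterInt c ws) (k := iterInt d ws)
      (fun s hs => by simpa using ih s (Ioo_subset_Icc_self hs)) ht
    simpa [iterInt] using this

/-- The outermost integral splits at `1 / 2`. The part before it carries the whole word on `d₁` and
is the cut `k = 0`; in the part after it the induction hypothesis is integrated, which puts `θ` in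
front of the `d₂`-prefix and raises the cut position by one. -/
theorem iterInt_second_half {c d₁ d₂ : ℝ → Fin 2 → ℂ} (hc : PiecewiseC1 c) (hd₂ : PiecewiseC1 d₂)
    (h₁ : ∀ s ∈ Icc (0 : ℝ) (1 / 2), c s = d₁ (2 * s))
    (h₂ : ∀ s ∈ Icc (1 / 2 : ℝ) 1, c s = d₂ (2 * s - 1)) (ws : List OneForm) :
    ∀ s ∈ Icc (1 / 2 : ℝ) 1, iterInt c ws s = ∑ k ∈ Finset.range (ws.length + 1),
      iterInt d₂ (ws.take k) (2 * s - 1) * iterInt d₁ (ws.drop k) 1 := by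
  induction ws with
  | nil => intro s _; simp [iterInt]
  | cons θ ws ih =>
    intro t ht
    have hhalf : (1 / 2 : ℝ) ∈ Icc (0 : ℝ) 1 := by constructor <;> norm_num
    have htt : 2 * t - 1 ∈ Icc (0 : ℝ) 1 := ⟨by linarith [ht.1], by linarith [ht.2]⟩
    have ht1 : t ∈ Icc (0 : ℝ) 1 := ⟨by linarith [ht.1], ht.2⟩
    rw [hc.iterInt_cons_sub ws θ hhalf ht1,
      iterInt_first_half h₁ _ _ (right_mem_Icc.2 (by norm_num)),
      integral_mul_pullback_affine (c := c) (d := d₂) (b := -1) (u := 1 / 2) (v := 1) θ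
      (fun s hs => by simpa [sub_eq_add_neg] using h₂ s (Ioo_subset_Icc_self hs)) (by norm_num)
      (by norm_num) (by norm_num) (by norm_num) (g := iterInt c ws)
      (k := fun s => ∑ k ∈ Finset.range (ws.length + 1),
        iterInt d₂ (ws.take k) s * iterInt d₁ (ws.drop k) 1)
      (fun s hs => by simpa [sub_eq_add_neg] using ih s (Ioo_subset_Icc_self hs)) ht,
      List.length_cons, Finset.sum_range_succ']
    have e0 : (2 : ℝ) * (1 / 2) + -1 = 0 := by norm_num
    have e1 : (2 : ℝ) * (1 / 2) = 1 := by norm_num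
    rw [e0, e1, ← sub_eq_add_neg]
    simp only [List.take_succ_cons, List.drop_succ_cons, List.take_zero, List.drop_zero]
    rw [add_comm]
    congr 1
    · simp_rw [Finset.sum_mul]
      rw [intervalIntegral.integral_finsetSum]
      · refine Finset.sum_congr rfl fun k _ => ?_
        change _ = (∫ s in (0 : ℝ)..(2 * t - 1), iterInt d₂ (ws.take k) s * pullback d₂ θ s) * _
        rw [← intervalIntegral.integral_mul_const]
        exact integral_congr fun s _ => by ring
      · intro k _
        have := (hd₂.intervalIntegrable_iterInt_mul (ws.take k) θ
          (left_mem_Icc.2 zero_le_one) htt).mul_const (iterInt d₁ (ws.drop k) 1)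
        exact this.congr fun s _ => by ring
    · simp [iterInt]

theorem PiecewiseC1.concat {c d₁ d₂ : ℝ → Fin 2 → ℂ} (hd₁ : PiecewiseC1 d₁) (hd₂ : PiecewiseC1 d₂)
    (h₁ : ∀ s ∈ Icc (0 : ℝ) (1 / 2), c s = d₁ (2 * s))
    (h₂ : ∀ s ∈ Icc (1 / 2 : ℝ) 1, c s = d₂ (2 * s - 1)) : PiecewiseC1 c := by
  classical
  obtain ⟨hc₁, P₁, hP₁⟩ := hd₁
  obtain ⟨hc₂, P₂, hP₂⟩ := hd₂
  constructor
  · have e : Icc (0 : ℝ) 1 = Icc 0 (1 / 2) ∪ Icc (1 / 2) 1 :=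
      (Icc_union_Icc_eq_Icc (by norm_num) (by norm_num)).symm
    rw [e]
    refine ContinuousOn.union_of_isClosed ?_ ?_ isClosed_Icc isClosed_Icc
    · refine ContinuousOn.congr (hc₁.comp (f := fun s => 2 * s) (by fun_prop) ?_) h₁
      intro s hs
      exact ⟨by linarith [hs.1], by linarith [hs.2]⟩
    · refine ContinuousOn.congr (hc₂.comp (f := fun s => 2 * s - 1) (by fun_prop) ?_) h₂
      intro s hs
      exact ⟨by linarith [hs.1], by linarith [hs.2]⟩
  -- With `1 / 2` among the break points, an admissible interval lies entirely in one half.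
  · refine ⟨insert (1 / 2) (P₁.image (fun s => s / 2) ∪ P₂.image fun s => (s + 1) / 2), ?_⟩
    intro a b ha hab hb hP
    have hhalf := hP (1 / 2) (Finset.mem_insert_self _ _)
    rcases le_or_gt b (1 / 2) with hb2 | hb2
    · refine ContDiffOn.congr (f := fun s => d₁ (2 * s)) ?_ fun s hs =>
        h₁ s ⟨ha.trans hs.1, hs.2.trans hb2⟩
      refine (hP₁ (2 * a) (2 * b) (by linarith) (by linarith) (by linarith) ?_).comp
        (by fun_prop) ?_
      · intro s hs hs'
        refine hP (s / 2) ?_ ⟨by linarith [hs'.1], by linarith [hs'.2]⟩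
        exact Finset.mem_insert_of_mem (Finset.mem_union_left _ (Finset.mem_image_of_mem _ hs))
      · intro s hs
        exact ⟨by linarith [hs.1], by linarith [hs.2]⟩
    · have ha2 : 1 / 2 ≤ a := by
        by_contra h
        exact hhalf ⟨not_le.1 h, hb2⟩
      refine ContDiffOn.congr (f := fun s => d₂ (2 * s - 1)) ?_ fun s hs =>
        h₂ s ⟨ha2.trans hs.1, hs.2.trans hb⟩
      refine (hP₂ (2 * a - 1) (2 * b - 1) (by linarith) (by linarith) (by linarith) ?_).comp
        (by fun_prop) ?_
      · intro s hs hs'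
        refine hP ((s + 1) / 2) ?_ ⟨by linarith [hs'.1], by linarith [hs'.2]⟩
        exact Finset.mem_insert_of_mem (Finset.mem_union_right _
          (Finset.mem_image_of_mem (fun s => (s + 1) / 2) hs))
      · intro s hs
        exact ⟨by linarith [hs.1], by linarith [hs.2]⟩

/-- A path on the curve with arbitrary end points, as a map from the line to `ℂ²`. -/
def pathCurve {H : Poly2} {x y : Curve H} (γ : Path x y) : ℝ → Fin 2 → ℂ :=
  fun t => (γ.extend t : Curve H).1

theorem pathCurve_trans_first {H : Poly2} {x y z : Curve H} (γ : Path x y) (η : Path y z) :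
    ∀ s ∈ Icc (0 : ℝ) (1 / 2), pathCurve (γ.trans η) s = pathCurve γ (2 * s) := by
  intro s hs
  have h : (γ.trans η).extend s = γ.extend (2 * s) := by
    rw [Path.extend_apply _ ⟨hs.1, by linarith [hs.2]⟩, Path.trans_apply, dif_pos hs.2,
      Path.extend_apply _ ⟨by linarith [hs.1], by linarith [hs.2]⟩]
  rw [pathCurve, h, pathCurve]

theorem pathCurve_trans_second {H : Poly2} {x y z : Curve H} (γ : Path x y) (η : Path y z) :
    ∀ s ∈ Icc (1 / 2 : ℝ) 1, pathCurve (γ.trans η) s = pathCurve η (2 * s - 1) := by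
  intro s hs
  have h : (γ.trans η).extend s = η.extend (2 * s - 1) := by
    rw [Path.extend_apply _ ⟨by linarith [hs.1], hs.2⟩, Path.trans_apply,
      Path.extend_apply _ ⟨by linarith [hs.1], by linarith [hs.2]⟩]
    split_ifs with h
    · have : s = 1 / 2 := le_antisymm h hs.1
      subst this
      norm_num
    · rfl
  rw [pathCurve, h, pathCurve]

theorem piecewiseC1_trans {H : Poly2} {x y z : Curve H} {γ : Path x y} {η : Path y z}
    (hγ : PiecewiseC1 (pathCurve γ)) (hη : PiecewiseC1 (pathCurve η)) :
    PiecewiseC1 (pathCurve (γ.trans η)) :=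
  hγ.concat hη (pathCurve_trans_first γ η) (pathCurve_trans_second γ η)

theorem iterInt_trans {H : Poly2} {x y z : Curve H} {γ : Path x y} {η : Path y z}
    (hγ : PiecewiseC1 (pathCurve γ)) (hη : PiecewiseC1 (pathCurve η)) (ws : List OneForm) :
    iterInt (pathCurve (γ.trans η)) ws 1 = ∑ k ∈ Finset.range (ws.length + 1),
      iterInt (pathCurve η) (ws.take k) 1 * iterInt (pathCurve γ) (ws.drop k) 1 := by
  have := iterInt_second_half (piecewiseC1_trans hγ hη) hη (pathCurve_trans_first γ η)
    (pathCurve_trans_second γ η) ws 1 (right_mem_Icc.2 (by norm_num))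
  norm_num at this
  exact this

theorem pathCurve_refl {H : Poly2} (x : Curve H) : pathCurve (Path.refl x) = fun _ => x.1 := by
  funext t
  simp [pathCurve]

theorem piecewiseC1_const (v : Fin 2 → ℂ) : PiecewiseC1 fun _ => v :=
  ⟨continuousOn_const, ∅, fun _ _ _ _ _ _ => contDiffOn_const⟩

theorem iterInt_const_cons (v : Fin 2 → ℂ) (θ : OneForm) (ws : List OneForm) (t : ℝ) :
    iterInt (fun _ => v) (θ :: ws) t = 0 := by
  simp [iterInt, pullback]

end PathIntegrals

end

end ChenPlane

namespace ChenPlane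

noncomputable section

/-! ### Charts of the affine curve -/

section Charts

open Set Filter Topology Metric

/-- The implicit function theorem supplies a solution with a derivative at the centre. Holomorphy on
a whole disc comes from applying the theorem again at nearby points of the graph and comparing by
local uniqueness. -/
theorem exists_graph {Φ : ℂ × ℂ → ℂ} (hΦ : ContDiff ℂ 1 Φ) {a b : ℂ} (h0 : Φ (a, b) = 0)
    (h1 : fderiv ℂ Φ (a, b) (0, 1) ≠ 0) {O : Set (ℂ × ℂ)} (hO : O ∈ 𝓝 (a, b)) :
    ∃ g : ℂ → ℂ, ∃ r > 0, ∃ ρ > 0, ball a r ×ˢ ball b ρ ⊆ O ∧ g a = b ∧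
      DifferentiableOn ℂ g (ball a r) ∧ (∀ z ∈ ball a r, g z ∈ ball b ρ) ∧
      ∀ z ∈ ball a r, ∀ w ∈ ball b ρ, Φ (z, w) = 0 ↔ g z = w := by
  have hstrict : ∀ u, HasStrictFDerivAt Φ (fderiv ℂ Φ u) u := fun u =>
    hΦ.contDiffAt.hasStrictFDerivAt one_ne_zero
  have hinv : ∀ u, fderiv ℂ Φ u (0, 1) ≠ 0 →
      (fderiv ℂ Φ u ∘L ContinuousLinearMap.inr ℂ ℂ ℂ).IsInvertible := fun u hu =>
    ⟨ContinuousLinearEquiv.unitsEquivAut ℂ (Units.mk0 _ hu), by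
      ext; simp⟩
  have himp : ∀ u, Φ u = 0 → fderiv ℂ Φ u (0, 1) ≠ 0 → ∃ ψ : ℂ → ℂ, ψ u.1 = u.2 ∧
      DifferentiableAt ℂ ψ u.1 ∧ (∀ᶠ v in 𝓝 u, Φ v = 0 ↔ ψ v.1 = v.2) := by
    intro u hu0 hu
    have hev := (hstrict u).eventually_apply_eq_iff_implicitFunctionOfProdDomain (hinv u hu)
    refine ⟨(hstrict u).implicitFunctionOfProdDomain (hinv u hu), hev.self_of_nhds.1 rfl,
      ((hstrict u).hasStrictFDerivAt_implicitFunctionOfProdDomain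
        (hinv u hu)).hasFDerivAt.differentiableAt, ?_⟩
    simpa only [hu0] using hev
  obtain ⟨ψ, hψab, hψd, hψ⟩ := himp (a, b) h0 h1
  have hcont : Continuous fun u => fderiv ℂ Φ u (0, 1) :=
    (hΦ.continuous_fderiv one_ne_zero).clm_apply continuous_const
  have hall : ∀ᶠ v in 𝓝 (a, b), (Φ v = 0 ↔ ψ v.1 = v.2) ∧ fderiv ℂ Φ v (0, 1) ≠ 0 ∧ v ∈ O :=
    hψ.and ((hcont.continuousAt.eventually_ne h1).and hO)
  obtain ⟨ε, hε, hsub⟩ := Metric.eventually_nhds_iff_ball.1 hall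
  have hball : ball (a, b) ε = ball a ε ×ˢ ball b ε := (ball_prod_same a b ε).symm
  have hψc : ∀ᶠ z in 𝓝 a, ψ z ∈ ball b ε :=
    hψd.continuousAt.eventually (by rw [hψab]; exact ball_mem_nhds b hε)
  obtain ⟨r', hr', hr⟩ := Metric.eventually_nhds_iff_ball.1 hψc
  have hmem : ∀ z ∈ ball a (min r' ε), ∀ w ∈ ball b ε, (z, w) ∈ ball (a, b) ε := by
    intro z hz w hw
    rw [hball]
    exact ⟨ball_subset_ball (min_le_right _ _) hz, hw⟩
  have hmaps : ∀ z ∈ ball a (min r' ε), ψ z ∈ ball b ε := fun z hz =>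
    hr z (ball_subset_ball (min_le_left _ _) hz)
  refine ⟨ψ, min r' ε, lt_min hr' hε, ε, hε, fun v hv => (hsub v (hmem _ hv.1 _ hv.2)).2.2, hψab,
    fun z hz => ?_, hmaps, fun z hz w hw => (hsub _ (hmem z hz w hw)).1⟩
  have hzw := hsub _ (hmem z hz _ (hmaps z hz))
  -- The local solution `χ` through `(z, ψ z)` must coincide with `ψ` near `z`, so `ψ` inherits its
  -- differentiability at `z`.
  obtain ⟨χ, hχz, hχd, hχ⟩ := himp (z, ψ z) (hzw.1.2 rfl) hzw.2.1
  have hχd' : DifferentiableAt ℂ χ z := hχd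
  have hlim : Tendsto (fun x => (x, χ x)) (𝓝 z) (𝓝 (z, ψ z)) := by
    have h2 : Tendsto χ (𝓝 z) (𝓝 (ψ z)) := by
      have := hχd'.continuousAt.tendsto
      rwa [show χ z = ψ z from hχz] at this
    exact tendsto_id.prodMk_nhds h2
  have heq : ψ =ᶠ[𝓝 z] χ := by
    filter_upwards [hlim.eventually hχ, hlim.eventually
      (isOpen_ball.mem_nhds (hmem z hz _ (hmaps z hz)))] with x hx1 hx2
    exact (hsub _ hx2).1.1 (hx1.2 rfl)
  exact (hχd'.congr_of_eventuallyEq heq).differentiableWithinAt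

/-- The value of a polynomial one-form at a point, as a linear functional. -/
def formCLM (θ : OneForm) (p : Fin 2 → ℂ) : (Fin 2 → ℂ) →L[ℂ] ℂ :=
  ∑ i, MvPolynomial.eval p (θ i) • ContinuousLinearMap.proj i

theorem formCLM_apply (θ : OneForm) (p v : Fin 2 → ℂ) :
    formCLM θ p v = ∑ i, MvPolynomial.eval p (θ i) * v i := by
  simp [formCLM]

theorem hasFDerivAt_eval (f : Poly2) (p : Fin 2 → ℂ) :
    HasFDerivAt (fun x => MvPolynomial.eval x f) (formCLM (extd f) p) p := by
  induction f using MvPolynomial.induction_on with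
  | C a =>
    have : formCLM (extd (MvPolynomial.C a)) p = 0 := by
      ext v; simp [formCLM_apply, extd]
    rw [this]
    simpa using hasFDerivAt_const a p
  | add f g hf hg =>
    have : formCLM (extd (f + g)) p = formCLM (extd f) p + formCLM (extd g) p := by
      ext v
      simp only [formCLM_apply, extd, map_add, add_mul, Finset.sum_add_distrib,
        add_apply]
    rw [this]
    simp only [map_add]
    exact hf.fun_add hg
  | mul_X f i hf =>
    have h := hf.mul (ContinuousLinearMap.proj (R := ℂ) (φ := fun _ : Fin 2 => ℂ) i).hasFDerivAt
    have he : (fun x => MvPolynomial.eval x (f * MvPolynomial.X i)) = fun x =>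
        MvPolynomial.eval x f * (ContinuousLinearMap.proj (R := ℂ) (φ := fun _ : Fin 2 => ℂ) i) x :=
      by funext x; simp
    rw [he]
    refine h.congr_fderiv ?_
    ext v
    fin_cases i <;>
      simp [formCLM_apply, extd, Derivation.leibniz, MvPolynomial.pderiv_X, Fin.sum_univ_two] <;>
      ring

theorem contDiff_eval (f : Poly2) : ContDiff ℂ 1 fun x : Fin 2 → ℂ => MvPolynomial.eval x f :=
  contDiffOn_univ.1 ((AnalyticOnNhd.eval_mvPolynomial (𝕜 := ℂ) f).contDiffOn uniqueDiffOn_univ)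

/-- The zero set of a polynomial in `ℂ²`. -/
def zeros (H : Poly2) : Set (Fin 2 → ℂ) := {p | MvPolynomial.eval p H = 0}

/-- A chart of the curve at `q`: near `q` the curve is the graph of a holomorphic function of one
of the coordinates, defined over a disc. -/
structure CurveChart (H : Poly2) (q : Fin 2 → ℂ) where
  /-- the ambient domain -/
  dom : Set (Fin 2 → ℂ)
  /-- the coordinate used -/
  idx : Fin 2
  /-- the radius of the disc -/
  rad : ℝ
  /-- the parametrization -/
  par : ℂ → Fin 2 → ℂ
  isOpen_dom : IsOpen dom
  mem_dom : q ∈ dom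
  rad_pos : 0 < rad
  differentiableOn_par : DifferentiableOn ℂ par (ball (q idx) rad)
  par_mem : ∀ z ∈ ball (q idx) rad, par z ∈ dom
  par_zeros : ∀ z ∈ ball (q idx) rad, par z ∈ zeros H
  par_idx : ∀ z, par z idx = z
  idx_mem : ∀ p ∈ dom, p idx ∈ ball (q idx) rad
  par_of_mem : ∀ p ∈ dom, p ∈ zeros H → par (p idx) = p

/-- A nonvanishing partial derivative in direction `j` lets `H = 0` be solved for coordinate `j` in
terms of the other coordinate `i`. Arbitrarily small domains are needed to compare sections on
overlaps. -/
theorem exists_chart {H : Poly2} (hs : IsSmoothCurve H) {q : Fin 2 → ℂ} (hq : q ∈ zeros H)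
    {O : Set (Fin 2 → ℂ)} (hO : O ∈ 𝓝 q) : ∃ C : CurveChart H q, C.dom ⊆ O := by
  obtain ⟨j, hj⟩ := hs q hq
  obtain ⟨i, hij⟩ : ∃ i : Fin 2, i ≠ j := exists_ne j
  have hk : ∀ k, k = i ∨ k = j := fun k => by
    fin_cases i <;> fin_cases j <;> fin_cases k <;> simp_all
  let ins : ℂ × ℂ →L[ℂ] (Fin 2 → ℂ) := ContinuousLinearMap.pi fun k =>
    if k = i then ContinuousLinearMap.fst ℂ ℂ ℂ else ContinuousLinearMap.snd ℂ ℂ ℂ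
  have hins_i : ∀ v, ins v i = v.1 := fun v => by simp [ins]
  have hins_j : ∀ v, ins v j = v.2 := fun v => by simp [ins, hij.symm]
  have hins : ∀ p : Fin 2 → ℂ, ins (p i, p j) = p := fun p => by
    funext k
    rcases hk k with rfl | rfl
    · exact hins_i _
    · exact hins_j _
  have hΦ : ContDiff ℂ 1 fun v => MvPolynomial.eval (ins v) H :=
    (contDiff_eval H).comp ins.contDiff
  have hd : fderiv ℂ (fun v => MvPolynomial.eval (ins v) H) (q i, q j) (0, 1) ≠ 0 := by
    have h1 : HasFDerivAt (fun v => MvPolynomial.eval (ins v) H)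
        ((formCLM (extd H) q).comp ins) (q i, q j) := by
      have := (hasFDerivAt_eval H (ins (q i, q j))).comp (q i, q j) ins.hasFDerivAt
      rwa [hins] at this
    rw [h1.fderiv, ContinuousLinearMap.comp_apply, formCLM_apply,
      Finset.sum_eq_single_of_mem j (Finset.mem_univ _), hins_j, mul_one]
    · exact hj
    · intro k _ hkj
      obtain rfl := (hk k).resolve_right hkj
      rw [hins_i, mul_zero]
  have hO' : ins ⁻¹' O ∈ 𝓝 (q i, q j) :=
    ins.continuous.continuousAt.preimage_mem_nhds (by rwa [hins])
  obtain ⟨g, r, hr, ρ, hρ, hsub, -, hgd, hgm, hg⟩ := exists_graph hΦ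
    (by rw [hins]; exact hq) hd hO'
  refine ⟨⟨(fun p => p i) ⁻¹' ball (q i) r ∩ (fun p => p j) ⁻¹' ball (q j) ρ, i, r,
    fun z => ins (z, g z), (isOpen_ball.preimage (continuous_apply i)).inter
      (isOpen_ball.preimage (continuous_apply j)),
    ⟨mem_ball_self hr, mem_ball_self hρ⟩, hr, ?_, ?_, ?_, ?_, ?_, ?_⟩, ?_⟩
  · exact ins.differentiable.comp_differentiableOn (differentiableOn_id.prodMk hgd)
  · intro z hz
    refine ⟨?_, ?_⟩
    · simpa only [mem_preimage, hins_i] using hz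
    · simpa only [mem_preimage, hins_j] using hgm z hz
  · intro z hz
    exact (hg z hz (g z) (hgm z hz)).2 rfl
  · exact fun z => hins_i _
  · exact fun p hp => hp.1
  · intro p hp hpz
    have : g (p i) = p j := (hg _ hp.1 _ hp.2).1 (by rw [hins]; exact hpz)
    change ins (p i, g (p i)) = p
    rw [this, hins]
  · intro p hp
    have : ins (p i, p j) ∈ O := hsub (⟨hp.1, hp.2⟩ : (p i, p j) ∈ ball (q i) r ×ˢ ball (q j) ρ)
    rwa [hins] at this

namespace CurveChart

variable {H : Poly2} {q : Fin 2 → ℂ} (C : CurveChart H q)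

theorem hasDerivAt_par {z : ℂ} (hz : z ∈ ball (q C.idx) C.rad) :
    HasDerivAt C.par (deriv C.par z) z :=
  (C.differentiableOn_par.differentiableAt (isOpen_ball.mem_nhds hz)).hasDerivAt

/-- A holomorphic function of the chart coordinate has the expected differential along the
curve. -/
theorem hasFDerivWithinAt_comp {Φ : ℂ → ℂ} {η : (Fin 2 → ℂ) →L[ℂ] ℂ} {p : Fin 2 → ℂ}
    (hp : p ∈ C.dom) (hpz : p ∈ zeros H) (h : HasDerivAt Φ (η (deriv C.par (p C.idx))) (p C.idx)) :
    HasFDerivWithinAt (fun x => Φ (x C.idx)) η (zeros H) p := by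
  have hproj : HasFDerivAt (fun x : Fin 2 → ℂ => x C.idx)
      (ContinuousLinearMap.proj (R := ℂ) (φ := fun _ : Fin 2 => ℂ) C.idx) p :=
    (ContinuousLinearMap.proj (R := ℂ) (φ := fun _ : Fin 2 => ℂ) C.idx).hasFDerivAt
  have h1 := h.hasFDerivAt.comp p hproj
  have h2 := (C.hasDerivAt_par (C.idx_mem p hp)).hasFDerivAt.comp p hproj
  -- The function `Φ(x_idx) + η(x - par(x_idx))` agrees with `Φ(x_idx)` on the curve, and its
  -- ambient derivative is exactly `η`.
  have h3 := (h1.add (η.hasFDerivAt.sub (η.hasFDerivAt.comp p h2))).hasFDerivWithinAt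
    (s := zeros H)
  refine (h3.congr_of_eventuallyEq ?_ ?_).congr_fderiv ?_
  · filter_upwards [self_mem_nhdsWithin, mem_nhdsWithin_of_mem_nhds (C.isOpen_dom.mem_nhds hp)]
      with x hx hxd
    simp [C.par_of_mem x hxd hx]
  · simp [C.par_of_mem p hp hpz]
  · ext v
    simp

theorem hasDerivAt_comp_par {F : (Fin 2 → ℂ) → ℂ} {η : (Fin 2 → ℂ) →L[ℂ] ℂ} {z : ℂ}
    (hz : z ∈ ball (q C.idx) C.rad) (h : HasFDerivWithinAt F η (zeros H) (C.par z)) :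
    HasDerivAt (fun z => F (C.par z)) (η (deriv C.par z)) z :=
  h.comp_hasDerivAt z (C.hasDerivAt_par hz)
    (Filter.mem_of_superset (isOpen_ball.mem_nhds hz) C.par_zeros)

end CurveChart

/-! ### Flat sections -/

/-- A family of functions indexed by words, flat over an open set for the connection whose parallel
transport is given by the iterated integrals. -/
structure IsFlat (H : Poly2) (O : Set (Fin 2 → ℂ)) (ψ : (Fin 2 → ℂ) → List OneForm → ℂ) :
    Prop where
  nil : ∀ p ∈ O, p ∈ zeros H →
    HasFDerivWithinAt (fun x => ψ x []) (0 : (Fin 2 → ℂ) →L[ℂ] ℂ) (zeros H) p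
  cons : ∀ θ ws, ∀ p ∈ O, p ∈ zeros H →
    HasFDerivWithinAt (fun x => ψ x (θ :: ws)) (ψ p ws • formCLM θ p) (zeros H) p

theorem IsFlat.mono {H : Poly2} {O O' : Set (Fin 2 → ℂ)} {ψ : (Fin 2 → ℂ) → List OneForm → ℂ}
    (h : IsFlat H O ψ) (hO : O' ⊆ O) : IsFlat H O' ψ :=
  ⟨fun p hp => h.nil p (hO hp), fun θ ws p hp => h.cons θ ws p (hO hp)⟩

theorem IsFlat.hasFDerivWithinAt_exists {H : Poly2} {O : Set (Fin 2 → ℂ)}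
    {ψ : (Fin 2 → ℂ) → List OneForm → ℂ} (h : IsFlat H O ψ) (ws : List OneForm) {p : Fin 2 → ℂ}
    (hp : p ∈ O) (hpz : p ∈ zeros H) :
    ∃ η : (Fin 2 → ℂ) →L[ℂ] ℂ, HasFDerivWithinAt (fun x => ψ x ws) η (zeros H) p := by
  cases ws with
  | nil => exact ⟨_, h.nil p hp hpz⟩
  | cons θ ws => exact ⟨_, h.cons θ ws p hp hpz⟩

/-- Induction on the word: once the shorter components agree, the difference of the next ones has
zero derivative on a connected disc, so agreement at one point suffices. -/
theorem IsFlat.eqOn_chart {H : Poly2} {q : Fin 2 → ℂ} (C : CurveChart H q)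
    {ψ χ : (Fin 2 → ℂ) → List OneForm → ℂ} (hψ : IsFlat H C.dom ψ) (hχ : IsFlat H C.dom χ)
    {a : Fin 2 → ℂ} (ha : a ∈ C.dom) (haz : a ∈ zeros H) (hab : ψ a = χ a) {b : Fin 2 → ℂ}
    (hb : b ∈ C.dom) (hbz : b ∈ zeros H) : ψ b = χ b := by
  have key : ∀ ws, ∀ z ∈ ball (q C.idx) C.rad, ψ (C.par z) ws = χ (C.par z) ws := by
    have hconst : ∀ ws, (∀ z ∈ ball (q C.idx) C.rad,
        HasDerivAt (fun z => ψ (C.par z) ws - χ (C.par z) ws) 0 z) →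
        ∀ z ∈ ball (q C.idx) C.rad, ψ (C.par z) ws = χ (C.par z) ws := by
      intro ws hd z hz
      have h1 : ψ (C.par z) ws - χ (C.par z) ws =
          ψ (C.par (a C.idx)) ws - χ (C.par (a C.idx)) ws :=
        (isOpen_ball (x := q C.idx)).is_const_of_deriv_eq_zero
          (convex_ball (q C.idx) C.rad).isPreconnected
          (fun x hx => (hd x hx).differentiableAt.differentiableWithinAt)
          (fun x hx => (hd x hx).deriv) hz (C.idx_mem a ha)
      rw [C.par_of_mem a ha haz, hab, sub_self] at h1
      exact sub_eq_zero.1 h1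
    intro ws
    induction ws with
    | nil =>
      refine hconst _ fun z hz => ?_
      have h := (C.hasDerivAt_comp_par hz (hψ.nil _ (C.par_mem z hz) (C.par_zeros z hz))).fun_sub
        (C.hasDerivAt_comp_par hz (hχ.nil _ (C.par_mem z hz) (C.par_zeros z hz)))
      simpa using h
    | cons θ ws ih =>
      refine hconst _ fun z hz => ?_
      have h := (C.hasDerivAt_comp_par hz (hψ.cons θ ws _ (C.par_mem z hz) (C.par_zeros z hz))).fun_sub
        (C.hasDerivAt_comp_par hz (hχ.cons θ ws _ (C.par_mem z hz) (C.par_zeros z hz)))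
      rwa [ih z hz, sub_self] at h
  funext ws
  have := key ws _ (C.idx_mem b hb)
  rwa [C.par_of_mem b hb hbz] at this

/-- In the chart coordinate the form becomes a holomorphic function on a disc, which has a
primitive; in one complex dimension there is no integrability condition. -/
theorem CurveChart.exists_primitive {H : Poly2} {q : Fin 2 → ℂ} (C : CurveChart H q) (θ : OneForm)
    (f : (Fin 2 → ℂ) → ℂ)
    (hf : ∀ p ∈ C.dom, p ∈ zeros H → ∃ η : (Fin 2 → ℂ) →L[ℂ] ℂ,
      HasFDerivWithinAt f η (zeros H) p) {a : Fin 2 → ℂ} (v : ℂ) :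
    ∃ F : (Fin 2 → ℂ) → ℂ, F a = v ∧ ∀ p ∈ C.dom, p ∈ zeros H →
      HasFDerivWithinAt F (f p • formCLM θ p) (zeros H) p := by
  have hd : DifferentiableOn ℂ (fun z => f (C.par z) * formCLM θ (C.par z) (deriv C.par z))
      (ball (q C.idx) C.rad) := by
    refine DifferentiableOn.mul (fun z hz => ?_) ?_
    · obtain ⟨η, hη⟩ := hf _ (C.par_mem z hz) (C.par_zeros z hz)
      exact (C.hasDerivAt_comp_par hz hη).differentiableAt.differentiableWithinAt
    · simp only [formCLM_apply]
      refine DifferentiableOn.fun_sum fun i _ => DifferentiableOn.mul ?_ ?_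
      · exact ((contDiff_eval (θ i)).differentiable one_ne_zero).comp_differentiableOn
          C.differentiableOn_par
      · exact differentiableOn_pi.1 (C.differentiableOn_par.deriv isOpen_ball) i
  obtain ⟨Φ, hΦ, hΦd⟩ := hd.isExactOn_ball.with_val_at (a C.idx) v
  refine ⟨fun x => Φ (x C.idx), hΦ, fun p hp hpz => C.hasFDerivWithinAt_comp hp hpz ?_⟩
  have := hΦd _ (C.idx_mem p hp)
  rwa [C.par_of_mem p hp hpz] at this

theorem CurveChart.exists_isFlat {H : Poly2} {q : Fin 2 → ℂ} (C : CurveChart H q)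
    (a : Fin 2 → ℂ) (v : List OneForm → ℂ) : ∃ ψ, IsFlat H C.dom ψ ∧ ψ a = v := by
  -- The primitive is chosen for every `f`, its property being conditional on differentiability. The
  -- section can thus be defined by recursion before its components are known to be differentiable.
  have hstep : ∀ (θ : OneForm) (ws : List OneForm) (f : (Fin 2 → ℂ) → ℂ),
      ∃ F : (Fin 2 → ℂ) → ℂ, F a = v (θ :: ws) ∧
      ((∀ p ∈ C.dom, p ∈ zeros H → ∃ η : (Fin 2 → ℂ) →L[ℂ] ℂ,
        HasFDerivWithinAt f η (zeros H) p) → ∀ p ∈ C.dom, p ∈ zeros H →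
      HasFDerivWithinAt F (f p • formCLM θ p) (zeros H) p) := by
    intro θ ws f
    by_cases hf : ∀ p ∈ C.dom, p ∈ zeros H → ∃ η : (Fin 2 → ℂ) →L[ℂ] ℂ,
        HasFDerivWithinAt f η (zeros H) p
    · obtain ⟨F, h1, h2⟩ := C.exists_primitive θ f hf (a := a) (v (θ :: ws))
      exact ⟨F, h1, fun _ => h2⟩
    · exact ⟨fun _ => v (θ :: ws), rfl, fun h => absurd h hf⟩
  choose prim hprim_a hprim using hstep
  let ψ' : List OneForm → (Fin 2 → ℂ) → ℂ := fun ws =>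
    List.rec (fun _ => v []) (fun θ ws f => prim θ ws f) ws
  have hdiff : ∀ ws, ∀ p ∈ C.dom, p ∈ zeros H → ∃ η : (Fin 2 → ℂ) →L[ℂ] ℂ,
      HasFDerivWithinAt (ψ' ws) η (zeros H) p := by
    intro ws
    induction ws with
    | nil => exact fun p _ _ => ⟨0, hasFDerivWithinAt_const _ _ _⟩
    | cons θ ws ih => exact fun p hp hpz => ⟨_, hprim θ ws (ψ' ws) ih p hp hpz⟩
  refine ⟨fun x ws => ψ' ws x, ⟨fun p _ _ => hasFDerivWithinAt_const _ _ _,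
    fun θ ws p hp hpz => hprim θ ws (ψ' ws) (hdiff ws) p hp hpz⟩, ?_⟩
  funext ws
  cases ws with
  | nil => rfl
  | cons θ ws => exact hprim_a θ ws (ψ' ws)

/-- Along a piecewise `C¹` path a flat section is given by the iterated integrals. -/
theorem IsFlat.apply_eq_iterInt {H : Poly2} {O : Set (Fin 2 → ℂ)}
    {ψ : (Fin 2 → ℂ) → List OneForm → ℂ} (h : IsFlat H O ψ) {c : ℝ → Fin 2 → ℂ}
    (hc : PiecewiseC1 c) (hcz : ∀ t, c t ∈ zeros H) {a : ℝ} (ha : a ∈ Icc (0 : ℝ) 1)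
    (h0 : ψ (c a) = fun ws => iterInt c ws a) {b : ℝ} (hb : b ∈ Icc (0 : ℝ) 1)
    (hO : ∀ t ∈ uIcc a b, c t ∈ O) : ψ (c b) = fun ws => iterInt c ws b := by
  have hsub : uIcc a b ⊆ Icc 0 1 := fun x hx =>
    ⟨(le_min ha.1 hb.1).trans hx.1, hx.2.trans (max_le ha.2 hb.2)⟩
  have hcont : ∀ ws, ContinuousOn (fun s => ψ (c s) ws) (uIcc a b) := by
    intro ws s hs
    obtain ⟨η, hη⟩ := h.hasFDerivWithinAt_exists ws (hO s hs) (hcz s)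
    exact ContinuousWithinAt.comp (t := zeros H) (f := c) hη.continuousWithinAt
      ((hc.1 s (hsub hs)).mono hsub) (fun t _ => hcz t)
  obtain ⟨P, hP⟩ := hc.exists_hasDerivAt
  -- Fundamental theorem of calculus along the path, with the finitely many break points as the
  -- exceptional set.
  have hint : ∀ (ws : List OneForm) (f' : ℝ → ℂ), ∀ t ∈ uIcc a b,
      (∀ s ∈ uIcc a b, ∃ η : (Fin 2 → ℂ) →L[ℂ] ℂ, HasFDerivWithinAt (fun x => ψ x ws) η (zeros H) (c s) ∧
        f' s = η fun i => derivWithin (fun t => c t i) (Icc 0 1) s) →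
      IntervalIntegrable f' MeasureTheory.volume a t →
      ∫ s in a..t, f' s = ψ (c t) ws - ψ (c a) ws := by
    intro ws f' t ht hf' hi
    have hmin : min a b ≤ min a t := le_min inf_le_left ht.1
    have hmax : max a t ≤ max a b := max_le le_sup_left ht.2
    refine MeasureTheory.integral_eq_of_hasDerivAt_off_countable (fun s => ψ (c s) ws) f'
      P.countable_toSet ((hcont ws).mono (uIcc_subset_uIcc_left ht)) (fun s hs => ?_) hi
    have hs0 : (0 : ℝ) < s := ((le_min ha.1 hb.1).trans hmin).trans_lt hs.1.1
    have hs1 : s < 1 := hs.1.2.trans_le (hmax.trans (max_le ha.2 hb.2))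
    obtain ⟨η, hη, he⟩ := hf' s ⟨hmin.trans hs.1.1.le, hs.1.2.le.trans hmax⟩
    rw [he]
    exact (hη.restrictScalars ℝ).comp_hasDerivAt s (hP s ⟨hs0, hs1⟩ hs.2)
      (Eventually.of_forall hcz)
  have key : ∀ ws, ∀ t ∈ uIcc a b, ψ (c t) ws = iterInt c ws t := by
    intro ws
    induction ws with
    | nil =>
      intro t ht
      have h1 := hint [] (fun _ => 0) t ht (fun s hs => ⟨0, h.nil _ (hO s hs) (hcz s), rfl⟩)
        (by simp)
      rw [intervalIntegral.integral_zero, h0] at h1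
      exact (sub_eq_zero.1 h1.symm)
    | cons θ ws ih =>
      intro t ht
      have h1 := hint (θ :: ws) (fun s => ψ (c s) ws * pullback c θ s) t ht
        (fun s hs => ⟨_, h.cons θ ws _ (hO s hs) (hcz s), by
          simp [formCLM_apply, pullback]⟩)
        ((hc.intervalIntegrable_iterInt_mul ws θ ha (hsub ht)).congr fun s hs => by
          rw [ih s (uIcc_subset_uIcc_left ht (uIoc_subset_uIcc hs))])
      have h2 : ∫ s in a..t, iterInt c ws s * pullback c θ s =
          ∫ s in a..t, ψ (c s) ws * pullback c θ s :=
        intervalIntegral.integral_congr fun s hs => by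
          rw [ih s (uIcc_subset_uIcc_left ht hs)]
      rw [hc.iterInt_cons_sub ws θ ha (hsub ht), h2, h1, h0]
      ring
  funext ws
  exact key ws b right_mem_uIcc

end Charts

end

end ChenPlane

namespace ChenPlane

noncomputable section

/-! ### The covering space of flat sections and homotopy invariance -/

section Covering

open Set Filter Topology Metric

variable {H : Poly2}

/-- Transport of a vector from `a` to `b` inside a chart. -/
def CurveChart.transport {q : Fin 2 → ℂ} (C : CurveChart H q) (a b : Fin 2 → ℂ)
    (v : List OneForm → ℂ) : List OneForm → ℂ :=
  (C.exists_isFlat a v).choose b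

theorem CurveChart.transport_eq {q : Fin 2 → ℂ} (C : CurveChart H q)
    {ψ : (Fin 2 → ℂ) → List OneForm → ℂ} (hψ : IsFlat H C.dom ψ) {a b : Fin 2 → ℂ}
    (ha : a ∈ C.dom) (haz : a ∈ zeros H) (hb : b ∈ C.dom) (hbz : b ∈ zeros H) :
    C.transport a b (ψ a) = ψ b :=
  IsFlat.eqOn_chart C (C.exists_isFlat a (ψ a)).choose_spec.1 hψ ha haz
    (C.exists_isFlat a (ψ a)).choose_spec.2 hb hbz

/-- Agreement is only local, because the overlap of two chart domains may meet the curve in a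
disconnected set. This is what makes the transition maps of the local system locally constant. -/
theorem IsFlat.eventually_eq (hs : IsSmoothCurve H) {O O' : Set (Fin 2 → ℂ)} (hO : IsOpen O)
    (hO' : IsOpen O') {ψ χ : (Fin 2 → ℂ) → List OneForm → ℂ} (hψ : IsFlat H O ψ)
    (hχ : IsFlat H O' χ) {p : Fin 2 → ℂ} (hp : p ∈ O) (hp' : p ∈ O') (hpz : p ∈ zeros H)
    (h : ψ p = χ p) : ∀ᶠ x in 𝓝 p, x ∈ zeros H → ψ x = χ x := by
  obtain ⟨C, hC⟩ := exists_chart hs hpz ((hO.inter hO').mem_nhds ⟨hp, hp'⟩)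
  filter_upwards [C.isOpen_dom.mem_nhds C.mem_dom] with x hx hxz
  exact IsFlat.eqOn_chart C (hψ.mono fun y hy => (hC hy).1) (hχ.mono fun y hy => (hC hy).2)
    C.mem_dom hpz h hx hxz

/-- A chosen chart at a point of the curve. -/
def curveChart (hs : IsSmoothCurve H) (q : Curve H) : CurveChart H q.1 :=
  (exists_chart hs q.2 univ_mem).choose

/-- Functions on words, as a discrete space. -/
def WordFun : Type := List OneForm → ℂ

instance : TopologicalSpace WordFun := ⊥

instance : DiscreteTopology WordFun := ⟨rfl⟩

/-- The local system of flat sections. -/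
def flatCore (hs : IsSmoothCurve H) : FiberBundleCore (Curve H) (Curve H) WordFun where
  baseSet q := {p | p.1 ∈ (curveChart hs q).dom}
  isOpen_baseSet q := (curveChart hs q).isOpen_dom.preimage continuous_subtype_val
  indexAt q := q
  mem_baseSet_at q := (curveChart hs q).mem_dom
  -- The coordinate of a fibre vector in chart `i` is the value at the centre `i` of the flat
  -- section through it. The change of coordinates transports from centre `i` to `p`, then from `p`
  -- to centre `j`.
  coordChange i j p v :=
    (curveChart hs j).transport p.1 j.1 ((curveChart hs i).transport i.1 p.1 v)
  coordChange_self i p hp v := by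
    obtain ⟨ψ, hψ, rfl⟩ := (curveChart hs i).exists_isFlat i.1 v
    have hi := (curveChart hs i).mem_dom
    rw [(curveChart hs i).transport_eq hψ hi i.2 hp p.2,
      (curveChart hs i).transport_eq hψ hp p.2 hi i.2]
  continuousOn_coordChange i j := by
    rintro ⟨p, v⟩ ⟨⟨hpi, hpj⟩, -⟩
    obtain ⟨ψ, hψ, rfl⟩ := (curveChart hs i).exists_isFlat i.1 v
    obtain ⟨χ, hχ, hχp⟩ := (curveChart hs j).exists_isFlat p.1 (ψ p.1)
    have hev := IsFlat.eventually_eq hs (curveChart hs i).isOpen_dom (curveChart hs j).isOpen_dom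
      hψ hχ hpi hpj p.2 hχp.symm
    have hi := (curveChart hs i).mem_dom
    have hj := (curveChart hs j).mem_dom
    have hval : ∀ p' : Curve H, p'.1 ∈ (curveChart hs i).dom → p'.1 ∈ (curveChart hs j).dom →
        ψ p'.1 = χ p'.1 → (curveChart hs j).transport p'.1 j.1
          ((curveChart hs i).transport i.1 p'.1 (ψ i.1)) = χ j.1 := by
      intro p' h1 h2 h3
      rw [(curveChart hs i).transport_eq hψ hi i.2 h1 p'.2, h3,
        (curveChart hs j).transport_eq hχ h2 p'.2 hj j.2]
    refine ContinuousAt.continuousWithinAt ?_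
    let v₀ : WordFun := ψ i.1
    let w₀ : WordFun := χ j.1
    have h1 : ∀ᶠ x : Curve H × WordFun in 𝓝 (p, v₀), x.2 = v₀ :=
      (continuous_snd.tendsto (p, v₀)).eventually
        ((isOpen_discrete {v₀}).mem_nhds rfl)
    have h2 : ∀ᶠ x : Curve H × WordFun in 𝓝 (p, v₀),
        ψ x.1.1 = χ x.1.1 ∧ x.1.1 ∈ (curveChart hs i).dom ∧ x.1.1 ∈ (curveChart hs j).dom := by
      have hc : ContinuousAt (fun x : Curve H × WordFun => x.1.1) (p, v₀) :=
        (continuous_subtype_val.comp continuous_fst).continuousAt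
      filter_upwards [hc.eventually hev,
        hc.eventually ((curveChart hs i).isOpen_dom.mem_nhds hpi),
        hc.eventually ((curveChart hs j).isOpen_dom.mem_nhds hpj)] with x h1 h2 h3
      exact ⟨h1 x.1.2, h2, h3⟩
    refine ContinuousAt.congr (f := fun _ => w₀) continuousAt_const ?_
    filter_upwards [h1, h2] with x hx1 hx2
    rw [hx1]
    exact (hval x.1 hx2.2.1 hx2.2.2 hx2.1).symm
  coordChange_comp i j k p hp v := by
    obtain ⟨⟨hpi, hpj⟩, hpk⟩ := hp
    have hj := (curveChart hs j).mem_dom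
    obtain ⟨χ, hχ, hχp⟩ := (curveChart hs j).exists_isFlat p.1
      ((curveChart hs i).transport i.1 p.1 v)
    rw [← hχp, (curveChart hs j).transport_eq hχ hpj p.2 hj j.2,
      (curveChart hs j).transport_eq hχ hj j.2 hpj p.2]

theorem pathCurve_mem_zeros {x y : Curve H} (γ : Path x y) (t : ℝ) : pathCurve γ t ∈ zeros H :=
  (γ.extend t).2

theorem continuous_pathCurve {x y : Curve H} (γ : Path x y) : Continuous (pathCurve γ) :=
  continuous_subtype_val.comp γ.continuous_extend

theorem pathCurve_apply {x y : Curve H} (γ : Path x y) (t : I) : pathCurve γ t = (γ t).1 := by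
  rw [pathCurve, Path.extend_apply _ t.2]

/-- The lift of a piecewise `C¹` path given by its iterated integrals. -/
def iterLift (hs : IsSmoothCurve H) {x y : Curve H} (γ : Path x y) (t : I) :
    (flatCore hs).TotalSpace :=
  ⟨γ t, (fun ws => iterInt (pathCurve γ) ws t : List OneForm → ℂ)⟩

/-- In the trivialization at `γ t₀` the lift is locally constant: near `t₀` the iterated integrals
are the values of a single flat section `ψ`. -/
theorem continuous_iterLift (hs : IsSmoothCurve H) {x y : Curve H} {γ : Path x y}
    (hγ : PiecewiseC1 (pathCurve γ)) : Continuous (iterLift hs γ) := by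
  rw [continuous_iff_continuousAt]
  intro t₀
  refine (FiberBundle.continuousAt_totalSpace WordFun (iterLift hs γ)).2 ⟨γ.continuous.continuousAt, ?_⟩
  set C := curveChart hs (γ t₀) with hC
  obtain ⟨ψ, hψ, hψ0⟩ := C.exists_isFlat (γ t₀).1 (fun ws => iterInt (pathCurve γ) ws t₀)
  have hmem : C.dom ∈ 𝓝 (pathCurve γ t₀) := by
    rw [pathCurve_apply]
    exact C.isOpen_dom.mem_nhds C.mem_dom
  obtain ⟨ε, hε, hball⟩ := Metric.mem_nhds_iff.1
    ((continuous_pathCurve γ).continuousAt.preimage_mem_nhds hmem)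
  let v₀ : WordFun := ψ (γ t₀).1
  refine ContinuousAt.congr (f := fun _ => v₀) continuousAt_const ?_
  filter_upwards [Metric.ball_mem_nhds t₀ hε] with t ht
  have hsub : ∀ s ∈ uIcc (t₀ : ℝ) t, pathCurve γ s ∈ C.dom := by
    intro s hs'
    refine hball ?_
    have : uIcc (t₀ : ℝ) t ⊆ ball (t₀ : ℝ) ε := by
      refine (convex_ball (t₀ : ℝ) ε).ordConnected.uIcc_subset (mem_ball_self hε) ht
    exact this hs'
  have hflat : ψ (pathCurve γ t) = fun ws => iterInt (pathCurve γ) ws t :=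
    hψ.apply_eq_iterInt hγ (pathCurve_mem_zeros γ) t₀.2 (by rw [pathCurve_apply, hψ0]) t.2 hsub
  have hdom : (γ t).1 ∈ C.dom := by
    exact pathCurve_apply γ t ▸ hsub _ right_mem_uIcc
  -- The fibre vector over `γ t` is stored in the chart indexed by `γ t` itself, so the inner
  -- transport goes from this point to itself and is trivial.
  change ψ (γ t₀).1 = (curveChart hs (γ t₀)).transport (γ t).1 (γ t₀).1
    ((curveChart hs (γ t)).transport (γ t).1 (γ t).1 fun ws => iterInt (pathCurve γ) ws t)
  rw [← hflat, pathCurve_apply]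
  obtain ⟨χ, hχ, hχt⟩ := (curveChart hs (γ t)).exists_isFlat (γ t).1 (ψ (γ t).1)
  have hm := (curveChart hs (γ t)).mem_dom
  rw [← hχt, (curveChart hs (γ t)).transport_eq hχ hm (γ t).2 hm (γ t).2, hχt,
    C.transport_eq hψ hdom (γ t).2 C.mem_dom (γ t₀).2]

/-- Iterated integrals over piecewise `C¹` paths with fixed end points are homotopy invariant. -/
theorem iterInt_eq_of_homotopic (hs : IsSmoothCurve H) {x y : Curve H} {γ η : Path x y}
    (hγ : PiecewiseC1 (pathCurve γ)) (hη : PiecewiseC1 (pathCurve η)) (h : γ.Homotopic η)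
    (ws : List OneForm) : iterInt (pathCurve γ) ws 1 = iterInt (pathCurve η) ws 1 := by
  -- The fibre is discrete, so the bundle projection is a covering.
  have cov : IsCoveringMap (Bundle.TotalSpace.proj : (flatCore hs).TotalSpace → Curve H) :=
    FiberBundle.isCoveringMap
  have h0 : iterLift hs γ 0 = iterLift hs η 0 := by
    have : ∀ {γ : Path x y}, iterLift hs γ 0 =
        ⟨x, (fun ws => ws.casesOn 1 fun _ _ => 0 : List OneForm → ℂ)⟩ := by
      intro γ
      unfold iterLift
      congr 1
      · exact γ.source
      · funext ws
        cases ws with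
        | nil => rfl
        | cons θ ws => exact iterInt_zero_cons _ _ _
    rw [this, this]
  have hγ0 : γ.toContinuousMap 0 = (iterLift hs γ 0).proj := rfl
  have hη0 : η.toContinuousMap 0 = (iterLift hs γ 0).proj := by rw [h0]; rfl
  have e1 : iterLift hs γ = cov.liftPath γ.toContinuousMap (iterLift hs γ 0) hγ0 :=
    (cov.eq_liftPath_iff _).2 ⟨continuous_iterLift hs hγ, rfl, rfl⟩
  have e2 : iterLift hs η = cov.liftPath η.toContinuousMap (iterLift hs γ 0) hη0 :=
    (cov.eq_liftPath_iff _).2 ⟨continuous_iterLift hs hη, rfl, h0.symm⟩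
  have e3 := cov.liftPath_apply_one_eq_of_homotopicRel h (iterLift hs γ 0) hγ0 hη0
  rw [← e1, ← e2] at e3
  exact congrFun (congrArg (fun p : (flatCore hs).TotalSpace => (p.2 : WordFun)) e3) ws

end Covering

end

end ChenPlane

namespace ChenPlane

noncomputable section

/-! ### Piecewise `C¹` representatives -/

section Representatives

open Set Filter Topology Metric

variable {H : Poly2}

/-- The parametrization of a chart, as a map into the curve. -/
def CurveChart.parCurve {q : Fin 2 → ℂ} (C : CurveChart H q) :
    C(ball (q C.idx) C.rad, Curve H) where
  toFun z := ⟨C.par z, C.par_zeros z z.2⟩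
  continuous_toFun := (continuousOn_iff_continuous_domRestrict.1
    C.differentiableOn_par.continuousOn).subtype_mk _

theorem CurveChart.parCurve_apply {q : Fin 2 → ℂ} (C : CurveChart H q) {x : Curve H}
    (hx : x.1 ∈ C.dom) : C.parCurve ⟨x.1 C.idx, C.idx_mem _ hx⟩ = x :=
  Subtype.ext (C.par_of_mem _ hx x.2)

/-- The path in a chart which is straight in the chart coordinate. -/
def CurveChart.straight {q : Fin 2 → ℂ} (C : CurveChart H q) {x y : Curve H} (hx : x.1 ∈ C.dom)
    (hy : y.1 ∈ C.dom) : Path (⟨x.1 C.idx, C.idx_mem _ hx⟩ : ball (q C.idx) C.rad)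
      ⟨y.1 C.idx, C.idx_mem _ hy⟩ where
  toFun t := ⟨AffineMap.lineMap (x.1 C.idx) (y.1 C.idx) (t : ℝ),
    (convex_ball _ _).lineMap_mem (C.idx_mem _ hx) (C.idx_mem _ hy) t.2⟩
  continuous_toFun := (AffineMap.lineMap_continuous.comp continuous_subtype_val).subtype_mk _
  source' := by simp
  target' := by simp

theorem CurveChart.piecewiseC1_straight {q : Fin 2 → ℂ} (C : CurveChart H q) {x y : Curve H}
    (hx : x.1 ∈ C.dom) (hy : y.1 ∈ C.dom) :
    PiecewiseC1 (pathCurve (((C.straight hx hy).map C.parCurve.continuous).cast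
      (C.parCurve_apply hx).symm (C.parCurve_apply hy).symm)) := by
  refine ⟨(continuous_pathCurve _).continuousOn, ∅, fun a b ha _ hb _ => ?_⟩
  refine ContDiffOn.mono ?_ (Icc_subset_Icc ha hb)
  have h : ContDiffOn ℝ 1 (fun t : ℝ => C.par (AffineMap.lineMap (x.1 C.idx) (y.1 C.idx) t))
      (Icc 0 1) := by
    have h1 : ContDiffOn ℝ 1 C.par (ball (q C.idx) C.rad) :=
      (C.differentiableOn_par.contDiffOn isOpen_ball).restrict_scalars ℝ
    refine h1.comp (f := fun t : ℝ => AffineMap.lineMap (x.1 C.idx) (y.1 C.idx) t) ?_ ?_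
    · simp only [AffineMap.lineMap_apply, vsub_eq_sub, vadd_eq_add]
      exact ContDiff.contDiffOn (by fun_prop)
    · intro t ht
      exact (convex_ball _ _).lineMap_mem (C.idx_mem _ hx) (C.idx_mem _ hy) ht
  refine h.congr fun t ht => ?_
  rw [pathCurve, Path.extend_apply _ ht]
  rfl

/-- The coordinate disc is simply connected, so the path is homotopic there to the straight one; the
parametrization carries the homotopy to the curve. -/
theorem CurveChart.exists_piecewiseC1_homotopic {q : Fin 2 → ℂ} (C : CurveChart H q)
    {x y : Curve H} (η : Path x y) (hη : ∀ t, (η t).1 ∈ C.dom) :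
    ∃ ρ : Path x y, PiecewiseC1 (pathCurve ρ) ∧ η.Homotopic ρ := by
  have hx : x.1 ∈ C.dom := by simpa using hη 0
  have hy : y.1 ∈ C.dom := by simpa using hη 1
  refine ⟨_, C.piecewiseC1_straight hx hy, ?_⟩
  let η' : Path (⟨x.1 C.idx, C.idx_mem _ hx⟩ : ball (q C.idx) C.rad)
      ⟨y.1 C.idx, C.idx_mem _ hy⟩ :=
    { toFun := fun t => ⟨(η t).1 C.idx, C.idx_mem _ (hη t)⟩
      continuous_toFun := ((continuous_apply C.idx).comp
        (continuous_subtype_val.comp η.continuous)).subtype_mk _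
      source' := by simp
      target' := by simp }
  have hcontr : ContractibleSpace (ball (q C.idx) C.rad) :=
    (convex_ball _ _).contractibleSpace (nonempty_ball.2 C.rad_pos)
  have h := (SimplyConnectedSpace.paths_homotopic η' (C.straight hx hy)).map C.parCurve
  have e : η = (η'.map C.parCurve.continuous).cast
      (C.parCurve_apply hx).symm (C.parCurve_apply hy).symm := by
    refine Path.ext (funext fun t => ?_)
    exact (C.parCurve_apply (hη t)).symm
  rw [e]
  exact h

/-- Connectedness of the unit interval: the parameters up to which the path can be replaced form a
clopen set, since near any parameter the path stays in one chart, where a subpath can be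
straightened. -/
theorem exists_piecewiseC1_homotopic (hs : IsSmoothCurve H) {x y : Curve H} (γ : Path x y) :
    ∃ ρ : Path x y, PiecewiseC1 (pathCurve ρ) ∧ γ.Homotopic ρ := by
  set A : Set I := {t | ∃ ρ : Path (γ 0) (γ t), PiecewiseC1 (pathCurve ρ) ∧
    (γ.subpath 0 t).Homotopic ρ} with hA
  have hloc : ∀ t₀ : I, ∀ᶠ t in 𝓝 t₀, t ∈ A ↔ t₀ ∈ A := by
    intro t₀
    set C := curveChart hs (γ t₀) with hC
    have hnhds : ∀ᶠ t in 𝓝 t₀, (γ t).1 ∈ C.dom :=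
      (continuous_subtype_val.comp γ.continuous).continuousAt.eventually
        (C.isOpen_dom.mem_nhds C.mem_dom)
    obtain ⟨ε, hε, hball⟩ := Metric.eventually_nhds_iff_ball.1 hnhds
    have hstep : ∀ t ∈ ball t₀ ε, ∀ t' ∈ ball t₀ ε, t ∈ A → t' ∈ A := by
      rintro t ht t' ht' ⟨ρ, hρ, hρh⟩
      obtain ⟨τ, hτ, hτh⟩ := C.exists_piecewiseC1_homotopic (γ.subpath t t') (fun s => by
        have hmem : γ.subpath t t' s ∈ γ '' uIcc t t' := by
          rw [← Path.range_subpath]; exact mem_range_self s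
        obtain ⟨r, hr, hrs⟩ := hmem
        rw [← hrs]
        refine hball r ?_
        have hr' : (r : ℝ) ∈ uIcc (t : ℝ) t' := by
          have hm : Monotone (Subtype.val : I → ℝ) := fun _ _ h => h
          rw [uIcc, mem_Icc] at hr ⊢
          rw [← hm.map_inf, ← hm.map_sup]
          exact hr
        exact (convex_ball (t₀ : ℝ) ε).ordConnected.uIcc_subset ht ht' hr')
      exact ⟨ρ.trans τ, piecewiseC1_trans hρ hτ,
        (Path.Homotopic.symm ⟨Path.Homotopy.subpathTransSubpath γ 0 t t'⟩).trans
          (hρh.hcomp hτh)⟩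
    filter_upwards [ball_mem_nhds t₀ hε] with t ht
    exact ⟨hstep t ht t₀ (mem_ball_self hε), hstep t₀ (mem_ball_self hε) t ht⟩
  have hclopen : IsClopen A := by
    constructor
    · rw [← isOpen_compl_iff, isOpen_iff_mem_nhds]
      intro t₀ ht₀
      filter_upwards [hloc t₀] with t ht h
      exact ht₀ (ht.1 h)
    · rw [isOpen_iff_mem_nhds]
      intro t₀ ht₀
      filter_upwards [hloc t₀] with t ht
      exact ht.2 ht₀
  have h0 : (0 : I) ∈ A := by
    refine ⟨Path.refl _, ?_, ?_⟩
    · rw [pathCurve_refl]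
      exact piecewiseC1_const _
    · rw [Path.subpath_self]
  have h1 : (1 : I) ∈ A := hclopen.eq_univ ⟨0, h0⟩ ▸ mem_univ _
  obtain ⟨ρ, hρ, hρh⟩ := h1
  rw [Path.subpath_zero_one] at hρh
  refine ⟨ρ.cast γ.source.symm γ.target.symm, ?_, ?_⟩
  · exact hρ
  · exact hρh

/-! ### Integrals over homotopy classes -/

variable {p₀ : Curve H}

theorem exists_piecewiseC1_loop (hs : IsSmoothCurve H) (α : FundamentalGroup (Curve H) p₀) :
    ∃ γ : Path p₀ p₀, PiecewiseC1 (curveOf γ) ∧ loopClass γ = α := by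
  obtain ⟨γ, hγ⟩ := Quotient.exists_rep α.toPath
  obtain ⟨ρ, hρ, hh⟩ := exists_piecewiseC1_homotopic hs γ
  refine ⟨ρ, hρ, ?_⟩
  have : (Path.Homotopic.Quotient.mk ρ) = α.toPath := by
    rw [← hγ]
    exact (Quotient.sound hh).symm
  exact this

/-- Homotopy invariance makes the representative chosen in `loopIterInt` immaterial. -/
theorem loopIterInt_loopClass (hs : IsSmoothCurve H) {γ : Path p₀ p₀}
    (hγ : PiecewiseC1 (curveOf γ)) (ws : List OneForm) :
    loopIterInt (loopClass γ) ws = iterInt (curveOf γ) ws 1 := by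
  have hex : ∃ η : Path p₀ p₀, PiecewiseC1 (curveOf η) ∧ loopClass η = loopClass γ := ⟨γ, hγ, rfl⟩
  rw [loopIterInt, dif_pos hex]
  exact iterInt_eq_of_homotopic hs hex.choose_spec.1 hγ (Quotient.exact hex.choose_spec.2) ws

theorem loopIterInt_nil (hs : IsSmoothCurve H) (α : FundamentalGroup (Curve H) p₀) :
    loopIterInt α [] = 1 := by
  obtain ⟨γ, hγ, rfl⟩ := exists_piecewiseC1_loop hs α
  rw [loopIterInt_loopClass hs hγ]
  rfl

theorem loopIterInt_one_cons (hs : IsSmoothCurve H) (θ : OneForm) (ws : List OneForm) :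
    loopIterInt (1 : FundamentalGroup (Curve H) p₀) (θ :: ws) = 0 := by
  have h : PiecewiseC1 (curveOf (Path.refl p₀)) := by
    change PiecewiseC1 (pathCurve (Path.refl p₀))
    rw [pathCurve_refl]
    exact piecewiseC1_const _
  have h1 : (1 : FundamentalGroup (Curve H) p₀) = loopClass (Path.refl p₀) := rfl
  rw [h1, loopIterInt_loopClass hs h]
  change iterInt (pathCurve (Path.refl p₀)) _ 1 = 0
  rw [pathCurve_refl, iterInt_const_cons]

theorem loopIterInt_mul (hs : IsSmoothCurve H) (α β : FundamentalGroup (Curve H) p₀)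
    (ws : List OneForm) : loopIterInt (α * β) ws = ∑ k ∈ Finset.range (ws.length + 1),
      loopIterInt α (ws.take k) * loopIterInt β (ws.drop k) := by
  obtain ⟨γ, hγ, rfl⟩ := exists_piecewiseC1_loop hs α
  obtain ⟨η, hη, rfl⟩ := exists_piecewiseC1_loop hs β
  -- The right factor runs first, so the outer integrations, which form the prefix of the word,
  -- belong to the left factor.
  have h1 : loopClass γ * loopClass η = loopClass (η.trans γ) := rfl
  simp only [h1, loopIterInt_loopClass hs hγ, loopIterInt_loopClass hs hη]
  rw [loopIterInt_loopClass hs (piecewiseC1_trans hη hγ)]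
  exact iterInt_trans hη hγ ws

theorem chenTrunc_one (hs : IsSmoothCurve H) {N : ℕ} (ω : Fin N → OneForm) (K : ℕ) :
    chenTrunc ω K (1 : FundamentalGroup (Curve H) p₀) = 1 := by
  refine trunc_eq_one (loopIterInt_nil hs 1) fun w hw => ?_
  induction w using FreeMonoid.casesOn with
  | one => exact absurd rfl hw
  | of_mul i w => exact loopIterInt_one_cons hs _ _

theorem chenTrunc_mul (hs : IsSmoothCurve H) {N : ℕ} (ω : Fin N → OneForm) (K : ℕ)
    (α β : FundamentalGroup (Curve H) p₀) :
    chenTrunc ω K (α * β) = chenTrunc ω K α * chenTrunc ω K β := by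
  refine trunc_mul fun w => ?_
  simp only [chen, loopIterInt_mul hs, List.length_map, ← List.map_take, ← List.map_drop,
    FreeMonoid.toList_ofList]
  rfl

end Representatives

end

end ChenPlane

namespace ChenPlane

noncomputable section

/-! ### Functions of polynomial growth -/

section Growth

open Set Filter Topology Metric Polynomial

/-- Polynomial growth in the first variable. -/
def PolyGrowth (Z : Set (ℂ × ℂ)) (G : ℂ × ℂ → ℂ) : Prop :=
  ∃ C : ℝ, 0 ≤ C ∧ ∃ M : ℕ, ∀ p ∈ Z, ‖G p‖ ≤ C * (1 + ‖p.1‖) ^ M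

namespace PolyGrowth

variable {Z : Set (ℂ × ℂ)} {G G' : ℂ × ℂ → ℂ}

theorem const (c : ℂ) : PolyGrowth Z fun _ => c :=
  ⟨‖c‖, norm_nonneg c, 0, fun p _ => by simp⟩

theorem fst : PolyGrowth Z fun p => p.1 :=
  ⟨1, zero_le_one, 1, fun p _ => by simp⟩

theorem add (h : PolyGrowth Z G) (h' : PolyGrowth Z G') : PolyGrowth Z fun p => G p + G' p := by
  obtain ⟨C, hC, M, hM⟩ := h
  obtain ⟨C', hC', M', hM'⟩ := h'
  refine ⟨C + C', add_nonneg hC hC', max M M', fun p hp => ?_⟩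
  have h1 : 1 ≤ 1 + ‖p.1‖ := by linarith [norm_nonneg p.1]
  have e1 := mul_le_mul_of_nonneg_left (pow_le_pow_right₀ h1 (le_max_left M M')) hC
  have e2 := mul_le_mul_of_nonneg_left (pow_le_pow_right₀ h1 (le_max_right M M')) hC'
  have := norm_add_le (G p) (G' p)
  have := hM p hp
  have := hM' p hp
  rw [add_mul]
  linarith

theorem mul (h : PolyGrowth Z G) (h' : PolyGrowth Z G') : PolyGrowth Z fun p => G p * G' p := by
  obtain ⟨C, hC, M, hM⟩ := h
  obtain ⟨C', hC', M', hM'⟩ := h'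
  refine ⟨C * C', mul_nonneg hC hC', M + M', fun p hp => ?_⟩
  rw [norm_mul, pow_add]
  calc ‖G p‖ * ‖G' p‖ ≤ (C * (1 + ‖p.1‖) ^ M) * (C' * (1 + ‖p.1‖) ^ M') :=
        mul_le_mul (hM p hp) (hM' p hp) (norm_nonneg _) (by positivity)
    _ = _ := by ring

theorem pow (h : PolyGrowth Z G) (n : ℕ) : PolyGrowth Z fun p => G p ^ n := by
  induction n with
  | zero => simpa using const 1
  | succ n ih => simpa only [pow_succ] using ih.mul h

theorem sum {ι : Type*} (s : Finset ι) {G : ι → ℂ × ℂ → ℂ} (h : ∀ i ∈ s, PolyGrowth Z (G i)) :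
    PolyGrowth Z fun p => ∑ i ∈ s, G i p := by
  classical
  induction s using Finset.induction_on with
  | empty => simpa using const 0
  | insert a s ha ih =>
    simp only [Finset.sum_insert ha]
    exact (h a (Finset.mem_insert_self _ _)).add
      (ih fun i hi => h i (Finset.mem_insert_of_mem hi))


theorem of_norm_le (h : PolyGrowth Z G) (hle : ∀ p ∈ Z, ‖G' p‖ ≤ ‖G p‖) : PolyGrowth Z G' := by
  obtain ⟨C, hC, M, hM⟩ := h
  exact ⟨C, hC, M, fun p hp => (hle p hp).trans (hM p hp)⟩

theorem norm (h : PolyGrowth Z G) : PolyGrowth Z fun p => (‖G p‖ : ℂ) :=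
  h.of_norm_le fun p _ => by simp

theorem eval (q : ℂ[X]) : PolyGrowth Z fun p => q.eval p.1 := by
  induction q using Polynomial.induction_on' with
  | add p q hp hq => simpa only [eval_add] using hp.add hq
  | monomial n a => simpa only [eval_monomial] using (const a).mul (fst.pow n)

theorem evalEval_of_snd (h : PolyGrowth Z fun p => p.2) (q : ℂ[X][X]) :
    PolyGrowth Z fun p => q.evalEval p.1 p.2 := by
  induction q using Polynomial.induction_on' with
  | add p q hp hq => simpa only [evalEval_add] using hp.add hq
  | monomial n a =>
    have : ∀ p : ℂ × ℂ, (Polynomial.monomial n a).evalEval p.1 p.2 = a.eval p.1 * p.2 ^ n := fun p => by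
      rw [← C_mul_X_pow_eq_monomial, evalEval_mul, evalEval_C, evalEval_pow, evalEval_X]
    simpa only [this] using (PolyGrowth.eval a).mul (h.pow n)

end PolyGrowth

/-- An entire function of polynomial growth is a polynomial. -/
theorem exists_polynomial_of_growth {h : ℂ → ℂ} (hd : Differentiable ℂ h) {C : ℝ} (hC : 0 ≤ C)
    {M : ℕ} (hM : ∀ z, ‖h z‖ ≤ C * (1 + ‖z‖) ^ M) : ∃ p : ℂ[X], ∀ z, h z = p.eval z := by
  -- Cauchy's estimate on the circle of radius `R` bounds the derivative by a multiple of `R ^ (M -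
  -- n)`, which tends to `0`.
  have hzero : ∀ n, M < n → iteratedDeriv n h 0 = 0 := by
    intro n hn
    have hbound : ∀ R : ℝ, 1 ≤ R → ‖iteratedDeriv n h 0‖ ≤ n.factorial * C * 2 ^ M * R⁻¹ := by
      intro R hR
      have hR0 : 0 < R := by linarith
      have h1 := Complex.norm_iteratedDeriv_le_of_forall_mem_sphere_norm_le (c := 0)
        (C := C * (2 * R) ^ M) n hR0 hd.diffContOnCl fun z hz => by
          refine (hM z).trans ?_
          rw [mem_sphere_zero_iff_norm] at hz
          rw [hz]
          gcongr
          linarith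
      refine h1.trans ?_
      rw [div_le_iff₀ (by positivity)]
      obtain ⟨k, rfl⟩ : ∃ k, n = M + 1 + k := ⟨n - (M + 1), by omega⟩
      have : (1 : ℝ) ≤ R ^ k := one_le_pow₀ hR
      have e : ((M + 1 + k).factorial : ℝ) * C * 2 ^ M * R⁻¹ * R ^ (M + 1 + k) =
          ((M + 1 + k).factorial : ℝ) * (C * (2 * R) ^ M) * R ^ k := by
        rw [pow_add, pow_succ, mul_pow]
        field_simp
      rw [e]
      exact le_mul_of_one_le_right (by positivity) this
    have hlim : Tendsto (fun R : ℝ => (n.factorial * C * 2 ^ M : ℝ) * R⁻¹) atTop (𝓝 0) := by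
      simpa using tendsto_inv_atTop_zero.const_mul (n.factorial * C * 2 ^ M : ℝ)
    have := ge_of_tendsto hlim ((eventually_ge_atTop 1).mono hbound)
    exact norm_le_zero_iff.1 this
  refine ⟨∑ n ∈ Finset.range (M + 1), Polynomial.monomial n
    ((n.factorial : ℂ)⁻¹ * iteratedDeriv n h 0), fun z => ?_⟩
  rw [← Complex.taylorSeries_eq_of_entire' (c := 0) (z := z) hd, eval_finsetSum,
    tsum_eq_sum (s := Finset.range (M + 1))]
  · simp
  · intro n hn
    rw [hzero n (by simpa using hn)]
    simp

/-- A function which is holomorphic off a finite set and has polynomial growth agrees with a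
polynomial off that set. -/
theorem exists_polynomial_of_growth_off_finite {h : ℂ → ℂ} {B : Set ℂ} (hB : B.Finite)
    (hd : ∀ z ∉ B, DifferentiableAt ℂ h z) {C : ℝ} (hC : 0 ≤ C)
    {M : ℕ} (hM : ∀ z, ‖h z‖ ≤ C * (1 + ‖z‖) ^ M) :
    ∃ p : ℂ[X], ∀ z ∉ B, h z = p.eval z := by
  have hopen : IsOpen Bᶜ := hB.isClosed.isOpen_compl
  have hne : ∀ z, ∀ᶠ w in 𝓝[≠] z, w ∉ B := fun z => by
    have : (B \ {z})ᶜ ∈ 𝓝 z := (hB.subset sdiff_subset).isClosed.isOpen_compl.mem_nhds (by simp)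
    filter_upwards [mem_nhdsWithin_of_mem_nhds this, self_mem_nhdsWithin] with w hw hwz hwB
    exact hw ⟨hwB, hwz⟩
  -- The growth bound makes every exceptional point a removable singularity, and `k` is the entire
  -- extension.
  set k : ℂ → ℂ := fun z => limUnder (𝓝[≠] z) h with hk
  have hgood : ∀ z ∉ B, k z = h z := fun z hz =>
    ((hd z hz).continuousAt.tendsto.mono_left nhdsWithin_le_nhds).limUnder_eq
  have hkd : Differentiable ℂ k := by
    intro z
    obtain ⟨ε, hε, hball⟩ := Metric.mem_nhdsWithin_iff.1 (hne z)
    have hoff : ∀ w ∈ ball z ε \ {z}, w ∉ B := fun w hw => hball hw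
    have h1 := Complex.differentiableOn_update_limUnder_of_bddAbove (f := h)
      (ball_mem_nhds z hε) (fun w hw => (hd w (hoff w hw)).differentiableWithinAt)
      ⟨C * (1 + (‖z‖ + ε)) ^ M, by
        rintro _ ⟨w, hw, rfl⟩
        refine (hM w).trans ?_
        have : ‖w‖ ≤ ‖z‖ + ε := by
          have h2 := mem_ball_iff_norm.1 hw.1
          have h3 := norm_le_norm_add_norm_sub' w z
          linarith
        gcongr⟩
    refine (h1.differentiableAt (ball_mem_nhds z hε)).congr_of_eventuallyEq ?_
    filter_upwards [ball_mem_nhds z hε] with w hw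
    rcases eq_or_ne w z with rfl | hwz
    · simp [hk]
    · rw [Function.update_of_ne hwz]
      exact hgood w (hoff w ⟨hw, hwz⟩)
  obtain ⟨p, hp⟩ := exists_polynomial_of_growth hkd hC (M := M) fun z => by
    have hcont : Tendsto (fun w => ‖k w‖) (𝓝[≠] z) (𝓝 ‖k z‖) :=
      (hkd.continuous.norm.tendsto z).mono_left nhdsWithin_le_nhds
    have hcont2 : Tendsto (fun w : ℂ => C * (1 + ‖w‖) ^ M) (𝓝[≠] z) (𝓝 (C * (1 + ‖z‖) ^ M)) :=
      (Continuous.tendsto (by fun_prop) z).mono_left nhdsWithin_le_nhds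
    refine le_of_tendsto_of_tendsto hcont hcont2 ?_
    filter_upwards [hne z] with w hw
    rw [hgood w hw]
    exact hM w
  exact ⟨p, fun z hz => by rw [← hgood z hz, hp z]⟩

/-! ### Bivariate polynomials that are monic in the second variable -/

/-- The zero set of a bivariate polynomial. -/
def bizeros (f : ℂ[X][X]) : Set (ℂ × ℂ) := {p | f.evalEval p.1 p.2 = 0}

/-- Cauchy's bound for the roots of a monic polynomial: `1` plus the sum of the absolute values of
the lower coefficients. -/
theorem polyGrowth_snd {f : ℂ[X][X]} (hf : f.Monic) : PolyGrowth (bizeros f) fun p => p.2 := by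
  have h : PolyGrowth (bizeros f) fun p =>
      1 + ∑ i ∈ Finset.range f.natDegree, (‖(f.coeff i).eval p.1‖ : ℂ) :=
    (PolyGrowth.const 1).add (PolyGrowth.sum _ fun i _ => (PolyGrowth.eval (f.coeff i)).norm)
  refine h.of_norm_le fun p hp => ?_
  have hnn : 0 ≤ ∑ i ∈ Finset.range f.natDegree, ‖(f.coeff i).eval p.1‖ :=
    Finset.sum_nonneg fun i _ => norm_nonneg _
  have hnorm : ‖(1 : ℂ) + ∑ i ∈ Finset.range f.natDegree, (‖(f.coeff i).eval p.1‖ : ℂ)‖ =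
      1 + ∑ i ∈ Finset.range f.natDegree, ‖(f.coeff i).eval p.1‖ := by
    rw [← Complex.ofReal_sum, ← Complex.ofReal_one, ← Complex.ofReal_add, Complex.norm_real,
      Real.norm_of_nonneg (by linarith)]
  rw [hnorm]
  rcases le_or_gt ‖p.2‖ 1 with h1 | h1
  · linarith
  have hp' : f.evalEval p.1 p.2 = 0 := hp
  have hexp : f.evalEval p.1 p.2 = p.2 ^ f.natDegree +
      ∑ i ∈ Finset.range f.natDegree, (f.coeff i).eval p.1 * p.2 ^ i := by
    conv_lhs => rw [hf.as_sum]
    simp only [evalEval_finsetSum, evalEval_add, evalEval_mul, evalEval_pow, evalEval_X, evalEval_C]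
  rcases Nat.eq_zero_or_pos f.natDegree with h0 | hpos
  · rw [hexp, h0] at hp'
    simp at hp'
  obtain ⟨d, hd⟩ := Nat.exists_eq_succ_of_ne_zero hpos.ne'
  have hle : ‖p.2‖ ^ (d + 1) ≤ (∑ i ∈ Finset.range f.natDegree, ‖(f.coeff i).eval p.1‖) *
      ‖p.2‖ ^ d := by
    have e : p.2 ^ (d + 1) = -∑ i ∈ Finset.range f.natDegree, (f.coeff i).eval p.1 * p.2 ^ i := by
      rw [hexp, hd] at hp'
      rw [hd]
      exact eq_neg_of_add_eq_zero_left hp'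
    rw [← norm_pow, e, norm_neg, Finset.sum_mul]
    refine (norm_sum_le _ _).trans (Finset.sum_le_sum fun i hi => ?_)
    rw [norm_mul, norm_pow]
    have : i ≤ d := by have := Finset.mem_range.1 hi; omega
    gcongr
    exact h1.le
  rw [pow_succ'] at hle
  have := le_of_mul_le_mul_right hle (pow_pos (by linarith) d)
  linarith

/-- A monic irreducible polynomial has a nonzero discriminant: some nonzero polynomial of the first
variable lies in the ideal generated by the polynomial and its derivative. -/
theorem exists_discriminant {f : ℂ[X][X]} (hf : f.Monic) (hirr : Irreducible f) :
    ∃ A B : ℂ[X][X], ∃ D : ℂ[X], D ≠ 0 ∧ A * f + B * derivative f = C D := by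
  let K := FractionRing ℂ[X]
  -- By Gauss's lemma `f` stays irreducible over the fraction field, hence is separable in
  -- characteristic zero. Clearing denominators in the Bézout relation produces `D`.
  have hirr' : Irreducible (f.map (algebraMap ℂ[X] K)) :=
    (hf.irreducible_iff_irreducible_map_fraction_map (K := K)).1 hirr
  obtain ⟨a, b, hab⟩ := hirr'.separable
  obtain ⟨c, hc0, hc⟩ := IsLocalization.integerNormalization_spec (nonZeroDivisors ℂ[X]) a
  obtain ⟨d, hd0, hd⟩ := IsLocalization.integerNormalization_spec (nonZeroDivisors ℂ[X]) b
  refine ⟨C d * IsLocalization.integerNormalization (nonZeroDivisors ℂ[X]) a,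
    C c * IsLocalization.integerNormalization (nonZeroDivisors ℂ[X]) b, c * d,
    mul_ne_zero (nonZeroDivisors.ne_zero hc0) (nonZeroDivisors.ne_zero hd0), ?_⟩
  apply Polynomial.map_injective _ (IsFractionRing.injective ℂ[X] K)
  have hs : ∀ (c : ℂ[X]) (q : K[X]), c • q = C (algebraMap ℂ[X] K c) * q := fun c q => by
    rw [← smul_eq_C_mul, algebraMap_smul]
  rw [hs] at hc hd
  simp only [Polynomial.map_add, Polynomial.map_mul, map_C, hc, hd, map_mul]
  rw [derivative_map] at hab
  linear_combination (C (algebraMap ℂ[X] K c) * C (algebraMap ℂ[X] K d)) * hab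

end Growth

end

end ChenPlane

namespace ChenPlane

noncomputable section

/-! ### Traces over the fibres and Lagrange interpolation -/

section Traces

open Set Filter Topology Metric Polynomial

theorem contDiff_evalEval (f : ℂ[X][X]) : ContDiff ℂ 1 fun p : ℂ × ℂ => f.evalEval p.1 p.2 := by
  induction f using Polynomial.induction_on' with
  | add p q hp hq => simpa only [evalEval_add] using hp.add hq
  | monomial n a =>
    have : ∀ p : ℂ × ℂ, (Polynomial.monomial n a).evalEval p.1 p.2 = a.eval p.1 * p.2 ^ n :=
      fun p => by
        rw [← C_mul_X_pow_eq_monomial, evalEval_mul, evalEval_C, evalEval_pow, evalEval_X]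
    simp only [this]
    exact ((Polynomial.contDiff_aeval a 1).comp contDiff_fst).mul (contDiff_snd.pow n)

theorem exists_hasFDerivAt_evalEval (f : ℂ[X][X]) : ∃ P : ℂ[X][X], ∀ p : ℂ × ℂ,
    HasFDerivAt (fun p : ℂ × ℂ => f.evalEval p.1 p.2)
      (P.evalEval p.1 p.2 • ContinuousLinearMap.fst ℂ ℂ ℂ +
        (derivative f).evalEval p.1 p.2 • ContinuousLinearMap.snd ℂ ℂ ℂ) p := by
  induction f using Polynomial.induction_on' with
  | add f g hf hg =>
    obtain ⟨P, hP⟩ := hf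
    obtain ⟨Q, hQ⟩ := hg
    refine ⟨P + Q, fun p => ?_⟩
    simp only [evalEval_add, derivative_add]
    refine ((hP p).add (hQ p)).congr_fderiv ?_
    ext <;> simp
  | monomial n a =>
    refine ⟨Polynomial.monomial n (derivative a), fun p => ?_⟩
    have : ∀ (n : ℕ) (a : ℂ[X]) (p : ℂ × ℂ),
        (Polynomial.monomial n a).evalEval p.1 p.2 = a.eval p.1 * p.2 ^ n :=
      fun n a p => by
        rw [← C_mul_X_pow_eq_monomial, evalEval_mul, evalEval_C, evalEval_pow, evalEval_X]
    simp only [this, derivative_monomial]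
    have h1 : HasFDerivAt (fun p : ℂ × ℂ => a.eval p.1)
        ((derivative a).eval p.1 • ContinuousLinearMap.fst ℂ ℂ ℂ) p :=
      (a.hasDerivAt p.1).comp_hasFDerivAt p hasFDerivAt_fst
    have h2 : HasFDerivAt (fun p : ℂ × ℂ => p.2 ^ n)
        ((n * p.2 ^ (n - 1) : ℂ) • ContinuousLinearMap.snd ℂ ℂ ℂ) p :=
      (hasDerivAt_pow n p.2).comp_hasFDerivAt p hasFDerivAt_snd
    refine (h1.mul h2).congr_fderiv ?_
    ext
    · simp [mul_comm]
    · simp [mul_assoc]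

/-- The fibre of the zero set over a value of the first variable. -/
def fibre (f : ℂ[X][X]) (s : ℂ) : Finset ℂ := (f.map (evalRingHom s)).roots.toFinset

variable {f : ℂ[X][X]}

theorem mem_fibre (hf : f.Monic) {s t : ℂ} : t ∈ fibre f s ↔ f.evalEval s t = 0 := by
  rw [fibre, Multiset.mem_toFinset, mem_roots (hf.map _).ne_zero, IsRoot.def, map_evalRingHom_eval]

theorem card_fibre_le (hf : f.Monic) (s : ℂ) : (fibre f s).card ≤ f.natDegree := by
  rw [← hf.natDegree_map (evalRingHom s)]
  exact (Multiset.toFinset_card_le _).trans (card_roots' _)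

theorem card_fibre (hf : f.Monic) {s : ℂ}
    (hs : ∀ t, f.evalEval s t = 0 → (derivative f).evalEval s t ≠ 0) :
    (fibre f s).card = f.natDegree := by
  have hne := (hf.map (evalRingHom s)).ne_zero
  have hnd : (f.map (evalRingHom s)).roots.Nodup := by
    rw [Multiset.nodup_iff_count_le_one]
    intro t
    rw [count_roots]
    by_contra! hlt
    have := (one_lt_rootMultiplicity_iff_isRoot hne).1 hlt
    refine hs t ?_ ?_
    · rw [← map_evalRingHom_eval]; exact this.1
    · rw [← map_evalRingHom_eval, ← derivative_map]; exact this.2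
  rw [fibre, Multiset.toFinset_card_of_nodup hnd, ← hf.natDegree_map (evalRingHom s)]
  exact (IsAlgClosed.splits _).natDegree_eq_card_roots.symm

/-- Locally, over a value where the fibre is reduced, the zero set is a disjoint union of graphs. -/
theorem exists_local_sections (hf : f.Monic) {s₀ : ℂ}
    (hs : ∀ᶠ s in 𝓝 s₀, ∀ t, f.evalEval s t = 0 → (derivative f).evalEval s t ≠ 0) :
    ∃ g : ℂ → ℂ → ℂ, (∀ t ∈ fibre f s₀, g t s₀ = t ∧
        ∀ᶠ s in 𝓝 s₀, DifferentiableAt ℂ (g t) s ∧ f.evalEval s (g t s) = 0) ∧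
      ∀ᶠ s in 𝓝 s₀, InjOn (g · s) (fibre f s₀) ∧ fibre f s = (fibre f s₀).image (g · s) := by
  classical
  obtain ⟨P, hP⟩ := exists_hasFDerivAt_evalEval f
  have hex : ∀ t ∈ fibre f s₀, ∃ g : ℂ → ℂ, g s₀ = t ∧
      ∀ᶠ s in 𝓝 s₀, DifferentiableAt ℂ g s ∧ f.evalEval s (g s) = 0 := by
    intro t ht
    rw [mem_fibre hf] at ht
    obtain ⟨g, r, hr, ρ, hρ, -, hg0, hgd, hgm, hg⟩ :=
      exists_graph (contDiff_evalEval f) (a := s₀) (b := t) ht (by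
        rw [(hP _).fderiv]; simpa using hs.self_of_nhds t ht) univ_mem
    refine ⟨g, hg0, ?_⟩
    filter_upwards [isOpen_ball.mem_nhds (mem_ball_self hr)] with s hs
    exact ⟨hgd.differentiableAt (isOpen_ball.mem_nhds hs), (hg s hs _ (hgm s hs)).2 rfl⟩
  choose! g hg using hex
  refine ⟨g, hg, ?_⟩
  have hinj : ∀ᶠ s in 𝓝 s₀, InjOn (g · s) (fibre f s₀) := by
    have : ∀ᶠ s in 𝓝 s₀, ∀ t ∈ fibre f s₀, ∀ t' ∈ fibre f s₀, t ≠ t' → g t s ≠ g t' s := by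
      simp only [Finset.eventually_all]
      intro t ht t' ht'
      by_cases htt : t = t'
      · simp [htt]
      have h1 := (hg t ht).2.self_of_nhds.1.continuousAt
      have h2 := (hg t' ht').2.self_of_nhds.1.continuousAt

      have h3 : ContinuousAt (fun s => g t s - g t' s) s₀ := h1.sub h2
      filter_upwards [h3.eventually_ne (by
        rw [(hg t ht).1, (hg t' ht').1]; exact sub_ne_zero.2 htt)] with s hs _
      exact sub_ne_zero.1 hs
    filter_upwards [this] with s hs t ht t' ht' htt
    by_contra h
    exact hs t ht t' ht' h htt
  have hz : ∀ᶠ s in 𝓝 s₀, ∀ t ∈ fibre f s₀, f.evalEval s (g t s) = 0 := by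
    simp only [Finset.eventually_all]
    exact fun t ht => (hg t ht).2.mono fun s hs => hs.2
  filter_upwards [hinj, hz, hs] with s h1 h2 h3
  -- The sections give distinct points of the nearby fibre; both fibres have `f.natDegree` points,
  -- so none is missed.
  refine ⟨h1, (Finset.eq_of_subset_of_card_le ?_ ?_).symm⟩
  · intro u hu
    obtain ⟨t, ht, rfl⟩ := Finset.mem_image.1 hu
    exact (mem_fibre hf).2 (h2 t ht)
  · rw [Finset.card_image_of_injOn h1, card_fibre hf h3, card_fibre hf hs.self_of_nhds]

/-- The sum over the fibre of a function of polynomial growth which is holomorphic along graphs is a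
polynomial. -/
theorem exists_polynomial_eq_trace (hf : f.Monic) {D : ℂ[X]} (hD : D ≠ 0)
    (hDf : ∀ s t, D.eval s ≠ 0 → f.evalEval s t = 0 → (derivative f).evalEval s t ≠ 0)
    {G : ℂ × ℂ → ℂ} (hG : PolyGrowth (bizeros f) G)
    (hd : ∀ (g : ℂ → ℂ) (s : ℂ), DifferentiableAt ℂ g s → (∀ᶠ s in 𝓝 s, f.evalEval s (g s) = 0) →
      DifferentiableAt ℂ (fun s => G (s, g s)) s) :
    ∃ q : ℂ[X], ∀ s, D.eval s ≠ 0 → ∑ t ∈ fibre f s, G (s, t) = q.eval s := by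
  obtain ⟨C, hC, M, hM⟩ := hG
  have hDs : ∀ s, D.eval s ≠ 0 → ∀ᶠ s in 𝓝 s, D.eval s ≠ 0 := fun s hs =>
    D.continuous.continuousAt.eventually_ne hs
  obtain ⟨q, hq⟩ := exists_polynomial_of_growth_off_finite (B := {s | D.eval s = 0})
    (h := fun s => ∑ t ∈ fibre f s, G (s, t)) (C := f.natDegree * C) (M := M)
    (by
      refine (D.roots.toFinset.finite_toSet).subset fun s hs => ?_
      simpa [hD] using hs)
    (fun s hs => by
      obtain ⟨g, hg, hloc⟩ := exists_local_sections hf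
        ((hDs s hs).mono fun s hs t ht => hDf s t hs ht)
      have : (fun s => ∑ t ∈ fibre f s, G (s, t)) =ᶠ[𝓝 s]
          fun s' => ∑ t ∈ fibre f s, G (s', g t s') := by
        filter_upwards [hloc] with s' h
        rw [h.2, Finset.sum_image h.1]
      refine DifferentiableAt.congr_of_eventuallyEq ?_ this
      exact DifferentiableAt.fun_sum fun t ht =>
        hd _ _ (hg t ht).2.self_of_nhds.1 ((hg t ht).2.mono fun s hs => hs.2))
    (by positivity)
    (fun s => by
      refine (norm_sum_le _ _).trans ?_
      refine (Finset.sum_le_card_nsmul _ _ (C * (1 + ‖s‖) ^ M) fun t ht =>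
        hM (s, t) ((mem_fibre hf).1 ht)).trans ?_
      rw [nsmul_eq_mul, mul_assoc]
      gcongr
      exact card_fibre_le hf s)
  exact ⟨q, fun s hs => hq s hs⟩

/-- `F` has derivative `a + b g'` along every holomorphic graph `t = g(s)` in the zero set of `f`. -/
def HasGraphDeriv (f : ℂ[X][X]) (F : ℂ × ℂ → ℂ) (a b : ℂ[X][X]) : Prop :=
  ∀ (g : ℂ → ℂ) (s g' : ℂ), HasDerivAt g g' s → (∀ᶠ s in 𝓝 s, f.evalEval s (g s) = 0) →
    HasDerivAt (fun s => F (s, g s)) (a.evalEval s (g s) + b.evalEval s (g s) * g') s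

theorem continuous_evalEval (f : ℂ[X][X]) : Continuous fun p : ℂ × ℂ => f.evalEval p.1 p.2 :=
  (contDiff_evalEval f).continuous

theorem isCompact_bizeros_inter (hf : f.Monic) (R : ℝ) :
    IsCompact (bizeros f ∩ {p | ‖p.1‖ ≤ R}) := by
  obtain ⟨C, hC, M, hM⟩ := polyGrowth_snd hf
  refine Metric.isCompact_of_isClosed_isBounded ?_ ?_
  · exact (isClosed_eq (continuous_evalEval f) continuous_const).inter
      (isClosed_le continuous_fst.norm continuous_const)
  · refine (Metric.isBounded_closedBall (x := (0 : ℂ × ℂ))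
      (r := max R (C * (1 + R) ^ M))).subset fun p hp => ?_
    rw [mem_closedBall_zero_iff, Prod.norm_def]
    have h2 : ‖p.1‖ ≤ R := hp.2
    refine max_le_max h2 ((hM p hp.1).trans ?_)
    gcongr

theorem exists_pos_le_norm_eval {D : ℂ[X]} (hD : D ≠ 0) :
    ∃ R : ℝ, ∃ c > 0, 0 ≤ R ∧ ∀ s : ℂ, R ≤ ‖s‖ → c ≤ ‖D.eval s‖ := by
  rcases lt_or_ge 0 D.degree with h | h
  · have ht := D.tendsto_norm_atTop h (tendsto_norm_cocompact_atTop (E := ℂ))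
    have := ht.eventually_ge_atTop 1
    rw [← cobounded_eq_cocompact, ← comap_norm_atTop, eventually_comap] at this
    obtain ⟨R, hR⟩ := eventually_atTop.1 this
    exact ⟨max R 0, 1, one_pos, le_max_right _ _,
      fun s hs => hR ‖s‖ ((le_max_left _ _).trans hs) s rfl⟩
  · rw [eq_C_of_degree_le_zero h] at hD ⊢
    refine ⟨0, ‖D.coeff 0‖, norm_pos_iff.2 fun h => hD (by rw [h, C_0]), le_rfl, fun s _ => ?_⟩
    rw [eval_C]

/-- A function with polynomial derivatives along graphs has polynomial growth. -/
theorem HasGraphDeriv.polyGrowth (hf : f.Monic) {A B : ℂ[X][X]} {D : ℂ[X]} (hD : D ≠ 0)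
    (hAB : A * f + B * derivative f = C D) {F : ℂ × ℂ → ℂ} (hc : ContinuousOn F (bizeros f))
    {a b : ℂ[X][X]} (hF : HasGraphDeriv f F a b) : PolyGrowth (bizeros f) F := by
  classical
  obtain ⟨R, c, hc0, hR0, hR⟩ := exists_pos_le_norm_eval hD
  obtain ⟨P, hP⟩ := exists_hasFDerivAt_evalEval f
  have hid : ∀ p ∈ bizeros f, B.evalEval p.1 p.2 * (derivative f).evalEval p.1 p.2 =
      D.eval p.1 := fun p hp => by
    have hp' : f.evalEval p.1 p.2 = 0 := hp
    have := congrArg (evalEval p.1 p.2) hAB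
    rwa [evalEval_add, evalEval_mul, evalEval_mul, hp', mul_zero, zero_add, evalEval_C] at this
  have hDf : ∀ s t, D.eval s ≠ 0 → f.evalEval s t = 0 → (derivative f).evalEval s t ≠ 0 :=
    fun s t hs ht h0 => hs (by rw [← hid (s, t) ht, h0, mul_zero])
  have hDne : ∀ s : ℂ, R ≤ ‖s‖ → D.eval s ≠ 0 := fun s hs h0 => by
    have := hR s hs
    rw [h0, norm_zero] at this
    linarith
  have hsnd := polyGrowth_snd hf
  -- Along a branch `g' = -∂_s f / ∂_t f`, and on the zero set `1 / ∂_t f = B / D` with `‖D‖ ≥ c`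
  -- outside radius `R`. So `K (1 + ‖s‖) ^ L` bounds the derivative of `F` along every branch there.
  obtain ⟨K, hK, L, hKL⟩ := (hsnd.evalEval_of_snd a).norm.add
    (((hsnd.evalEval_of_snd b).mul ((hsnd.evalEval_of_snd P).mul
      (hsnd.evalEval_of_snd B))).mul (PolyGrowth.const (c⁻¹ : ℂ))).norm
  have hderiv : ∀ (g : ℂ → ℂ) (s : ℂ), R ≤ ‖s‖ → DifferentiableAt ℂ g s →
      (∀ᶠ s in 𝓝 s, f.evalEval s (g s) = 0) → ∃ F', HasDerivAt (fun s => F (s, g s)) F' s ∧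
        ‖F'‖ ≤ K * (1 + ‖s‖) ^ L := by
    intro g s hs hg hg0
    have hz : (s, g s) ∈ bizeros f := hg0.self_of_nhds
    refine ⟨_, hF g s _ hg.hasDerivAt hg0, ?_⟩
    have h1 : HasDerivAt (fun s => f.evalEval s (g s))
        (P.evalEval s (g s) + (derivative f).evalEval s (g s) * deriv g s) s := by
      have := (hP (s, g s)).comp_hasDerivAt s ((hasDerivAt_id s).prodMk hg.hasDerivAt)
      refine (this.congr_deriv ?_ :)
      simp
    have h2 : P.evalEval s (g s) + (derivative f).evalEval s (g s) * deriv g s = 0 := by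
      have h3 : HasDerivAt (fun s => f.evalEval s (g s)) 0 s :=
        (hasDerivAt_const s (0 : ℂ)).congr_of_eventuallyEq hg0
      exact h1.unique h3
    have h4 : D.eval s * deriv g s = -(P.evalEval s (g s) * B.evalEval s (g s)) := by
      have := hid _ hz
      simp only at this
      rw [← this]
      linear_combination (B.evalEval s (g s)) * h2
    have h5 : c * ‖deriv g s‖ ≤ ‖P.evalEval s (g s)‖ * ‖B.evalEval s (g s)‖ := by
      rw [← norm_mul, ← norm_neg (P.evalEval s (g s) * B.evalEval s (g s)), ← h4, norm_mul]
      exact mul_le_mul_of_nonneg_right (hR s hs) (norm_nonneg _)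
    have h6 : ‖deriv g s‖ ≤ ‖P.evalEval s (g s)‖ * ‖B.evalEval s (g s)‖ * c⁻¹ := by
      rw [← div_eq_mul_inv, le_div_iff₀ hc0, mul_comm]
      exact h5
    have h7 := hKL _ hz
    beta_reduce at h7
    rw [← Complex.ofReal_add, Complex.norm_real, Real.norm_of_nonneg (by positivity)] at h7
    simp only [norm_mul, norm_inv, Complex.norm_real, Real.norm_of_nonneg hc0.le] at h7
    refine (norm_add_le _ _).trans (le_trans ?_ h7)
    rw [norm_mul]
    refine add_le_add_right ?_ _
    rw [mul_assoc]
    exact mul_le_mul_of_nonneg_left h6 (norm_nonneg _)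
  obtain ⟨M₀, hM₀⟩ := (isCompact_bizeros_inter hf R).exists_bound_of_continuousOn
    (hc.mono inter_subset_left)
  have hM₀' : ∀ s t, f.evalEval s t = 0 → ‖s‖ ≤ R → ‖F (s, t)‖ ≤ max M₀ 0 :=
    fun s t h h' => (hM₀ (s, t) ⟨h, h'⟩).trans (le_max_left _ _)
  obtain ⟨d, hd⟩ : ∃ d : ℝ, d = (f.natDegree : ℝ) := ⟨_, rfl⟩
  have hd0 : 0 ≤ d := hd ▸ Nat.cast_nonneg _
  -- The constant term dominates the fibre sum at radius `R`. The power is chosen so that its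
  -- derivative dominates the sum over the fibre of the derivative bounds.
  set Bd : ℝ → ℝ := fun r => d * max M₀ 0 + d * K * (1 + r) ^ (L + 1) with hBd
  have hBd' : ∀ r, HasDerivAt Bd (d * K * ((L + 1) * (1 + r) ^ L)) r := fun r => by
    have := ((((hasDerivAt_id r).const_add 1).pow (L + 1)).const_mul (d * K)).const_add
      (d * max M₀ 0)
    refine (this.congr_deriv ?_ :)
    simp
  -- The sum over the whole fibre is followed along a ray, so no single branch has to be continued
  -- globally. Norms need not be differentiable at zeros of `F`, hence the comparison by right
  -- slopes.
  have key : ∀ ζ : ℂ, ‖ζ‖ = 1 → ∀ r, R ≤ r → ∑ t ∈ fibre f (r * ζ), ‖F (r * ζ, t)‖ ≤ Bd r := by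
    intro ζ hζ r hr
    have hnorm : ∀ x : ℝ, R ≤ x → ‖(x * ζ : ℂ)‖ = x := fun x hx => by
      rw [norm_mul, hζ, mul_one, Complex.norm_real, Real.norm_of_nonneg (hR0.trans hx)]
    have hcont : ∀ x : ℝ, ContinuousAt (fun x : ℝ => (x * ζ : ℂ)) x := fun x => by fun_prop
    have hline : ∀ x : ℝ, HasDerivAt (fun x : ℝ => (x * ζ : ℂ)) ζ x := fun x => by
      simpa using (Complex.ofRealCLM.hasDerivAt (x := x)).mul_const ζ
    have hloc : ∀ x : ℝ, R ≤ x → ∃ g : ℂ → ℂ → ℂ, ∃ F' : ℂ → ℂ,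
        (∀ t ∈ fibre f (x * ζ), g t (x * ζ) = t ∧ ‖F' t‖ ≤ K * (1 + x) ^ L ∧
          HasDerivAt (fun y : ℝ => F (y * ζ, g t (y * ζ))) (F' t) x) ∧
        ∀ᶠ y : ℝ in 𝓝 x, ∑ t ∈ fibre f (y * ζ), ‖F (y * ζ, t)‖ =
          ∑ t ∈ fibre f (x * ζ), ‖F (y * ζ, g t (y * ζ))‖ := by
      intro x hx
      have hxR : R ≤ ‖(x * ζ : ℂ)‖ := by rw [hnorm x hx]; exact hx
      obtain ⟨g, hg, hl⟩ := exists_local_sections hf (s₀ := x * ζ)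
        ((D.continuous.continuousAt.eventually_ne (hDne _ hxR)).mono
          fun s hs t ht => hDf s t hs ht)
      have : ∀ t ∈ fibre f (x * ζ), ∃ F', ‖F'‖ ≤ K * (1 + x) ^ L ∧
          HasDerivAt (fun y : ℝ => F (y * ζ, g t (y * ζ))) F' x := fun t ht => by
        obtain ⟨F', h1, h2⟩ := hderiv (g t) _ hxR (hg t ht).2.self_of_nhds.1
          ((hg t ht).2.mono fun s hs => hs.2)
        rw [hnorm x hx] at h2
        exact ⟨F' * ζ, by rw [norm_mul, hζ, mul_one]; exact h2,
          HasDerivAt.comp (h₂ := fun s => F (s, g t s)) x h1 (hline x)⟩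
      choose! F' hF' using this
      refine ⟨g, F', fun t ht => ⟨(hg t ht).1, hF' t ht⟩, ?_⟩
      filter_upwards [(hcont x).eventually hl] with y hy
      rw [hy.2, Finset.sum_image hy.1]
    refine image_le_of_liminf_slope_right_le_deriv_boundary (a := R) (b := r)
      (f := fun x : ℝ => ∑ t ∈ fibre f (x * ζ), ‖F (x * ζ, t)‖) (B := Bd)
      (B' := fun r => d * K * ((L + 1) * (1 + r) ^ L))
      ?_ ?_ (fun x _ => (hBd' x).continuousAt.continuousWithinAt)
      (fun x _ => (hBd' x).hasDerivWithinAt) ?_ ⟨hr, le_rfl⟩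
    · intro x hx
      obtain ⟨g, F', h1, h2⟩ := hloc x hx.1
      refine ContinuousAt.continuousWithinAt (ContinuousAt.congr ?_ (EventuallyEq.symm h2))
      exact tendsto_finsetSum _ fun t ht => (h1 t ht).2.2.continuousAt.norm
    · have h1 : ∑ t ∈ fibre f (R * ζ), ‖F (R * ζ, t)‖ ≤ d * max M₀ 0 := by
        refine (Finset.sum_le_card_nsmul _ _ (max M₀ 0) fun t ht =>
          hM₀' _ _ ((mem_fibre hf).1 ht) (hnorm R le_rfl).le).trans ?_
        rw [nsmul_eq_mul]
        gcongr
        rw [hd]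
        exact_mod_cast card_fibre_le hf _
      have : 0 ≤ d * K * (1 + R) ^ (L + 1) := by positivity
      simp only [hBd]
      linarith
    · intro x hx q hq
      have hx0 : 0 ≤ x := hR0.trans hx.1
      obtain ⟨g, F', h1, h2⟩ := hloc x hx.1
      have hlim : Tendsto (fun y => ∑ t ∈ fibre f (x * ζ),
          ‖slope (fun y : ℝ => F (y * ζ, g t (y * ζ))) x y‖) (𝓝[>] x)
          (𝓝 (∑ t ∈ fibre f (x * ζ), ‖F' t‖)) :=
        tendsto_finsetSum _ fun t ht =>
          ((hasDerivAt_iff_tendsto_slope.1 (h1 t ht).2.2).mono_left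
            (nhdsWithin_mono _ fun y hy => ne_of_gt hy)).norm
      have hle : ∑ t ∈ fibre f (x * ζ), ‖F' t‖ < q := by
        refine lt_of_le_of_lt ?_ hq
        refine (Finset.sum_le_card_nsmul _ _ _ fun t ht => (h1 t ht).2.1).trans ?_
        rw [nsmul_eq_mul]
        have hcard : ((fibre f (x * ζ)).card : ℝ) ≤ d := by
          rw [hd]
          exact_mod_cast card_fibre_le hf _
        have hL : (1 : ℝ) ≤ L + 1 := by simp
        calc ((fibre f (x * ζ)).card : ℝ) * (K * (1 + x) ^ L) ≤ d * (K * (1 + x) ^ L) := by gcongr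
          _ = d * K * (1 * (1 + x) ^ L) := by ring
          _ ≤ _ := by gcongr
      refine Eventually.frequently ?_
      filter_upwards [hlim.eventually_lt_const hle, mem_nhdsWithin_of_mem_nhds h2,
        self_mem_nhdsWithin] with y hy hy2 hxy
      refine lt_of_le_of_lt ?_ hy
      have hxy' : 0 < y - x := sub_pos.2 hxy
      rw [slope_def_field, hy2, h2.self_of_nhds, ← Finset.sum_sub_distrib, Finset.sum_div]
      refine Finset.sum_le_sum fun t ht => ?_
      rw [slope_def_module, norm_smul, norm_inv, Real.norm_of_nonneg hxy'.le, div_eq_inv_mul]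
      exact mul_le_mul_of_nonneg_left (norm_sub_norm_le _ _) (inv_nonneg.2 hxy'.le)
  refine ⟨d * max M₀ 0 + max M₀ 0 + d * K, by positivity, L + 1, fun p hp => ?_⟩
  have h1 : (1 : ℝ) ≤ (1 + ‖p.1‖) ^ (L + 1) := one_le_pow₀ (by simp)
  rcases le_total ‖p.1‖ R with h | h
  · refine (hM₀' p.1 p.2 hp h).trans ?_
    have h2 : 0 ≤ d * max M₀ 0 := by positivity
    have h3 : 0 ≤ d * K := by positivity
    have h4 : 0 ≤ max M₀ 0 := le_max_right _ _
    nlinarith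
  · obtain ⟨ζ, hζ, hpζ⟩ : ∃ ζ : ℂ, ‖ζ‖ = 1 ∧ (‖p.1‖ : ℂ) * ζ = p.1 := by
      rcases eq_or_ne p.1 0 with h0 | h0
      · exact ⟨1, by simp, by simp [h0]⟩
      · have : (‖p.1‖ : ℂ) ≠ 0 := by exact_mod_cast norm_ne_zero_iff.2 h0
        refine ⟨p.1 / ‖p.1‖, ?_, by field_simp⟩
        rw [norm_div, Complex.norm_real, norm_norm, div_self (norm_ne_zero_iff.2 h0)]
    have h2 := key ζ hζ ‖p.1‖ h
    rw [hpζ] at h2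
    have h3 : ‖F (p.1, p.2)‖ ≤ ∑ t ∈ fibre f p.1, ‖F (p.1, t)‖ :=
      Finset.single_le_sum (f := fun t => ‖F (p.1, t)‖) (fun t _ => norm_nonneg _)
        ((mem_fibre hf).2 hp)
    refine (h3.trans h2).trans ?_
    have h4 : 0 ≤ d * max M₀ 0 := by positivity
    have h5 : 0 ≤ max M₀ 0 := le_max_right _ _
    simp only [hBd]
    nlinarith

/-- A monic polynomial that is small at `x` must have a root near `x`. This continuity of roots is
used to approximate points over zeros of the discriminant. -/
theorem pow_card_le_norm_prod {ε : ℝ} (hε : 0 ≤ ε) {x : ℂ} {m : Multiset ℂ}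
    (h : ∀ y ∈ m, ε ≤ ‖x - y‖) : ε ^ m.card ≤ ‖(m.map (x - ·)).prod‖ := by
  induction m using Multiset.induction_on with
  | empty => simp
  | cons a m ih =>
    rw [Multiset.card_cons, Multiset.map_cons, Multiset.prod_cons, norm_mul, pow_succ']
    exact mul_le_mul (h a (Multiset.mem_cons_self _ _))
      (ih fun y hy => h y (Multiset.mem_cons_of_mem hy)) (by positivity) (norm_nonneg _)

/-- Interpolation: a function which is holomorphic along graphs with polynomial derivative becomes
the restriction of a polynomial after multiplication by the derivative of `f`. -/
theorem HasGraphDeriv.exists_polynomial (hf : f.Monic) (hirr : Irreducible f)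
    {F : ℂ × ℂ → ℂ} (hc : ContinuousOn F (bizeros f))
    {a b : ℂ[X][X]} (hF : HasGraphDeriv f F a b) :
    ∃ P : ℂ[X][X], ∀ p ∈ bizeros f,
      P.evalEval p.1 p.2 = F p * (derivative f).evalEval p.1 p.2 := by
  obtain ⟨A, B, D, hD, hAB⟩ := exists_discriminant hf hirr
  have hDf : ∀ s t, D.eval s ≠ 0 → f.evalEval s t = 0 → (derivative f).evalEval s t ≠ 0 := by
    intro s t hs ht h0
    have := congrArg (evalEval s t) hAB
    rw [evalEval_add, evalEval_mul, evalEval_mul, ht, h0, mul_zero, mul_zero, zero_add,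
      evalEval_C] at this
    exact hs this.symm
  have hgrow := hF.polyGrowth hf hD hAB hc
  have htr : ∀ k : ℕ, ∃ q : ℂ[X], ∀ s, D.eval s ≠ 0 →
      ∑ t ∈ fibre f s, F (s, t) * t ^ k = q.eval s := fun k =>
    exists_polynomial_eq_trace (G := fun p => F p * p.2 ^ k) hf hD hDf
      (hgrow.mul ((polyGrowth_snd hf).pow k))
      fun g s hg hz => (hF g s _ hg.hasDerivAt hz).differentiableAt.mul (hg.pow k)
  choose q hq using htr
  -- Expansion of the Lagrange sum of `F(s, y) (f(s, T) - f(s, y)) / (T - y)` over `y` in the fibre;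
  -- its coefficients involve only the traces `q k`.
  set P : ℂ[X][X] := ∑ m ∈ Finset.range (f.natDegree + 1), ∑ i ∈ Finset.range m,
    C (f.coeff m * q (m - 1 - i)) * X ^ i with hP
  have hgood : ∀ p ∈ bizeros f, D.eval p.1 ≠ 0 →
      P.evalEval p.1 p.2 = F p * (derivative f).evalEval p.1 p.2 := by
    rintro ⟨s, t⟩ hp hs
    have hp' : f.evalEval s t = 0 := hp
    have hfe : ∀ y, f.evalEval s y =
        ∑ m ∈ Finset.range (f.natDegree + 1), (f.coeff m).eval s * y ^ m := fun y => by
      conv_lhs => rw [f.as_sum_range_C_mul_X_pow]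
      simp only [evalEval_finsetSum, evalEval_mul, evalEval_pow, evalEval_X, evalEval_C]
    have hfd : (derivative f).evalEval s t =
        ∑ m ∈ Finset.range (f.natDegree + 1), (f.coeff m).eval s * (m * t ^ (m - 1)) := by
      conv_lhs => rw [f.as_sum_range_C_mul_X_pow]
      simp only [derivative_sum, derivative_C_mul_X_pow, evalEval_finsetSum, evalEval_mul,
        evalEval_pow, evalEval_X, evalEval_C, eval_mul, eval_natCast, mul_assoc]
    have hexp : P.evalEval s t = ∑ y ∈ fibre f s, F (s, y) *
        ∑ m ∈ Finset.range (f.natDegree + 1), (f.coeff m).eval s *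
          ∑ i ∈ Finset.range m, t ^ i * y ^ (m - 1 - i) := by
      simp only [hP, evalEval_finsetSum, evalEval_mul, evalEval_pow, evalEval_X, evalEval_C,
        eval_mul, ← hq _ s hs]
      simp only [Finset.mul_sum, Finset.sum_mul]
      rw [Finset.sum_comm (s := fibre f s)]
      refine Finset.sum_congr rfl fun m _ => ?_
      rw [Finset.sum_comm (s := fibre f s)]
      exact Finset.sum_congr rfl fun i _ => Finset.sum_congr rfl fun y _ => by ring
    -- At a root `T = t` the quotient vanishes for every other root `y`, and for `y = t` it equals
    -- `∂_t f`.
    rw [hexp, Finset.sum_eq_single t]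
    · rw [hfd]
      congr 1
      refine Finset.sum_congr rfl fun m _ => ?_
      rw [geom_sum₂_self]
    · intro y hy hyt
      have h1 : (∑ m ∈ Finset.range (f.natDegree + 1), (f.coeff m).eval s *
          ∑ i ∈ Finset.range m, t ^ i * y ^ (m - 1 - i)) * (t - y) = 0 := by
        rw [Finset.sum_mul]
        have h2 : ∀ m, (f.coeff m).eval s * (∑ i ∈ Finset.range m, t ^ i * y ^ (m - 1 - i)) *
            (t - y) = (f.coeff m).eval s * t ^ m - (f.coeff m).eval s * y ^ m := fun m => by
          rw [mul_assoc, geom_sum₂_mul, mul_sub]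
        rw [Finset.sum_congr rfl fun m _ => h2 m, Finset.sum_sub_distrib, ← hfe, ← hfe, hp',
          (mem_fibre hf).1 hy, sub_zero]
      rw [(mul_eq_zero.1 h1).resolve_right (sub_ne_zero.2 hyt.symm), mul_zero]
    · intro h
      exact absurd ((mem_fibre hf).2 hp') h
  refine ⟨P, fun p hp => ?_⟩
  set Z' : Set (ℂ × ℂ) := {p | p ∈ bizeros f ∧ D.eval p.1 ≠ 0} with hZ'
  -- Points with nonzero discriminant are dense in the zero set, so the identity extends by
  -- continuity.
  have hcl : p ∈ closure Z' := by
    rw [Metric.mem_closure_iff]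
    intro ε hε
    have hpf : f.evalEval p.1 p.2 = 0 := hp
    have h1 : ∀ᶠ s in 𝓝[≠] p.1, ‖f.evalEval s p.2‖ < ε ^ f.natDegree := by
      have : Continuous fun s : ℂ => ‖f.evalEval s p.2‖ :=
        ((continuous_evalEval f).comp (Continuous.prodMk_left p.2)).norm
      refine (this.continuousAt.eventually_lt continuousAt_const ?_).filter_mono nhdsWithin_le_nhds
      rw [hpf, norm_zero]
      positivity
    have h2 : ∀ᶠ s in 𝓝[≠] p.1, D.eval s ≠ 0 := by
      have hfin : ({s | D.eval s = 0} \ {p.1}).Finite :=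
        (D.roots.toFinset.finite_toSet.subset fun s hs => by simpa [hD] using hs).subset sdiff_subset
      filter_upwards [mem_nhdsWithin_of_mem_nhds
        (hfin.isClosed.isOpen_compl.mem_nhds (x := p.1) (by simp)), self_mem_nhdsWithin] with s hs h0 h
      exact hs ⟨h, h0⟩
    have h3 : ∀ᶠ s in 𝓝[≠] p.1, dist p.1 s < ε := by
      refine Eventually.filter_mono nhdsWithin_le_nhds ?_
      filter_upwards [ball_mem_nhds p.1 hε] with s hs
      rw [dist_comm]; exact hs
    obtain ⟨s, hs1, hs2, hs3⟩ := (h1.and (h2.and h3)).exists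
    have h4 : ∃ y, f.evalEval s y = 0 ∧ dist p.2 y < ε := by
      by_contra! hcon
      refine absurd hs1 (not_lt.2 ?_)
      have hsp := IsAlgClosed.splits (f.map (evalRingHom s))
      rw [← map_evalRingHom_eval, hsp.eval_eq_prod_roots_of_monic (hf.map _),
        ← hf.natDegree_map (evalRingHom s), hsp.natDegree_eq_card_roots]
      refine pow_card_le_norm_prod hε.le fun y hy => ?_
      rw [← dist_eq_norm]
      exact hcon y ((mem_fibre hf).1 (Multiset.mem_toFinset.2 hy))
    obtain ⟨y, hy, hyd⟩ := h4
    exact ⟨(s, y), ⟨hy, hs2⟩, by rw [Prod.dist_eq]; exact max_lt hs3 hyd⟩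
  have hcont : ContinuousOn (fun p => P.evalEval p.1 p.2 -
      F p * (derivative f).evalEval p.1 p.2) (bizeros f) :=
    (continuous_evalEval P).continuousOn.sub (hc.mul (continuous_evalEval _).continuousOn)
  have hmem := ((hcont p hp).mono fun q hq => hq.1).mem_closure_image (s := Z') hcl
  have himg : (fun p : ℂ × ℂ => P.evalEval p.1 p.2 -
      F p * (derivative f).evalEval p.1 p.2) '' Z' ⊆ {0} := by
    rintro _ ⟨q, hq, rfl⟩
    exact sub_eq_zero.2 (hgood q hq.1 hq.2)
  have := closure_mono himg hmem
  rw [closure_singleton] at this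
  exact sub_eq_zero.1 this

end Traces

end

end ChenPlane

namespace ChenPlane

noncomputable section

/-! ### Algebra of the equation of the curve -/

section Equation

open MvPolynomial

/-- The substitution `X_i ↦ X_i T`, whose coefficients are the homogeneous components. -/
def grade : Poly2 →ₐ[ℂ] Polynomial Poly2 := aeval fun i => Polynomial.C (X i) * Polynomial.X

theorem coeff_grade (q : Poly2) (j : ℕ) : (grade q).coeff j = homogeneousComponent j q := by
  induction q using MvPolynomial.induction_on' with
  | monomial d c =>
    have h : grade (MvPolynomial.monomial d c) =
        Polynomial.C (MvPolynomial.monomial d c) * Polynomial.X ^ d.degree := by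
      rw [grade, aeval_monomial, Finsupp.prod_fintype _ _ (by simp), Finsupp.degree_eq_sum,
        MvPolynomial.monomial_eq, Finsupp.prod_fintype _ _ (by simp)]
      simp only [Fin.prod_univ_two, Fin.sum_univ_two, mul_pow, pow_add, map_mul, map_pow,
        MvPolynomial.algebraMap_eq, Polynomial.algebraMap_apply]
      ring
    rw [h, Polynomial.coeff_C_mul, Polynomial.coeff_X_pow,
      homogeneousComponent_of_mem (isHomogeneous_monomial c rfl)]
    simp
  | add p q hp hq => rw [map_add, Polynomial.coeff_add, hp, hq, map_add]

theorem eq_zero_of_homogeneousComponent {q : Poly2} (h : ∀ j, homogeneousComponent j q = 0) :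
    q = 0 := by
  rw [← sum_homogeneousComponent q]
  exact Finset.sum_eq_zero fun j _ => h j

theorem homogeneousComponent_mul_top {u A : Poly2} {i a : ℕ}
    (hu : ∀ j, i < j → homogeneousComponent j u = 0)
    (hA : ∀ j, a < j → homogeneousComponent j A = 0) :
    homogeneousComponent (i + a) (u * A) = homogeneousComponent i u * homogeneousComponent a A := by
  rw [← coeff_grade, map_mul, Polynomial.coeff_mul_add_eq_of_natDegree_le, coeff_grade, coeff_grade]
  · exact Polynomial.natDegree_le_iff_coeff_eq_zero.2 fun j hj => by rw [coeff_grade, hu j hj]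
  · exact Polynomial.natDegree_le_iff_coeff_eq_zero.2 fun j hj => by rw [coeff_grade, hA j hj]

theorem homogeneousComponent_hom_mul {w B : Poly2} {e : ℕ} (hw : w.IsHomogeneous e) (j : ℕ) :
    homogeneousComponent j (w * B) = if e ≤ j then w * homogeneousComponent (j - e) B else 0 := by
  have h : grade w = Polynomial.C w * Polynomial.X ^ e := by
    ext1 j
    rw [coeff_grade, homogeneousComponent_of_mem hw, Polynomial.coeff_C_mul, Polynomial.coeff_X_pow]
    simp
  rw [← coeff_grade, map_mul, h, mul_right_comm, Polynomial.coeff_mul_X_pow', Polynomial.coeff_C_mul,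
    coeff_grade]

/-- Two non-constant polynomials without common zeros at infinity have a common zero. -/
theorem false_of_combination {A B : Poly2} {a b : ℕ} (ha : 0 < a) (hb : 0 < b)
    (hA : ∀ j, a < j → homogeneousComponent j A = 0)
    (hB : ∀ j, b < j → homogeneousComponent j B = 0) (hB0 : homogeneousComponent b B ≠ 0)
    (hrel : IsRelPrime (homogeneousComponent a A) (homogeneousComponent b B))
    (hAu : ¬ IsUnit A) (hBu : ¬ IsUnit B) (m : ℕ) : ∀ u v : Poly2,
    (∀ j, m < j + a → homogeneousComponent j u = 0) →
    (∀ j, m < j + b → homogeneousComponent j v = 0) → u * A + v * B ≠ 1 := by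
  -- Here `m` bounds both `deg u + a` and `deg v + b`; the descent lowers it until one factor would
  -- have to be a unit.
  induction m with
  | zero =>
    intro u v hu hv h
    rw [eq_zero_of_homogeneousComponent fun j => hu j (by omega),
      eq_zero_of_homogeneousComponent fun j => hv j (by omega)] at h
    simp at h
  | succ k ih =>
    intro u v hu hv h
    rcases lt_or_ge (k + 1) a with hka | hka
    · rw [eq_zero_of_homogeneousComponent fun j => hu j (by omega), zero_mul, zero_add] at h
      exact hBu (IsUnit.of_mul_eq_one_right _ h)
    rcases lt_or_ge (k + 1) b with hkb | hkb
    · rw [eq_zero_of_homogeneousComponent fun j => hv j (by omega), zero_mul, add_zero] at h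
      exact hAu (IsUnit.of_mul_eq_one_right _ h)
    obtain ⟨i, hi⟩ := Nat.exists_eq_add_of_le' hka
    obtain ⟨l, hl⟩ := Nat.exists_eq_add_of_le' hkb
    have htop : homogeneousComponent i u * homogeneousComponent a A +
        homogeneousComponent l v * homogeneousComponent b B = 0 := by
      rw [← homogeneousComponent_mul_top (fun j hj => hu j (by omega)) hA,
        ← homogeneousComponent_mul_top (fun j hj => hv j (by omega)) hB, ← hi, ← hl, ← map_add, h]
      exact homogeneousComponent_eq_zero _ _ (by simp)
    -- Positive-degree terms of `u * A + v * B` cancel, and the top forms of `A` and `B` are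
    -- coprime, so the leading form of `u` is a multiple of that of `B`.
    obtain ⟨w₀, hw₀⟩ : homogeneousComponent b B ∣ homogeneousComponent i u := by
      refine hrel.symm.dvd_of_dvd_mul_right ⟨-homogeneousComponent l v, ?_⟩
      linear_combination htop
    obtain ⟨w, hw, hwu, hwe⟩ : ∃ w : Poly2, homogeneousComponent i u =
        w * homogeneousComponent b B ∧ w.IsHomogeneous (i - b) ∧ (i < b → w = 0) := by
      have h1 : homogeneousComponent i (homogeneousComponent b B * w₀) =
          homogeneousComponent b B * w₀ := by
        rw [← hw₀]
        exact homogeneousComponent_eq_self (homogeneousComponent_isHomogeneous _ _)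
      rw [homogeneousComponent_hom_mul (homogeneousComponent_isHomogeneous _ _)] at h1
      split_ifs at h1 with hbi
      · exact ⟨homogeneousComponent (i - b) w₀, by rw [hw₀, ← h1, mul_comm],
          homogeneousComponent_isHomogeneous _ _, fun h => absurd hbi (by omega)⟩
      · exact ⟨0, by rw [hw₀, ← h1, zero_mul], isHomogeneous_zero _ _ _, fun _ => rfl⟩
    have hv2 : homogeneousComponent l v = -(w * homogeneousComponent a A) := by
      refine mul_right_cancel₀ hB0 ?_
      rw [hw] at htop
      linear_combination htop
    -- This syzygy shift keeps the combination equal to `1` and removes both leading forms.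
    refine ih (u - w * B) (v + w * A) (fun j hj => ?_) (fun j hj => ?_) (by linear_combination h)
    · rw [map_sub]
      rcases lt_or_ge i b with hib | hib
      · rw [hwe hib, zero_mul] at hw ⊢
        rw [map_zero, sub_zero]
        rcases eq_or_ne j i with rfl | hji
        · exact hw
        · exact hu j (by omega)
      · rw [homogeneousComponent_hom_mul hwu, if_pos (by omega)]
        rcases eq_or_ne j i with rfl | hji
        · rw [hw, Nat.sub_sub_self hib, sub_self]
        · rw [hu j (by omega), hB _ (by omega), mul_zero, sub_zero]
    · rw [map_add]
      rcases lt_or_ge i b with hib | hib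
      · rw [hwe hib, zero_mul, neg_zero] at hv2
        rw [hwe hib, zero_mul, map_zero, add_zero]
        rcases eq_or_ne j l with rfl | hji
        · exact hv2
        · exact hv j (by omega)
      · rw [homogeneousComponent_hom_mul hwu, if_pos (by omega)]
        rcases eq_or_ne j l with rfl | hji
        · rw [hv2, show j - (i - b) = a by omega, neg_add_cancel]
        · rw [hv j (by omega), hA _ (by omega), mul_zero, add_zero]

/-! ### Consequences of the Nullstellensatz -/

theorem ideal_eq_top {J : Ideal Poly2} (h : ∀ p, ∃ q ∈ J, eval p q ≠ 0) : J = ⊤ := by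
  rw [← Ideal.radical_eq_top, ← vanishingIdeal_zeroLocus_eq_radical (K := ℂ)]
  have : zeroLocus ℂ J = ∅ := by
    refine Set.eq_empty_of_forall_notMem fun p hp => ?_
    obtain ⟨q, hq, hpq⟩ := h p
    exact hpq (by simpa using mem_zeroLocus_iff.1 hp q hq)
  rw [this, vanishingIdeal_empty]

theorem dvd_of_vanish {H q : Poly2} (hH : Prime H) (h : ∀ p ∈ zeros H, eval p q = 0) : H ∣ q := by
  have := (Ideal.span_singleton_prime hH.ne_zero).2 hH
  rw [← Ideal.mem_span_singleton, ← IsPrime.vanishingIdeal_zeroLocus (K := ℂ) (Ideal.span {H})]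
  intro p hp
  simp only [zeroLocus_span, Set.mem_singleton_iff, forall_eq] at hp
  simpa using h p (by simpa [zeros] using hp)

/-- For `H = AB`, a common zero of `A` and `B` would be a singular point of the curve, so `u A + v B
= 1` for some `u`, `v`. Square-freeness makes the top forms coprime, and `false_of_combination`
excludes such a relation for nonunits. -/
theorem irreducible_of_smooth {n : ℕ} {H : Poly2} (hdeg : H.totalDegree = n + 1)
    (hinf : Squarefree (homogeneousComponent (n + 1) H)) (hs : IsSmoothCurve H) :
    Irreducible H := by
  have hH0 : H ≠ 0 := by rintro rfl; simp at hdeg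
  have hunit : ∀ q : Poly2, q ≠ 0 → ¬ IsUnit q → 0 < q.totalDegree := by
    intro q hq0 hq
    by_contra! h
    rw [Nat.le_zero, totalDegree_eq_zero_iff_eq_C] at h
    rw [h] at hq hq0
    exact hq ((IsUnit.mk0 _ fun h0 => hq0 (by rw [h0, map_zero])).map C)
  refine ⟨fun hu => ?_, fun A B hAB => ?_⟩
  · obtain ⟨K, hK⟩ := hu.exists_right_inv
    have hK0 : K ≠ 0 := by rintro rfl; simp at hK
    have := totalDegree_mul_of_isDomain hH0 hK0
    rw [hK, totalDegree_one] at this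
    omega
  · by_contra! hcon
    obtain ⟨hAu, hBu⟩ := hcon
    have hA0 : A ≠ 0 := by rintro rfl; simp [hH0] at hAB
    have hB0 : B ≠ 0 := by rintro rfl; simp [hH0] at hAB
    have hd := totalDegree_mul_of_isDomain hA0 hB0
    rw [← hAB, hdeg] at hd
    have hA : ∀ j, A.totalDegree < j → homogeneousComponent j A = 0 := fun j hj =>
      homogeneousComponent_eq_zero _ _ hj
    have hB : ∀ j, B.totalDegree < j → homogeneousComponent j B = 0 := fun j hj =>
      homogeneousComponent_eq_zero _ _ hj
    rw [hd, hAB, homogeneousComponent_mul_top hA hB] at hinf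
    have hne : homogeneousComponent A.totalDegree A * homogeneousComponent B.totalDegree B ≠ 0 :=
      hinf.ne_zero
    have htop : Ideal.span {A, B} = ⊤ := by
      refine ideal_eq_top fun p => ?_
      by_contra! hcon
      have h1 := hcon A (Ideal.subset_span (by simp))
      have h2 := hcon B (Ideal.subset_span (by simp))
      obtain ⟨i, hi⟩ := hs p (by rw [hAB, map_mul, h1, zero_mul])
      exact hi (by simp [hAB, Derivation.leibniz, h1, h2])
    obtain ⟨u, v, huv⟩ := Ideal.mem_span_pair.1 (htop ▸ Submodule.mem_top : (1 : Poly2) ∈ _)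
    exact false_of_combination (hunit A hA0 hAu) (hunit B hB0 hBu) hA hB (right_ne_zero_of_mul hne)
      (squarefree_mul_iff.1 hinf).1 hAu hBu
      (u.totalDegree + A.totalDegree + v.totalDegree + B.totalDegree) u v
      (fun j hj => homogeneousComponent_eq_zero _ _ (by omega))
      (fun j hj => homogeneousComponent_eq_zero _ _ (by omega)) huv

/-- On a smooth curve `1` is a combination of the equation and its partial derivatives. -/
theorem exists_jacobian_combination {H : Poly2} (hs : IsSmoothCurve H) :
    ∃ α β γ : Poly2, α * H + β * pderiv 0 H + γ * pderiv 1 H = 1 := by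
  have htop : Ideal.span {H, pderiv 0 H, pderiv 1 H} = ⊤ := by
    refine ideal_eq_top fun p => ?_
    by_cases hp : eval p H = 0
    · obtain ⟨i, hi⟩ := hs p hp
      refine ⟨_, Ideal.subset_span ?_, hi⟩
      fin_cases i <;> simp
    · exact ⟨H, Ideal.subset_span (by simp), hp⟩
  have h1 : (1 : Poly2) ∈ Ideal.span {H, pderiv 0 H, pderiv 1 H} := htop ▸ Submodule.mem_top
  obtain ⟨α, z, hz, h⟩ := Ideal.mem_span_insert.1 h1
  obtain ⟨β, γ, rfl⟩ := Ideal.mem_span_pair.1 hz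
  exact ⟨α, β, γ, by rw [h]; ring⟩

end Equation

end

end ChenPlane

namespace ChenPlane

noncomputable section

/-! ### Functions with polynomial differential on the curve are polynomial -/

section Potentials

open Set Filter Topology Polynomial

/-- On the curve, `dF` is the restriction of `θ`. -/
def HasDifferential (H : Poly2) (θ : OneForm) (F : (Fin 2 → ℂ) → ℂ) : Prop :=
  ∀ p ∈ zeros H, HasFDerivWithinAt F (formCLM θ p) (zeros H) p

/-- The linear substitution `X_i ↦ v_i s + w_i t`. -/
def toBi (v w : Fin 2 → ℂ) : Poly2 →ₐ[ℂ] ℂ[X][X] :=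
  MvPolynomial.aeval fun i => C (C (v i) * X) + C (C (w i)) * X

theorem evalEval_toBi (v w : Fin 2 → ℂ) (q : Poly2) (s t : ℂ) :
    (toBi v w q).evalEval s t = MvPolynomial.eval (s • v + t • w) q := by
  induction q using MvPolynomial.induction_on with
  | C a =>
    rw [toBi, MvPolynomial.aeval_C, MvPolynomial.eval_C]
    exact evalEval_CC s t a
  | add p q hp hq => rw [map_add, map_add, evalEval_add, hp, hq]
  | mul_X p i hp =>
    rw [map_mul, map_mul, evalEval_mul, hp, toBi, MvPolynomial.aeval_X, MvPolynomial.eval_X,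
      evalEval_add, evalEval_mul, evalEval_C, evalEval_C, evalEval_X]
    simp only [eval_mul, eval_C, eval_X, Pi.add_apply, Pi.smul_apply, smul_eq_mul]
    ring

/-- The coefficient of `t ^ m` does not involve `s`: it is the degree-`m` form at `w`. A direction
`w` off the zeros of the top form thus makes the equation monic in `t` up to a constant. -/
theorem coeff_toBi {q : Poly2} {m : ℕ} (hq : q.totalDegree ≤ m) (v w : Fin 2 → ℂ) :
    (toBi v w q).natDegree ≤ m ∧
      (toBi v w q).coeff m = C (MvPolynomial.eval w (MvPolynomial.homogeneousComponent m q)) := by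
  classical
  set l : Fin 2 → ℂ[X][X] := fun i => C (C (v i) * X) + C (C (w i)) * X with hl
  have hl1 : ∀ i, (l i).natDegree ≤ 1 := fun i => by
    simp only [hl]; compute_degree
  have hl2 : ∀ i, (l i).coeff 1 = C (w i) := fun i => by
    simp [hl, coeff_C]
  have hmon : ∀ (d : Fin 2 →₀ ℕ) (c : ℂ),
      (toBi v w (MvPolynomial.monomial d c)).natDegree ≤ d 0 + d 1 ∧
      (toBi v w (MvPolynomial.monomial d c)).coeff (d 0 + d 1) =
        C (MvPolynomial.eval w (MvPolynomial.monomial d c)) := fun d c => by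
    have he : toBi v w (MvPolynomial.monomial d c) = C (C c) * (l 0 ^ d 0 * l 1 ^ d 1) := by
      rw [toBi, MvPolynomial.aeval_monomial, Finsupp.prod_fintype _ _ (by simp),
        Fin.prod_univ_two]
      rfl
    have hn : ∀ i, (l i ^ d i).natDegree ≤ d i := fun i => by
      simpa using natDegree_pow_le_of_le (d i) (hl1 i)
    have hc : ∀ i, (l i ^ d i).coeff (d i) = C (w i) ^ d i := fun i => by
      have := coeff_pow_of_natDegree_le (m := d i) (hl1 i)
      rwa [mul_one, hl2] at this
    rw [he]
    refine ⟨(natDegree_C_mul_le _ _).trans (natDegree_mul_le_of_le (hn 0) (hn 1)), ?_⟩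
    rw [coeff_C_mul, coeff_mul_add_eq_of_natDegree_le (hn 0) (hn 1), hc, hc,
      MvPolynomial.eval_monomial, Finsupp.prod_fintype _ _ (by simp), Fin.prod_univ_two]
    simp
  have hsum : toBi v w q = ∑ d ∈ q.support, toBi v w (MvPolynomial.monomial d (q.coeff d)) := by
    conv_lhs => rw [q.as_sum, map_sum]
  have hdeg : ∀ d ∈ q.support, d 0 + d 1 ≤ m := fun d hd => by
    have := (MvPolynomial.le_totalDegree hd).trans hq
    rwa [Finsupp.sum_fintype _ _ (by simp), Fin.sum_univ_two] at this
  rw [hsum]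
  refine ⟨natDegree_sum_le_of_forall_le _ _ fun d hd => (hmon d _).1.trans (hdeg d hd), ?_⟩
  rw [finsetSum_coeff, MvPolynomial.homogeneousComponent_apply, map_sum, map_sum,
    Finset.sum_filter]
  refine Finset.sum_congr rfl fun d hd => ?_
  rw [Finsupp.degree_eq_sum, Fin.sum_univ_two]
  split_ifs with h
  · rw [← (hmon d _).2, h]
  · exact coeff_eq_zero_of_natDegree_lt
      ((hmon d _).1.trans_lt (lt_of_le_of_ne (hdeg d hd) h))

/-- The inverse substitution. -/
def ofBi (v w : Fin 2 → ℂ) : ℂ[X][X] →+* Poly2 :=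
  eval₂RingHom (eval₂RingHom MvPolynomial.C
    (MvPolynomial.C (v 0 * w 1 - v 1 * w 0)⁻¹ *
      (MvPolynomial.C (w 1) * MvPolynomial.X 0 - MvPolynomial.C (w 0) * MvPolynomial.X 1)))
    (MvPolynomial.C (v 0 * w 1 - v 1 * w 0)⁻¹ *
      (MvPolynomial.C (v 0) * MvPolynomial.X 1 - MvPolynomial.C (v 1) * MvPolynomial.X 0))

theorem eval_ofBi (v w p : Fin 2 → ℂ) (P : ℂ[X][X]) :
    MvPolynomial.eval p (ofBi v w P) =
      P.evalEval ((v 0 * w 1 - v 1 * w 0)⁻¹ * (w 1 * p 0 - w 0 * p 1))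
        ((v 0 * w 1 - v 1 * w 0)⁻¹ * (v 0 * p 1 - v 1 * p 0)) := by
  rw [← coe_evalEvalRingHom, ← RingHom.comp_apply]
  congr 1
  ext <;> simp [ofBi]

/-- The substitution as an isomorphism. -/
def biEquiv (v w : Fin 2 → ℂ) (h : v 0 * w 1 - v 1 * w 0 ≠ 0) : Poly2 ≃+* ℂ[X][X] :=
  RingEquiv.ofRingHom (toBi v w).toRingHom (ofBi v w)
    (by
      have h' : (C (C (v 0 * w 1 - v 1 * w 0)⁻¹) : ℂ[X][X]) * (C (C (v 0)) * C (C (w 1)) -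
          C (C (v 1)) * C (C (w 0))) = 1 := by
        simp only [← C_mul, ← C_sub]
        rw [inv_mul_cancel₀ h, C_1, C_1]
      apply Polynomial.ringHom_ext'
      · apply Polynomial.ringHom_ext'
        · ext a : 1
          simp [ofBi, toBi, Polynomial.algebraMap_apply]
        · simp [ofBi, toBi, Polynomial.algebraMap_apply]
          linear_combination (C X) * h'
      · simp [ofBi, toBi, Polynomial.algebraMap_apply]
        linear_combination X * h')
    (by
      have h' : (MvPolynomial.C (v 0 * w 1 - v 1 * w 0)⁻¹ : Poly2) *
          (MvPolynomial.C (v 0) * MvPolynomial.C (w 1) -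
          MvPolynomial.C (v 1) * MvPolynomial.C (w 0)) = 1 := by
        simp only [← MvPolynomial.C_mul, ← MvPolynomial.C_sub]
        rw [inv_mul_cancel₀ h, MvPolynomial.C_1]
      apply MvPolynomial.ringHom_ext
      · intro a
        simp [ofBi, toBi, Polynomial.algebraMap_apply]
      · intro i
        fin_cases i
        · simp [ofBi, toBi]
          linear_combination (MvPolynomial.X 0) * h'
        · simp [ofBi, toBi]
          linear_combination (MvPolynomial.X 1) * h')

theorem combination_eq {v w : Fin 2 → ℂ} (h : v 0 * w 1 - v 1 * w 0 ≠ 0) (p : Fin 2 → ℂ) :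
    ((v 0 * w 1 - v 1 * w 0)⁻¹ * (w 1 * p 0 - w 0 * p 1)) • v +
      ((v 0 * w 1 - v 1 * w 0)⁻¹ * (v 0 * p 1 - v 1 * p 0)) • w = p := by
  funext i
  fin_cases i <;> simp <;> field_simp <;> ring

/-- In coordinates adapted to `w` the equation is monic and irreducible, and its `t`-derivative is
the derivative of `H` along `w` up to a constant; the statement is then the interpolation result. -/
theorem HasDifferential.exists_directional {H : Poly2} (hirr : Irreducible H) {m : ℕ}
    (hdeg : H.totalDegree ≤ m) {v w : Fin 2 → ℂ} (hvw : v 0 * w 1 - v 1 * w 0 ≠ 0)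
    (hw : MvPolynomial.eval w (MvPolynomial.homogeneousComponent m H) ≠ 0)
    {θ : OneForm} {F : (Fin 2 → ℂ) → ℂ} (hF : HasDifferential H θ F) :
    ∃ Q : Poly2, ∀ p ∈ zeros H, MvPolynomial.eval p Q = F p * formCLM (extd H) p w := by
  set c := MvPolynomial.eval w (MvPolynomial.homogeneousComponent m H) with hc
  obtain ⟨hdeg', hcoeff⟩ := coeff_toBi hdeg v w
  set f : ℂ[X][X] := C (C c⁻¹) * toBi v w H with hf
  have hmonic : f.Monic := by
    refine monic_of_natDegree_le_of_coeff_eq_one m ((natDegree_C_mul_le _ _).trans hdeg') ?_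
    rw [coeff_C_mul, hcoeff, ← C_mul, inv_mul_cancel₀ hw, C_1]
  have hirrf : Irreducible f := by
    have hu : IsUnit (C (C c⁻¹) : ℂ[X][X]) := ((IsUnit.mk0 _ (inv_ne_zero hw)).map C).map C
    rw [hf, irreducible_isUnit_mul hu]
    exact (MulEquiv.irreducible_iff (biEquiv v w hvw)).2 hirr
  have hfe : ∀ s t, f.evalEval s t = c⁻¹ * MvPolynomial.eval (s • v + t • w) H := fun s t => by
    rw [hf, evalEval_mul, evalEval_toBi, evalEval_C, eval_C]
  have hz : ∀ s t, f.evalEval s t = 0 ↔ s • v + t • w ∈ zeros H := fun s t => by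
    rw [hfe, mul_eq_zero, or_iff_right (inv_ne_zero hw)]
    rfl
  have hfd : ∀ s t, (derivative f).evalEval s t = c⁻¹ * formCLM (extd H) (s • v + t • w) w := by
    intro s t
    have h1 : HasDerivAt (fun t => f.evalEval s t) ((derivative f).evalEval s t) t := by
      have := (f.map (evalRingHom s)).hasDerivAt t
      simpa only [derivative_map, map_evalRingHom_eval] using this
    have h2 : HasDerivAt (fun t : ℂ => s • v + t • w) w t := by
      simpa using ((hasDerivAt_id t).smul_const w).const_add (s • v)
    have h3 := ((hasFDerivAt_eval H (s • v + t • w)).comp_hasDerivAt t h2).const_mul c⁻¹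
    refine h1.unique (h3.congr_of_eventuallyEq (Eventually.of_forall fun t => ?_))
    exact hfe s t
  let lin : ℂ × ℂ → Fin 2 → ℂ := fun p => p.1 • v + p.2 • w
  have hlin : Continuous lin := by fun_prop
  have hmaps : MapsTo lin (bizeros f) (zeros H) := fun p hp => (hz p.1 p.2).1 hp
  have hFc : ContinuousOn F (zeros H) := fun p hp => (hF p hp).continuousWithinAt
  have hgraph : HasGraphDeriv f (F ∘ lin)
      (toBi v w (MvPolynomial.C (v 0) * θ 0 + MvPolynomial.C (v 1) * θ 1))
      (toBi v w (MvPolynomial.C (w 0) * θ 0 + MvPolynomial.C (w 1) * θ 1)) := by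
    intro g s g' hg hgz
    have hmem : ∀ᶠ s in 𝓝 s, s • v + g s • w ∈ zeros H := hgz.mono fun s hs => (hz _ _).1 hs
    have h2 : HasDerivAt (fun s : ℂ => s • v + g s • w) (v + g' • w) s := by
      exact (((hasDerivAt_id s).smul_const v).fun_add (hg.smul_const w)).congr_deriv (by simp)
    have h3 := (hF _ hmem.self_of_nhds).comp_hasDerivAt s h2 hmem
    refine h3.congr_deriv ?_
    rw [evalEval_toBi, evalEval_toBi, formCLM_apply, Fin.sum_univ_two]
    simp
    ring
  obtain ⟨P, hP⟩ := hgraph.exists_polynomial hmonic hirrf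
    (hFc.comp hlin.continuousOn hmaps)
  refine ⟨MvPolynomial.C c * ofBi v w P, fun p hp => ?_⟩
  have hcomb := combination_eq hvw p
  rw [map_mul, MvPolynomial.eval_C, eval_ofBi]
  set s := (v 0 * w 1 - v 1 * w 0)⁻¹ * (w 1 * p 0 - w 0 * p 1)
  set t := (v 0 * w 1 - v 1 * w 0)⁻¹ * (v 0 * p 1 - v 1 * p 0)
  have h1 := hP (s, t) ((hz s t).2 (by rwa [hcomb]))
  simp only [Function.comp_apply, hfd, lin, hcomb] at h1
  rw [h1]
  field_simp

theorem exists_eval_ne_zero {q : Poly2} (hq : q ≠ 0) : ∃ p, MvPolynomial.eval p q ≠ 0 := by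
  by_contra! h
  exact hq (MvPolynomial.funext fun p => by rw [h p, map_zero])

/-- A function on the curve with polynomial differential is the restriction of a polynomial. -/
theorem HasDifferential.exists_polynomial {H : Poly2} (hs : IsSmoothCurve H)
    (hirr : Irreducible H) (hT0 : MvPolynomial.homogeneousComponent H.totalDegree H ≠ 0)
    {θ : OneForm} {F : (Fin 2 → ℂ) → ℂ} (hF : HasDifferential H θ F) :
    ∃ f : Poly2, ∀ p ∈ zeros H, F p = MvPolynomial.eval p f := by

  -- Two independent directions off the zeros of the top form are needed. The condition `a 0 ≠ 0`
  -- ensures that the linear form testing independence of `b` from `a` is not zero.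
  obtain ⟨a, ha⟩ := exists_eval_ne_zero (mul_ne_zero hT0 (MvPolynomial.X_ne_zero 0))
  rw [map_mul, MvPolynomial.eval_X] at ha
  have hlin : (MvPolynomial.C (a 0) * MvPolynomial.X 1 - MvPolynomial.C (a 1) * MvPolynomial.X 0 :
      Poly2) ≠ 0 := fun h => by
    have := congrArg (MvPolynomial.eval ![0, 1]) h
    simp [right_ne_zero_of_mul ha] at this
  obtain ⟨b, hb⟩ := exists_eval_ne_zero (mul_ne_zero hT0 hlin)
  simp only [map_mul, map_sub, MvPolynomial.eval_X, MvPolynomial.eval_C] at hb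
  have hab := right_ne_zero_of_mul hb
  obtain ⟨Q₁, hQ₁⟩ := hF.exists_directional hirr le_rfl hab (left_ne_zero_of_mul hb)
  obtain ⟨Q₂, hQ₂⟩ := hF.exists_directional hirr le_rfl (v := b) (w := a)
    (fun h => hab (by linear_combination -h)) (left_ne_zero_of_mul ha)
  obtain ⟨α, β, γ, h1⟩ := exists_jacobian_combination hs
  -- Cramer's rule recovers `F ∂₀H` and `F ∂₁H` from the two directional products; on the curve `β
  -- ∂₀H + γ ∂₁H = 1`, which leaves `F`.
  refine ⟨MvPolynomial.C (a 0 * b 1 - a 1 * b 0)⁻¹ *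
    (β * (MvPolynomial.C (b 1) * Q₂ - MvPolynomial.C (a 1) * Q₁) +
      γ * (MvPolynomial.C (a 0) * Q₁ - MvPolynomial.C (b 0) * Q₂)), fun p hp => ?_⟩
  have h2 := congrArg (MvPolynomial.eval p) h1
  have hp' : MvPolynomial.eval p H = 0 := hp
  simp only [map_add, map_mul, map_one, hp', mul_zero, zero_add] at h2
  simp only [map_add, map_mul, map_sub, MvPolynomial.eval_C, hQ₁ p hp, hQ₂ p hp, formCLM_apply,
    Fin.sum_univ_two, extd]
  have h3 := inv_mul_cancel₀ hab
  linear_combination (-F p) * h2 - F p * (MvPolynomial.eval p β *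
    MvPolynomial.eval p (MvPolynomial.pderiv 0 H) + MvPolynomial.eval p γ *
    MvPolynomial.eval p (MvPolynomial.pderiv 1 H)) * h3

end Potentials

end

end ChenPlane

namespace ChenPlane

noncomputable section

/-! ### Non-degeneracy of the period matrix -/

section Periods

open Set Filter Topology

variable {H : Poly2}

theorem CurveChart.exists_path {q : Fin 2 → ℂ} (C : CurveChart H q) {x y : Curve H}
    (hx : x.1 ∈ C.dom) (hy : y.1 ∈ C.dom) :
    ∃ τ : Path x y, PiecewiseC1 (pathCurve τ) ∧ ∀ t, pathCurve τ t ∈ C.dom := by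
  refine ⟨_, C.piecewiseC1_straight hx hy, fun t => ?_⟩
  exact C.par_mem _ (C.straight hx hy (projIcc 0 1 zero_le_one t)).2

theorem exists_curveChart (hs : IsSmoothCurve H) {p : Fin 2 → ℂ} (hp : p ∈ zeros H) :
    Nonempty (CurveChart H p) :=
  ⟨(exists_chart hs hp univ_mem).choose⟩

/-- The points of a smooth irreducible curve can be joined by paths. -/
theorem joined_of_irreducible (hs : IsSmoothCurve H) (hirr : Irreducible H)
    (hT : MvPolynomial.homogeneousComponent H.totalDegree H ≠ 0) (x y : Curve H) : Joined x y := by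
  classical
  -- The indicator of a path component is locally constant, so its differential is the zero form and
  -- it is the restriction of a polynomial.
  let F : (Fin 2 → ℂ) → ℂ := fun p => if ∃ h : p ∈ zeros H, Joined x ⟨p, h⟩ then 1 else 0
  have hF : HasDifferential H 0 F := by
    intro p hp
    obtain ⟨C⟩ := exists_curveChart hs hp
    have hform : formCLM 0 p = 0 := by ext v; simp [formCLM_apply]
    rw [hform]
    refine (hasFDerivWithinAt_const (F p) p (zeros H)).congr_of_eventuallyEq ?_ rfl
    filter_upwards [self_mem_nhdsWithin, mem_nhdsWithin_of_mem_nhds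
      (C.isOpen_dom.mem_nhds C.mem_dom)] with r hr hrC
    obtain ⟨τ, -⟩ := C.exists_path (x := ⟨p, hp⟩) (y := ⟨r, hr⟩) C.mem_dom hrC
    have hiff : (∃ h : r ∈ zeros H, Joined x ⟨r, h⟩) ↔ ∃ h : p ∈ zeros H, Joined x ⟨p, h⟩ :=
      ⟨fun ⟨_, h⟩ => ⟨hp, h.trans ⟨τ.symm⟩⟩, fun ⟨_, h⟩ => ⟨hr, h.trans ⟨τ⟩⟩⟩
    simp only [F, hiff]
  obtain ⟨f, hf⟩ := hF.exists_polynomial hs hirr hT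
  -- This polynomial is idempotent on the curve, and `H` is prime, so it is constantly `0` or `1`
  -- there.
  have hdvd : H ∣ f * (f - 1) := by
    refine dvd_of_vanish hirr.prime fun p hp => ?_
    rw [map_mul, map_sub, map_one, ← hf p hp]
    by_cases h : ∃ h : p ∈ zeros H, Joined x ⟨p, h⟩ <;> simp [F, h]
  have hx : F x.1 = 1 := if_pos ⟨x.2, Joined.refl x⟩
  rcases hirr.prime.dvd_or_dvd hdvd with ⟨k, hk⟩ | ⟨k, hk⟩
  · rw [hf _ x.2, hk, map_mul, x.2, zero_mul] at hx
    exact absurd hx zero_ne_one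
  · have h1 := congrArg (MvPolynomial.eval y.1) hk
    rw [map_sub, map_one, map_mul, y.2, zero_mul, ← hf _ y.2, sub_eq_zero] at h1
    by_contra hxy
    have h2 : F y.1 = 0 := if_neg fun ⟨_, h⟩ => hxy h
    exact one_ne_zero (h1.symm.trans h2)

variable {p₀ : Curve H}

theorem iterInt_trans_single {x y z : Curve H} {γ : Path x y} {η : Path y z}
    (hγ : PiecewiseC1 (pathCurve γ)) (hη : PiecewiseC1 (pathCurve η)) (θ : OneForm) :
    iterInt (pathCurve (γ.trans η)) [θ] 1 =
      iterInt (pathCurve γ) [θ] 1 + iterInt (pathCurve η) [θ] 1 := by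
  rw [iterInt_trans hγ hη]
  simp only [List.length_cons, List.length_nil, Finset.sum_range_succ, Finset.sum_range_zero]
  simp only [List.take, List.drop]
  simp [iterInt]

/-- A one-form without periods has a potential on the curve. -/
theorem exists_potential (hs : IsSmoothCurve H) (hc : ∀ x y : Curve H, Joined x y) {θ : OneForm}
    (hper : ∀ α : FundamentalGroup (Curve H) p₀, loopIterInt α [θ] = 0) :
    ∃ F, HasDifferential H θ F := by
  classical
  have hex : ∀ x : Curve H, ∃ γ : Path p₀ x, PiecewiseC1 (pathCurve γ) := fun x => by
    obtain ⟨ρ, hρ, -⟩ := exists_piecewiseC1_homotopic hs (hc p₀ x).somePath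
    exact ⟨ρ, hρ⟩
  choose γ hγ using hex
  -- Two paths to the same point differ by a loop, over which the integral vanishes.
  have hindep : ∀ (x : Curve H) (η : Path p₀ x), PiecewiseC1 (pathCurve η) →
      iterInt (pathCurve η) [θ] 1 = iterInt (pathCurve (γ x)) [θ] 1 := by
    intro x η hη
    obtain ⟨ρ, hρ, hh⟩ := exists_piecewiseC1_homotopic hs (η.trans (γ x).symm)
    have h1 : η.Homotopic (ρ.trans (γ x)) := by
      refine Path.Homotopic.trans ?_ (hh.hcomp (Path.Homotopic.refl (γ x)))
      refine Path.Homotopic.symm ?_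
      refine Path.Homotopic.trans ⟨Path.Homotopy.transAssoc _ _ _⟩ ?_
      refine Path.Homotopic.trans ((Path.Homotopic.refl η).hcomp
        (Path.Homotopic.symm ⟨Path.Homotopy.reflSymmTrans (γ x)⟩)) ?_
      exact ⟨Path.Homotopy.transRefl η⟩
    rw [iterInt_eq_of_homotopic hs hη (piecewiseC1_trans hρ (hγ x)) h1,
      iterInt_trans_single hρ (hγ x)]
    have h2 := hper (loopClass ρ)
    rw [loopIterInt_loopClass hs hρ] at h2
    change iterInt (pathCurve ρ) [θ] 1 = 0 at h2
    rw [h2, zero_add]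
  let F : (Fin 2 → ℂ) → ℂ := fun p =>
    if h : p ∈ zeros H then iterInt (pathCurve (γ ⟨p, h⟩)) [θ] 1 else 0
  refine ⟨F, fun q hq => ?_⟩
  obtain ⟨C⟩ := exists_curveChart hs hq
  -- With initial value `1` on the empty word and `0` elsewhere, the component of `ψ` at `[θ]` is
  -- the increment of `F` from `q` inside the chart.
  obtain ⟨ψ, hψ, hψq⟩ := C.exists_isFlat q fun ws => iterInt (fun _ => q) ws 0
  have hd := (hψ.cons θ [] q C.mem_dom hq).const_add (F q)
  simp only [hψq, iterInt, one_smul] at hd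
  refine hd.congr_of_eventuallyEq ?_ ?_
  · filter_upwards [self_mem_nhdsWithin, mem_nhdsWithin_of_mem_nhds
      (C.isOpen_dom.mem_nhds C.mem_dom)] with r hr hrC
    obtain ⟨τ, hτ, hτC⟩ := C.exists_path (x := ⟨q, hq⟩) (y := ⟨r, hr⟩) C.mem_dom hrC
    have h0 : pathCurve τ 0 = q := by simp [pathCurve]
    have h1 : pathCurve τ 1 = r := by simp [pathCurve]
    have h2 := hψ.apply_eq_iterInt hτ (pathCurve_mem_zeros τ) (a := 0) (b := 1)
      ⟨le_rfl, zero_le_one⟩ (by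
        rw [h0, hψq]
        funext ws
        cases ws with
        | nil => rfl
        | cons θ ws => rw [iterInt_zero_cons, iterInt_zero_cons])
      ⟨zero_le_one, le_rfl⟩ fun t _ => hτC t
    rw [h1] at h2
    rw [h2]
    simp only [F, dif_pos hr, dif_pos hq]
    rw [← hindep _ _ (piecewiseC1_trans (hγ ⟨q, hq⟩) hτ), iterInt_trans_single (hγ _) hτ]
  · simp only [hψq, iterInt_zero_cons, add_zero]

theorem loopIterInt_sum (hs : IsSmoothCurve H) (α : FundamentalGroup (Curve H) p₀) {ι : Type*}
    (s : Finset ι) (a : ι → ℂ) (ω : ι → OneForm) :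
    loopIterInt α [∑ i ∈ s, a i • ω i] = ∑ i ∈ s, a i * loopIterInt α [ω i] := by
  obtain ⟨γ, hγ, rfl⟩ := exists_piecewiseC1_loop hs α
  simp only [loopIterInt_loopClass hs hγ]
  simp only [iterInt, one_mul]
  have h : ∀ t, pullback (curveOf γ) (∑ i ∈ s, a i • ω i) t =
      ∑ i ∈ s, a i * pullback (curveOf γ) (ω i) t := fun t => by
    simp only [pullback, Finset.sum_apply, Pi.smul_apply, map_sum, MvPolynomial.smul_eval,
      Finset.sum_mul, Finset.mul_sum, mul_assoc]
    exact Finset.sum_comm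
  simp only [h]
  rw [intervalIntegral.integral_finsetSum fun i _ => ?_]
  · simp only [intervalIntegral.integral_const_mul]
  · have := hγ.intervalIntegrable_iterInt_mul [] (ω i) (left_mem_Icc.2 zero_le_one)
      (right_mem_Icc.2 zero_le_one)
    simp only [iterInt, one_mul] at this
    exact this.const_mul _

/-- A one-form whose integrals over a homology basis vanish has no periods. -/
theorem loopIterInt_eq_zero (hs : IsSmoothCurve H) {N : ℕ}
    {δ : Fin N → FundamentalGroup (Curve H) p₀} (hδ : IsHomologyBasis δ) {θ : OneForm}
    (h : ∀ j, loopIterInt (δ j) [θ] = 0) (α : FundamentalGroup (Curve H) p₀) :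
    loopIterInt α [θ] = 0 := by
  -- Length-one integrals have no mixed terms in the product formula, so they define a homomorphism
  -- to `ℂ`, which factors through the abelianization.
  let φ : FundamentalGroup (Curve H) p₀ →* Multiplicative ℂ :=
    { toFun := fun α => Multiplicative.ofAdd (loopIterInt α [θ])
      map_one' := by rw [loopIterInt_one_cons hs]; rfl
      map_mul' := fun α β => by
        rw [← ofAdd_add, loopIterInt_mul hs]
        simp only [List.length_cons, List.length_nil, Finset.sum_range_succ,
          Finset.sum_range_zero, List.take, List.drop, loopIterInt_nil hs]
        simp [add_comm] }
  let Φ : Additive (Abelianization (FundamentalGroup (Curve H) p₀)) →+ ℂ :=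
    MonoidHom.toAdditiveLeft (Abelianization.lift φ)
  have hΦ : ∀ α, Φ (Additive.ofMul (Abelianization.of α)) = loopIterInt α [θ] := fun α => by
    change Multiplicative.toAdd (Abelianization.lift φ (Abelianization.of α)) = _
    rw [Abelianization.lift_apply_of]
    rfl
  have hz : Φ.toIntLinearMap = 0 := by
    refine LinearMap.ext_on_range hδ.2 fun j => ?_
    rw [AddMonoidHom.coe_toIntLinearMap, hΦ, h j, LinearMap.zero_apply]
  rw [← hΦ α]
  exact LinearMap.congr_fun hz _

/-! ### Passage from potentials to the Petrov module -/

/-- Two differentials of one function agree on the tangent line of the curve. -/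
theorem wedge_eq_zero (hs : IsSmoothCurve H) {F : (Fin 2 → ℂ) → ℂ} {θ θ' : OneForm}
    {p : Fin 2 → ℂ} (hp : p ∈ zeros H) (h : HasFDerivWithinAt F (formCLM θ p) (zeros H) p)
    (h' : HasFDerivWithinAt F (formCLM θ' p) (zeros H) p) :
    MvPolynomial.eval p ((θ 0 - θ' 0) * MvPolynomial.pderiv 1 H -
      (θ 1 - θ' 1) * MvPolynomial.pderiv 0 H) = 0 := by
  obtain ⟨C⟩ := exists_curveChart hs hp
  have hmem : p C.idx ∈ Metric.ball (p C.idx) C.rad := Metric.mem_ball_self C.rad_pos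
  have hpar := C.par_of_mem p C.mem_dom hp
  set v := deriv C.par (p C.idx) with hv
  have h1 : formCLM θ p v = formCLM θ' p v := by
    have e1 := C.hasDerivAt_comp_par hmem (η := formCLM θ p) (by rwa [hpar])
    have e2 := C.hasDerivAt_comp_par hmem (η := formCLM θ' p) (by rwa [hpar])
    exact e1.unique e2
  have h2 : formCLM (extd H) p v = 0 := by
    have e1 : HasDerivAt (fun z => MvPolynomial.eval (C.par z) H) (formCLM (extd H) p v)
        (p C.idx) := by
      have e0 : HasFDerivAt (fun x => MvPolynomial.eval x H) (formCLM (extd H) p)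
          (C.par (p C.idx)) := by
        rw [hpar]
        exact hasFDerivAt_eval H p
      exact e0.comp_hasDerivAt _ (C.hasDerivAt_par hmem)
    have e2 : HasDerivAt (fun z => MvPolynomial.eval (C.par z) H) 0 (p C.idx) :=
      (hasDerivAt_const _ (0 : ℂ)).congr_of_eventuallyEq
        (Filter.mem_of_superset (Metric.isOpen_ball.mem_nhds hmem) C.par_zeros)
    exact e1.unique e2
  have h3 : v C.idx = 1 := by
    have e1 := hasDerivAt_pi.1 (C.hasDerivAt_par hmem) C.idx
    have e2 : HasDerivAt (fun z => C.par z C.idx) 1 (p C.idx) := by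
      simp only [C.par_idx]
      exact hasDerivAt_id _
    exact e1.unique e2
  simp only [formCLM_apply, Fin.sum_univ_two, extd] at h1 h2
  simp only [map_sub, map_mul]
  set a₀ := MvPolynomial.eval p (θ 0)
  set a₁ := MvPolynomial.eval p (θ 1)
  set b₀ := MvPolynomial.eval p (θ' 0)
  set b₁ := MvPolynomial.eval p (θ' 1)
  set c₀ := MvPolynomial.eval p (MvPolynomial.pderiv 0 H)
  set c₁ := MvPolynomial.eval p (MvPolynomial.pderiv 1 H)
  have hi : C.idx = 0 ∨ C.idx = 1 := by
    generalize C.idx = i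
    fin_cases i <;> simp
  rcases hi with hi | hi <;> rw [hi] at h3
  · linear_combination (-(a₀ - b₀) * c₁ + (a₁ - b₁) * c₀) * h3 + c₁ * h1 - (a₁ - b₁) * h2
  · linear_combination (-(a₀ - b₀) * c₁ + (a₁ - b₁) * c₀) * h3 - c₀ * h1 + (a₀ - b₀) * h2

theorem petrovClass_smul (H : Poly2) (q : ℂ[X]) (θ : OneForm) :
    q • petrovClass H θ = petrovClass H (Polynomial.aeval H q • θ) :=
  rfl

theorem petrovClass_sum (H : Poly2) {ι : Type*} (s : Finset ι) (a : ι → ℂ) (ω : ι → OneForm) :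
    petrovClass H (∑ i ∈ s, a i • ω i) = ∑ i ∈ s, Polynomial.C (a i) • petrovClass H (ω i) := by
  have h : ∀ i, a i • ω i = Polynomial.aeval H (Polynomial.C (a i)) • ω i := fun i => by
    rw [Polynomial.aeval_C, algebraMap_smul]
  simp only [h, petrovClass_smul]
  exact map_sum (relExact H).mkQ (fun i => (show FormOver H from
    Polynomial.aeval H (Polynomial.C (a i)) • ω i)) s

/-- A one-form with a potential on the curve is divisible by `h` in the Petrov module. -/
theorem HasDifferential.petrovClass_eq (hs : IsSmoothCurve H) (hirr : Irreducible H)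
    (hT : MvPolynomial.homogeneousComponent H.totalDegree H ≠ 0)
    {θ : OneForm} {F : (Fin 2 → ℂ) → ℂ} (hF : HasDifferential H θ F) :
    ∃ ξ : PetrovModule H, petrovClass H θ = (Polynomial.X : ℂ[X]) • ξ := by
  obtain ⟨f, hf⟩ := hF.exists_polynomial hs hirr hT
  obtain ⟨κ, hκ⟩ := dvd_of_vanish hirr.prime (q := (θ 0 - extd f 0) * MvPolynomial.pderiv 1 H -
      (θ 1 - extd f 1) * MvPolynomial.pderiv 0 H) fun p hp =>
    wedge_eq_zero hs hp (hF p hp) ((hasFDerivAt_eval f p).hasFDerivWithinAt.congr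
      (fun x hx => hf x hx) (hf p hp))
  obtain ⟨α, β, γ, h1⟩ := exists_jacobian_combination hs
  -- Multiplying `θ - df` by `1 = α H + β ∂₀H + γ ∂₁H` and exchanging the cross terms by means of
  -- `(θ - df) ∧ dH = κ H` gives `θ - df = H η + b dH`.
  set b := β * (θ 0 - extd f 0) + γ * (θ 1 - extd f 1) with hb
  let η : OneForm := ![α * (θ 0 - extd f 0) + γ * κ, α * (θ 1 - extd f 1) - β * κ]
  refine ⟨petrovClass H η, ?_⟩
  rw [petrovClass_smul, Polynomial.aeval_X]
  refine (Submodule.Quotient.eq _).2 ?_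
  refine ⟨b, f, ?_⟩
  funext i
  change θ i - H * η i = b * extd H i + extd f i
  fin_cases i
  · change θ 0 - H * (α * (θ 0 - extd f 0) + γ * κ) = b * MvPolynomial.pderiv 0 H + extd f 0
    rw [hb]
    linear_combination (-(θ 0 - extd f 0)) * h1 + γ * hκ
  · change θ 1 - H * (α * (θ 1 - extd f 1) - β * κ) = b * MvPolynomial.pderiv 1 H + extd f 1
    rw [hb]
    linear_combination (-(θ 1 - extd f 1)) * h1 - β * hκ

/-- Expanding `ξ` in the basis makes each constant `a i` equal to a multiple of `X`; evaluation at
`0` gives `a i = 0`. -/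
theorem eq_zero_of_petrovClass {ι : Type*} [Fintype ι] {M : Type*} [AddCommGroup M] [Module ℂ[X] M]
    {b : ι → M} (hli : LinearIndependent ℂ[X] b) (hsp : Submodule.span ℂ[X] (range b) = ⊤)
    {a : ι → ℂ} {ξ : M} (h : ∑ i, Polynomial.C (a i) • b i = (Polynomial.X : ℂ[X]) • ξ) : a = 0 := by
  obtain ⟨q, rfl⟩ := (Submodule.mem_span_range_iff_exists_fun ℂ[X]).1
    (hsp ▸ Submodule.mem_top : ξ ∈ Submodule.span ℂ[X] (range b))
  have h1 : ∑ i, (Polynomial.C (a i) - Polynomial.X * q i) • b i = 0 := by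
    simp only [sub_smul, mul_smul, Finset.sum_sub_distrib, ← Finset.smul_sum]
    rw [h, sub_self]
  have h2 := Fintype.linearIndependent_iff.1 hli _ h1
  funext i
  simpa using congrArg (Polynomial.eval 0) (h2 i)

/-- The period matrix of the basic forms over a homology basis is invertible. -/
theorem isUnit_det_period {n : ℕ} (hdeg : H.totalDegree = n + 1)
    (hinf : Squarefree (MvPolynomial.homogeneousComponent (n + 1) H))
    (hpetrov : BasicFormsPetrovBasis n H) (hs : IsSmoothCurve H)
    (e : Fin (n ^ 2) ≃ Fin n × Fin n) {ω : Fin (n ^ 2) → OneForm}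
    (hω : ∀ l, ω l = basicForm (e l)) {δ : Fin (n ^ 2) → FundamentalGroup (Curve H) p₀}
    (hδ : IsHomologyBasis δ) :
    IsUnit (Matrix.of fun i j => loopIterInt (δ j) [ω i]).det := by
  have hirr := irreducible_of_smooth hdeg hinf hs
  have hT : MvPolynomial.homogeneousComponent H.totalDegree H ≠ 0 := by
    rw [hdeg]; exact hinf.ne_zero
  rw [isUnit_iff_ne_zero]
  intro hdet
  -- A left kernel vector is a constant combination of the forms whose integrals over all `δ j`
  -- vanish.
  obtain ⟨a, ha0, ha⟩ := Matrix.exists_vecMul_eq_zero_iff.2 hdet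
  refine ha0 ?_
  have hper : ∀ α : FundamentalGroup (Curve H) p₀, loopIterInt α [∑ i, a i • ω i] = 0 :=
    loopIterInt_eq_zero hs hδ fun j => by
      rw [loopIterInt_sum hs]
      exact congrFun ha j
  obtain ⟨F, hF⟩ := exists_potential hs (joined_of_irreducible hs hirr hT) hper
  obtain ⟨ξ, hξ⟩ := hF.petrovClass_eq hs hirr hT
  rw [petrovClass_sum] at hξ
  have hfun : (fun l => petrovClass H (ω l)) =
      (fun ij : Fin n × Fin n => petrovClass H (basicForm ij)) ∘ e := by
    funext l; simp [hω]
  refine eq_zero_of_petrovClass (b := fun l => petrovClass H (ω l)) ?_ ?_ hξ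
  · rw [hfun]
    exact hpetrov.1.comp _ e.injective
  · rw [hfun, e.surjective.range_comp]
    exact hpetrov.2

end Periods

end

end ChenPlane

/-! ### The basis of the truncated algebra and the determinant -/

theorem mainTheorem4 (n : ℕ) (H : ChenPlane.Poly2)
    (hdeg : H.totalDegree = n + 1)
    (hinf : Squarefree (MvPolynomial.homogeneousComponent (n + 1) H))
    (hpetrov : ChenPlane.BasicFormsPetrovBasis n H)
    (hsmooth : ChenPlane.IsSmoothCurve H)
    (p₀ : ChenPlane.Curve H)
    (e : Fin (n ^ 2) ≃ Fin n × Fin n)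
    (ω : Fin (n ^ 2) → ChenPlane.OneForm) (hω : ∀ l, ω l = ChenPlane.basicForm (e l))
    (δ : Fin (n ^ 2) → FundamentalGroup (ChenPlane.Curve H) p₀)
    (hδ : ChenPlane.IsHomologyBasis δ)
    (K : ℕ) :
    -- integrals over homotopy classes are well defined
    ((∀ α : FundamentalGroup (ChenPlane.Curve H) p₀,
        ∃ γ : Path p₀ p₀, ChenPlane.PiecewiseC1 (ChenPlane.curveOf γ) ∧
          ChenPlane.loopClass γ = α) ∧
      (∀ γ : Path p₀ p₀, ChenPlane.PiecewiseC1 (ChenPlane.curveOf γ) →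
        ∀ ws : List ChenPlane.OneForm,
          ChenPlane.loopIterInt (ChenPlane.loopClass γ) ws =
            ChenPlane.iterInt (ChenPlane.curveOf γ) ws 1)) ∧
    -- the truncated Chen map is multiplicative
    (ChenPlane.chenTrunc ω K (1 : FundamentalGroup (ChenPlane.Curve H) p₀) = 1 ∧
      ∀ α β : FundamentalGroup (ChenPlane.Curve H) p₀,
        ChenPlane.chenTrunc ω K (α * β) =
          ChenPlane.chenTrunc ω K α * ChenPlane.chenTrunc ω K β) ∧
    -- the images of the products of at most `K` generators are a basis
    (∃ b : Module.Basis (ChenPlane.Word (n ^ 2) K) ℂ (ChenPlane.UTrunc (n ^ 2) K),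
      ∀ w, b w = ChenPlane.chenTrunc ω K (ChenPlane.wordProd δ w)) ∧
    -- the matrix of basic iterated integrals is non-degenerate
    (ChenPlane.iterMatrix ω δ K).det ≠ 0 := by
  have hs := hsmooth
  have hchen : ∀ w : ChenPlane.Word (n ^ 2) K,
      ChenPlane.chenTrunc ω K (ChenPlane.wordProd δ w) =
        (w.letters.map fun j => ChenPlane.trunc K (ChenPlane.chen ω (δ j))).prod := by
    intro w
    unfold ChenPlane.wordProd
    induction w.letters with
    | nil => exact ChenPlane.chenTrunc_one hs ω K
    | cons j l ih =>
      rw [List.map_cons, List.prod_cons, ChenPlane.chenTrunc_mul hs, ih, List.map_cons,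
        List.prod_cons]
      rfl
  have hspan := ChenPlane.span_words_eq_top K (fun j => ChenPlane.chen ω (δ j))
    (fun j => ChenPlane.loopIterInt_nil hs (δ j))
    (ChenPlane.isUnit_det_period hdeg hinf hpetrov hs e hω hδ)
  simp only [← hchen] at hspan
  -- Words index both the spanning family and the monomial basis, so spanning already implies being
  -- a basis.
  have hcard : Fintype.card (ChenPlane.Word (n ^ 2) K) =
      Module.finrank ℂ (ChenPlane.UTrunc (n ^ 2) K) := by
    rw [← (ChenPlane.truncEquiv (n ^ 2) K).finrank_eq, Module.finrank_fintype_fun_eq_card]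
  let b := basisOfTopLeSpanOfCardEqFinrank
    (fun w => ChenPlane.chenTrunc ω K (ChenPlane.wordProd δ w)) hspan.ge hcard
  have hb : ∀ w, b w = ChenPlane.chenTrunc ω K (ChenPlane.wordProd δ w) := fun w => by
    rw [coe_basisOfTopLeSpanOfCardEqFinrank]
  refine ⟨⟨ChenPlane.exists_piecewiseC1_loop hs,
    fun γ hγ ws => ChenPlane.loopIterInt_loopClass hs hγ ws⟩,
    ⟨ChenPlane.chenTrunc_one hs ω K, ChenPlane.chenTrunc_mul hs ω K⟩, ⟨b, hb⟩, ?_⟩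
  -- The monomial coordinates of a Chen image are its iterated integrals, so `S_K` is a
  -- change-of-basis matrix.
  have hmat : ChenPlane.iterMatrix ω δ K = (Pi.basisFun ℂ (ChenPlane.Word (n ^ 2) K)).toMatrix
      (b.map (ChenPlane.truncEquiv (n ^ 2) K).symm) := by
    ext u w
    rw [Module.Basis.toMatrix_apply, Module.Basis.map_apply, hb, ChenPlane.chenTrunc,
      ← ChenPlane.truncEquiv_apply, LinearEquiv.symm_apply_apply, Pi.basisFun_repr]
    rfl
  rw [hmat]
  exact (Module.Basis.isUnit_det _ _).ne_zero
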